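/- Let $A$ be a combinatorial problem: each instance, described by a finite sequence of integers, has a ground set $U$ of $n\ge 1$ elements and a family $\mathcal F$ of feasible subsets of $U$. Suppose that there is a pseudopolynomial algorithm for the exact version of $A$, that is, an algorithm which, given an instance of $A$, a nonnegative integer weight for every element and a target integer $K\ge 0$, decides whether some $S\in\mathcal F$ has total weight exactly $K$, in time polynomial in $n$ and in the largest integer occurring among $K$ and the weights. (Algorithms are programs for a random access machine with logarithmic cost.) In the expected utility maximization problem $\mathsf{EUM}(A)$ the weights $w_e$, $e\in U$, are independent nonnegative random variables, and one looks for a feasible $S\in\mathcal F$ that maximizes $\mathbb E[\mu(w(S))]$, where $w(S)=\sum_{e\in S}w_e$ and $\mu:[0,\infty)\to\mathbb R$ is a (measurable) utility function that is not part of the instance. Suppose that for every $\epsilon=1/N$, $N\in\mathbb N_{\ge1}$, we are given an exponential sum $\widetilde\mu_\epsilon(x)=\sum_{k=1}^{L}c_k\phi_k^x$ with $|\widetilde\mu_\epsilon(x)-\mu(x)|\le\epsilon$ for all $x\ge 0$. Here $c_k,\phi_k\in\mathbb C$, $|\phi_k|\le 1$, any branch of the complex power $x\mapsto\phi_k^x$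 is allowed, and $L\ge1$, $c_k$, $\phi_k$ depend on $\epsilon$ (and on $\mu$) but not on the instance. Algorithms for $\mathsf{EUM}(A)$ can read the description of the instance, $\epsilon$, the numbers $L$, and integer approximations, to any requested precision, of the coefficients $c_k$ and of the expectations $\mathbb E[\phi_k^{w_e}]$ ($e\in U$, $k\le L$), for the sums of all accuracies. Then there are an algorithm and a constant $C$, both depending only on $A$, such that for all such $\mu$ and $\widetilde\mu_\epsilon$, every $\epsilon=1/N\le 1/2$, every instance with $\mathcal F\neq\emptyset$ and all such random weights, the algorithm finds a solution $S\in\mathcal F$ with $$\mathbb E[\mu(w(S))]\ \ge\ \max_{S'\in\mathcal F}\mathbb E[\mu(w(S'))]-C\epsilon$$ in time at most $$\Bigl(\frac{n}{\epsilon}\cdot\max\Bigl\{1,\sum_{k=1}^{L}|c_k|\Bigr\}\Bigr)^{C L}.$$ In particular the time is $(n/\epsilon)^{O(L)}$ when the coefficients are bounded by constants: if $\sum_k|c_k|\le(1/\epsilon)^{D}$ for some $D\in\mathbb N$, it is at most $(n/\epsilon)^{C(D+1)L}$. Moreover, if the optimal expected utility is $\Theta(1)$, we obtain a PTAS: for every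 constant $\kappa>0$ there is an algorithm which, for every $\mu$ and $\widetilde\mu_\epsilon$ as above and every $\delta=1/N$ ($N\in\mathbb N_{\ge1}$), finds on all instances with $\max_{S'\in\mathcal F}\mathbb E[\mu(w(S'))]\ge\kappa$ a solution $S\in\mathcal F$ with $\mathbb E[\mu(w(S))]\ge(1-\delta)\max_{S'\in\mathcal F}\mathbb E[\mu(w(S'))]$, in time bounded by a polynomial in $n$ that depends only on $A$, $\kappa$, $\mu$, the sums $\widetilde\mu_\epsilon$ and $\delta$. -/

import Mathlib

open MeasureTheory ProbabilityTheory
open scoped NNReal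

/-! ### The machine model

A random access machine with integer registers, finitely many arrays (each one indexed by `ℤ` and
initially zero) and a read-only input, programmed in a while-language.  The cost is the
*logarithmic* one: every evaluation of an expression pays for the bit length of every value that
occurs in it (operands, addresses, results), so that the cost is polynomially related to the
running time of Turing machines. -/

namespace RAM

/-- The binary operations; comparisons return `1` (true) or `0` (false). -/
inductive Op where
  | add | sub | mul | div | le | eq

/-- The value of a binary operation (integer division, with `x / 0 = 0`). -/
def Op.apply : Op → ℤ → ℤ → ℤ
  | .add, x, y => x + y
  | .sub, x, y => x - y
  | .mul, x, y => x * y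
  | .div, x, y => x / y
  | .le, x, y => if x ≤ y then 1 else 0
  | .eq, x, y => if x = y then 1 else 0

/-- Expressions: constants, reading cell `i` of array `a`, reading the cell of the read-only input
channel `a` with index tuple `args`, and binary operations. -/
inductive Expr where
  | const (z : ℤ)
  | mem (a : ℕ) (i : Expr)
  | inp (a : ℕ) {r : ℕ} (args : Fin r → Expr)
  | op (o : Op) (e₁ e₂ : Expr)

/-- Programs. -/
inductive Cmd where
  /-- do nothing -/
  | skip
  /-- the assignment `a[i] := e` -/
  | assign (a : ℕ) (i e : Expr)
  /-- reset all cells of the array `a` to zero (allocate a fresh array under the name `a`) -/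
  | clear (a : ℕ)
  /-- sequential composition -/
  | seq (c₁ c₂ : Cmd)
  /-- branch on `e ≠ 0` -/
  | ite (e : Expr) (c₁ c₂ : Cmd)
  /-- loop as long as `e ≠ 0` -/
  | loop (e : Expr) (c : Cmd)

/-- The read-only input: channels, each one a table indexed by tuples of integers. -/
abbrev Input := ℕ → List ℤ → ℤ

/-- The memory: array `a`, cell `i`. -/
abbrev Mem := ℕ → ℤ → ℤ

/-- Bit length of an integer. -/
def bits (z : ℤ) : ℕ := Nat.size z.natAbs

/-- Value of an expression. -/
def Expr.eval (I : Input) (m : Mem) : Expr → ℤ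
  | .const z => z
  | .mem a i => m a (i.eval I m)
  | .inp a args => I a (List.ofFn fun j => (args j).eval I m)
  | .op o e₁ e₂ => o.apply (e₁.eval I m) (e₂.eval I m)

/-- Cost of evaluating an expression: each node costs one plus the bit length of its value. -/
def Expr.cost (I : Input) (m : Mem) : Expr → ℕ
  | .const z => 1 + bits z
  | .mem a i => 1 + bits ((Expr.mem a i).eval I m) + i.cost I m
  | .inp a args => 1 + bits ((Expr.inp a args).eval I m) + ∑ j, (args j).cost I m
  | .op o e₁ e₂ => 1 + bits ((Expr.op o e₁ e₂).eval I m) + e₁.cost I m + e₂.cost I m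

/-- The memory after `a[i] := v`. -/
def Mem.set (m : Mem) (a : ℕ) (i v : ℤ) : Mem :=
  fun b j => if b = a ∧ j = i then v else m b j

/-- The memory after resetting the array `a`. -/
def Mem.reset (m : Mem) (a : ℕ) : Mem :=
  fun b j => if b = a then 0 else m b j

/-- `Run I c m m' t`: on input `I` the program `c`, started in the memory `m`, halts in the
memory `m'` after total cost `t`. -/
inductive Run (I : Input) : Cmd → Mem → Mem → ℕ → Prop where
  | skip (m : Mem) : Run I .skip m m 1
  | assign (m : Mem) (a : ℕ) (i e : Expr) :
      Run I (.assign a i e) m (m.set a (i.eval I m) (e.eval I m)) (1 + i.cost I m + e.cost I m)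
  | clear (m : Mem) (a : ℕ) : Run I (.clear a) m (m.reset a) 1
  | seq {c₁ c₂ : Cmd} {m m₁ m₂ : Mem} {t₁ t₂ : ℕ} :
      Run I c₁ m m₁ t₁ → Run I c₂ m₁ m₂ t₂ → Run I (.seq c₁ c₂) m m₂ (1 + t₁ + t₂)
  | iteTrue {e : Expr} {c₁ c₂ : Cmd} {m m' : Mem} {t : ℕ} :
      e.eval I m ≠ 0 → Run I c₁ m m' t → Run I (.ite e c₁ c₂) m m' (1 + e.cost I m + t)
  | iteFalse {e : Expr} {c₁ c₂ : Cmd} {m m' : Mem} {t : ℕ} :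
      e.eval I m = 0 → Run I c₂ m m' t → Run I (.ite e c₁ c₂) m m' (1 + e.cost I m + t)
  | loopStop {e : Expr} {c : Cmd} {m : Mem} :
      e.eval I m = 0 → Run I (.loop e c) m m (1 + e.cost I m)
  | loopStep {e : Expr} {c : Cmd} {m m₁ m₂ : Mem} {t₁ t₂ : ℕ} :
      e.eval I m ≠ 0 → Run I c m m₁ t₁ → Run I (.loop e c) m₁ m₂ t₂ →
        Run I (.loop e c) m m₂ (1 + e.cost I m + t₁ + t₂)

/-- The subset of an `n`-element ground set that is written in array `0` at the end of a run. -/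
def outputSet (n : ℕ) (m : Mem) : Finset (Fin n) :=
  Finset.univ.filter fun e => m 0 ((e : ℕ) : ℤ) = 1

end RAM

/-! ### Combinatorial problems and their exact versions -/

/-- A combinatorial problem: every instance, described by a finite sequence of integers, has a
ground set `{0, …, n - 1}` and a family of feasible subsets of it. -/
structure CombProblem where
  Inst : Type
  /-- the description of an instance that algorithms get to read -/
  encode : Inst → List ℤ
  /-- the number of elements of the ground set -/
  n : Inst → ℕ
  /-- the feasible solutions -/
  feasible : (I : Inst) → Set (Finset (Fin (n I)))

namespace CombProblem

variable (A : CombProblem)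

/-- Input of the exact version: the number `n` of elements (channel `0`), the description of the
instance and its length (channel `1`), the target (channel `2`), the weights (channel `3`). -/
def exactInput (I : A.Inst) (wt : Fin (A.n I) → ℕ) (K : ℕ) : RAM.Input
  | 0, [] => A.n I
  | 1, [] => (A.encode I).length
  | 1, [i] => if 0 ≤ i then (A.encode I).getD i.toNat 0 else 0
  | 2, [] => K
  | 3, [e] => if h : 0 ≤ e ∧ e.toNat < A.n I then wt ⟨e.toNat, h.2⟩ else 0
  | _, _ => 0

/-- There is a pseudopolynomial algorithm for the exact version of `A`: given an instance, natural
weights of the elements and a target `K`, it decides whether there is a feasible solution of weight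
exactly `K`, in time polynomial in `n` and the largest integer occurring among `K` and the
weights. -/
def HasPseudopolyExact : Prop :=
  ∃ (Q : RAM.Cmd) (d : ℕ), ∀ (I : A.Inst) (wt : Fin (A.n I) → ℕ) (K : ℕ),
    ∃ (m : RAM.Mem) (t : ℕ), RAM.Run (A.exactInput I wt K) Q 0 m t ∧
      (m 0 0 = 1 ↔ ∃ S ∈ A.feasible I, ∑ e ∈ S, wt e = K) ∧
      ∀ T : ℕ, K ≤ T → (∀ e, wt e ≤ T) → t ≤ d * (A.n I + T + 1) ^ d

end CombProblem

/-! ### Random weights and expected utility -/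

/-- Independent nonnegative random weights of `n` elements. -/
structure RandomWeights (n : ℕ) where
  Ω : Type
  [mΩ : MeasurableSpace Ω]
  ν : Measure Ω
  [prob : IsProbabilityMeasure ν]
  w : Fin n → Ω → ℝ≥0
  measurable_w : ∀ e, Measurable (w e)
  indep : iIndepFun w ν

namespace RandomWeights

attribute [instance] RandomWeights.mΩ RandomWeights.prob

variable {n : ℕ} (W : RandomWeights n)

/-- The random weight `w(S) = ∑_{e ∈ S} w_e` of a set `S` of elements. -/
def total (S : Finset (Fin n)) (ω : W.Ω) : ℝ≥0 := ∑ e ∈ S, W.w e ω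

/-- The expected utility `𝔼[μ(w(S))]`. -/
noncomputable def expectedUtility (μ : ℝ≥0 → ℝ) (S : Finset (Fin n)) : ℝ :=
  ∫ ω, μ (W.total S ω) ∂W.ν

end RandomWeights

/-! ### Exponential sums -/

/-- An exponential sum `x ↦ ∑_{k < L} c_k φ_k ^ x` with complex `c_k`, `φ_k` and `|φ_k| ≤ 1`.  The
integer `branch k` selects the branch of the complex power `x ↦ φ_k ^ x` (`0` is the principal
one), so that every `x ↦ exp (ζ x)` with `Re ζ ≤ 0` is allowed as a term. -/
structure ExpSum where
  L : ℕ
  L_pos : 0 < L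
  c : Fin L → ℂ
  φ : Fin L → ℂ
  branch : Fin L → ℤ
  norm_le : ∀ k, ‖φ k‖ ≤ 1

namespace ExpSum

variable (E : ExpSum)

/-- The function `x ↦ φ_k ^ x`. -/
noncomputable def pow (k : Fin E.L) (x : ℝ≥0) : ℂ :=
  E.φ k ^ (((x : ℝ) : ℂ)) * Complex.exp (2 * Real.pi * Complex.I * E.branch k * ((x : ℝ) : ℂ))

/-- The value of the exponential sum. -/
noncomputable def eval (x : ℝ≥0) : ℂ := ∑ k, E.c k * E.pow k x

/-- The exponential sum is an `ε`-approximation of `μ` on `[0, ∞)`. -/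
def Approximates (μ : ℝ≥0 → ℝ) (ε : ℝ) : Prop := ∀ x, ‖E.eval x - (μ x : ℂ)‖ ≤ ε

/-- `∑ |c_k|`. -/
noncomputable def coeffNorm : ℝ := ∑ k, ‖E.c k‖

/-- The number `𝔼[φ_k ^ {w_e}]`. -/
noncomputable def expect {n : ℕ} (W : RandomWeights n) (k : Fin E.L) (e : Fin n) : ℂ :=
  ∫ ω, E.pow k (W.w e ω) ∂W.ν

end ExpSum

/-! ### The input of the expected utility maximization problem -/

/-- The real number `x` is presented by the integers `f 0, f 1, …`: asked for precision `m`, the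
presentation returns an integer `f m` with `|f m / m - x| ≤ 1 / m`. -/
def Presents (f : ℕ → ℤ) (x : ℝ) : Prop := ∀ m : ℕ, |(f m : ℝ) - m * x| ≤ 1

/-- Presentations of real and imaginary parts of the coefficients `c_k` of the `N`-th exponential
sum (arguments `N`, `k` and the precision) and of the expectations `𝔼[φ_k ^ {w_e}]`
(arguments `N`, `k`, `e` and the precision). -/
structure Access where
  cRe : ℕ → ℕ → ℕ → ℤ
  cIm : ℕ → ℕ → ℕ → ℤ
  eRe : ℕ → ℕ → ℕ → ℕ → ℤ
  eIm : ℕ → ℕ → ℕ → ℕ → ℤ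

/-- The presentations are correct for the exponential sums `es N` and the random weights `W`. -/
def Access.Valid (X : Access) (es : ℕ → ExpSum) {n : ℕ} (W : RandomWeights n) : Prop :=
  ∀ (N : ℕ) (k : Fin (es N).L),
    Presents (X.cRe N k) ((es N).c k).re ∧ Presents (X.cIm N k) ((es N).c k).im ∧
    ∀ e : Fin n, Presents (X.eRe N k e) ((es N).expect W k e).re ∧
      Presents (X.eIm N k e) ((es N).expect W k e).im

/-- Input of the expected utility maximization problem for `A`: the number `n` of elements
(channel `0`), the description of the instance and its length (channel `1`), the number `N`, where
`1 / N` is the accuracy parameter (channel `2`), for every accuracy `1 / M` the number of terms of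
the exponential sum (channel `3`) and its coefficients (channels `4` and `5`), and the
distributions of the weights, accessed through the expectations `𝔼[φ_k ^ {w_e}]`
(channels `6` and `7`). -/
def CombProblem.eumInput (A : CombProblem) (I : A.Inst) (N : ℕ) (es : ℕ → ExpSum) (X : Access) :
    RAM.Input
  | 0, [] => A.n I
  | 1, [] => (A.encode I).length
  | 1, [i] => if 0 ≤ i then (A.encode I).getD i.toNat 0 else 0
  | 2, [] => N
  | 3, [M] => (es M.toNat).L
  | 4, [M, k, m] => X.cRe M.toNat k.toNat m.toNat
  | 5, [M, k, m] => X.cIm M.toNat k.toNat m.toNat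
  | 6, [M, k, e, m] => X.eRe M.toNat k.toNat e.toNat m.toNat
  | 7, [M, k, e, m] => X.eIm M.toNat k.toNat e.toNat m.toNat
  | _, _ => 0

/-! By independence the expectation of the exponential sum at $w(S)$ is $\sum_k c_k\prod_{e\in
S}z_{k,e}$ with $z_{k,e}=\mathbb E[\phi_k^{w_e}]$ in the unit disc, and its real part is within
$\epsilon$ of the expected utility (`ExpSum.integral_pow_total`,
`ExpSum.abs_expectedUtility_sub_le`). So only a sum of $L$ products has to be maximized.

All $z_{k,e}$ are rounded to powers of one complex number $\gamma=1-1/M^2+i/M$. Its powers wind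
inwards so slowly that the first $8M^3+1$ of them form a $12/M$-net of the disc
(`exists_spiral_pow_near`). Products of rounded numbers become $\gamma^{s_k}$, where $s_k$ is a sum
of exponents over $S$. Rounding errors in a product of numbers of modulus at most $1$ add up to
$O(n/M)$, so that $M\approx nN\sum_k|c_k|$ gives total error $O(1/N)$
(`UtilityData.Correct.abs_value_sub_le`).

The rounded objective depends only on $(s_1,\dots,s_L)$, and every $s_k$ is at most $8nM^3$. Written
in a base larger than that bound, the exponents of an element form one integer weight, and the
weight of a set has the $s_k$ as its digits, without carries
(`UtilityData.Correct.digit_setWeight`). The exact algorithm is called for every target below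
$\mathrm{base}^L=M^{O(L)}$; among the targets that are attained, one of best value is kept. A set of
this weight is recovered by self-reduction: an element is excluded by raising its weight above the
target, and it is kept only if the answer turns negative (`UtilityData.triple_decideElt`).

For the running time, a single number $U=M^{13L}$ bounds all intermediate results
(`UtilityData.Correct.admissible`), and each loop costs one more factor $U$ (`RAM.Triple.loop`). The
total is a fixed power of $U$, which is $(nN\max\{1,\sum_k|c_k|\})^{O(L)}$. The PTAS is the same
program run at accuracy $1/(NJ)$ with $J\ge 262/\kappa$, so that the additive loss is at most a
$1/N$ fraction of the optimum. -/

namespace RAM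

/-! ### Cost bounds for expressions -/

theorem bits_le_iff {z : ℤ} {k : ℕ} : bits z ≤ k ↔ z.natAbs < 2 ^ k := Nat.size_le

theorem natAbs_lt_two_pow_bits (z : ℤ) : z.natAbs < 2 ^ bits z := bits_le_iff.1 le_rfl

theorem bits_le_natAbs (z : ℤ) : bits z ≤ z.natAbs := bits_le_iff.2 Nat.lt_two_pow_self

theorem bits_apply_le (o : Op) (x y : ℤ) : bits (o.apply x y) ≤ bits x + bits y + 1 := by
  rw [bits_le_iff]
  have hx := natAbs_lt_two_pow_bits x
  have hy := natAbs_lt_two_pow_bits y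
  have hx1 : 2 ^ bits x ≤ 2 ^ (bits x + bits y) := Nat.pow_le_pow_right (by norm_num) (by omega)
  have hy1 : 2 ^ bits y ≤ 2 ^ (bits x + bits y) := Nat.pow_le_pow_right (by norm_num) (by omega)
  have h1 : 1 ≤ 2 ^ (bits x + bits y) := Nat.one_le_two_pow
  have h2 : 2 ^ (bits x + bits y + 1) = 2 * 2 ^ (bits x + bits y) := by ring
  rw [h2]
  cases o with
  | add => simp only [Op.apply]; omega
  | sub => simp only [Op.apply]; omega
  | mul =>
    simp only [Op.apply, Int.natAbs_mul]
    have : x.natAbs * y.natAbs < 2 ^ bits x * 2 ^ bits y := Nat.mul_lt_mul'' hx hy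
    rw [← pow_add] at this
    omega
  | div =>
    simp only [Op.apply]
    have := Int.natAbs_ediv_le_natAbs x y
    omega
  | le => simp only [Op.apply]; split_ifs <;> (simp; try omega)
  | eq => simp only [Op.apply]; split_ifs <;> (simp; try omega)

/-- The expression reads only the arrays `0, …, 4` and no input. -/
def Expr.ok : Expr → Prop
  | .const _ => True
  | .mem a i => a < 5 ∧ i.ok
  | .inp _ _ => False
  | .op _ e₁ e₂ => e₁.ok ∧ e₂.ok

/-- Bit length of the value of an expression, in units of a common bound for all cells. -/
def Expr.valueWeight : Expr → ℕ
  | .const z => z.natAbs + 1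
  | .mem _ _ => 1
  | .inp _ _ => 1
  | .op _ e₁ e₂ => e₁.valueWeight + e₂.valueWeight + 1

/-- Cost of an expression, in units of a common bound for all cells. -/
def Expr.weight : Expr → ℕ
  | .const z => z.natAbs + 2
  | .mem _ i => 2 + i.weight
  | .inp _ args => 2 + ∑ j, (args j).weight
  | .op o e₁ e₂ => 1 + (Expr.op o e₁ e₂).valueWeight + e₁.weight + e₂.weight

/-- The values in the arrays `0, …, 4` are bounded by `U`. -/
def Bounded (U : ℕ) (m : Mem) : Prop := ∀ a < 5, ∀ i, |m a i| ≤ (U : ℤ)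

/-- Bounding a bit length by the magnitude itself is wasteful but harmless: time only has to be
polynomial in `U`. -/
theorem bits_le_of_abs_le {U : ℕ} {z : ℤ} (h : |z| ≤ (U : ℤ)) : bits z ≤ U :=
  (bits_le_natAbs z).trans (by rw [Int.abs_eq_natAbs] at h; omega)

/-- Bit lengths at most add up under every operation, so subexpressions need no magnitude bounds of
their own; only stored values do. -/
theorem Expr.bits_eval_le {I : Input} {U : ℕ} (hU : 1 ≤ U) {m : Mem} (hm : Bounded U m) :
    ∀ e : Expr, e.ok → bits (e.eval I m) ≤ e.valueWeight * U
  | .const z, _ => by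
    have := bits_le_natAbs z
    simp only [Expr.eval, Expr.valueWeight]
    nlinarith
  | .mem a i, h => by
    simpa [Expr.eval, Expr.valueWeight] using bits_le_of_abs_le (hm a h.1 _)
  | .inp a args, h => h.elim
  | .op o e₁ e₂, h => by
    have h1 := Expr.bits_eval_le (I := I) hU hm e₁ h.1
    have h2 := Expr.bits_eval_le (I := I) hU hm e₂ h.2
    have := bits_apply_le o (e₁.eval I m) (e₂.eval I m)
    simp only [Expr.eval, Expr.valueWeight]
    nlinarith

theorem Expr.cost_le {I : Input} {U : ℕ} (hU : 1 ≤ U) {m : Mem} (hm : Bounded U m) :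
    ∀ e : Expr, e.ok → e.cost I m ≤ e.weight * U
  | .const z, _ => by
    have := bits_le_natAbs z
    simp only [Expr.cost, Expr.weight]
    nlinarith
  | .mem a i, h => by
    have h1 := Expr.bits_eval_le (I := I) hU hm (.mem a i) h
    have h2 := Expr.cost_le (I := I) hU hm i h.2
    simp only [Expr.cost, Expr.weight, Expr.valueWeight] at *
    nlinarith
  | .inp a args, h => h.elim
  | .op o e₁ e₂, h => by
    have h1 := Expr.bits_eval_le (I := I) hU hm (.op o e₁ e₂) h
    have h2 := Expr.cost_le (I := I) hU hm e₁ h.1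
    have h3 := Expr.cost_le (I := I) hU hm e₂ h.2
    simp only [Expr.cost, Expr.weight] at *
    nlinarith

/-- Input values are not controlled by the memory. Hence an input access is allowed only at the root
of an expression, with a bound for the value supplied by hand. -/
theorem Expr.cost_inp_le {I : Input} {U : ℕ} (hU : 1 ≤ U) {m : Mem} (hm : Bounded U m)
    (a : ℕ) {r : ℕ} (args : Fin r → Expr) (hargs : ∀ j, (args j).ok)
    (hv : |(Expr.inp a args).eval I m| ≤ (U : ℤ)) :
    (Expr.inp a args).cost I m ≤ (Expr.inp a args).weight * U := by
  have h1 := bits_le_of_abs_le hv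
  have h2 : ∑ j, (args j).cost I m ≤ (∑ j, (args j).weight) * U := by
    rw [Finset.sum_mul]
    exact Finset.sum_le_sum fun j _ => Expr.cost_le hU hm _ (hargs j)
  simp only [Expr.cost, Expr.weight] at *
  nlinarith

/-! ### Total correctness with time bounds -/

/-- Started in a memory `m` bounded by `U`, the program `c` halts within time `b * U ^ j` in a
memory that is bounded by `U` and satisfies `Q`. -/
def Triple (I : Input) (U : ℕ) (c : Cmd) (m : Mem) (b j : ℕ) (Q : Mem → Prop) : Prop :=
  Bounded U m → ∃ m' t, Run I c m m' t ∧ t ≤ b * U ^ j ∧ Bounded U m' ∧ Q m'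

variable {I : Input} {U : ℕ} {m : Mem} {Q : Mem → Prop}

theorem Bounded.set (hm : Bounded U m) (a : ℕ) (i v : ℤ) (hv : |v| ≤ (U : ℤ)) :
    Bounded U (m.set a i v) := by
  intro a' ha' i'
  unfold Mem.set
  split_ifs
  · exact hv
  · exact hm a' ha' i'

theorem Triple.mono {c : Cmd} {b j b' j' : ℕ} {Q' : Mem → Prop} (hU : 1 ≤ U)
    (h : Triple I U c m b j Q) (hb : b ≤ b') (hj : j ≤ j') (hQ : ∀ m', Q m' → Q' m') :
    Triple I U c m b' j' Q' := by
  intro hm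
  obtain ⟨m', t, hr, ht, hm', hq⟩ := h hm
  exact ⟨m', t, hr, ht.trans (Nat.mul_le_mul hb (Nat.pow_le_pow_right hU hj)), hm', hQ _ hq⟩

theorem Triple.skip (hQ : Q m) : Triple I U .skip m 1 0 Q :=
  fun hm => ⟨m, 1, .skip m, by simp, hm, hQ⟩

theorem Triple.assign (hU : 1 ≤ U) {a : ℕ} {i e : Expr} (hi : i.ok) (he : e.ok)
    (hv : |e.eval I m| ≤ (U : ℤ)) (hQ : Q (m.set a (i.eval I m) (e.eval I m))) :
    Triple I U (.assign a i e) m (1 + i.weight + e.weight) 1 Q := by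
  intro hm
  refine ⟨_, _, .assign m a i e, ?_, hm.set _ _ _ hv, hQ⟩
  have h1 := Expr.cost_le (I := I) hU hm i hi
  have h2 := Expr.cost_le (I := I) hU hm e he
  nlinarith

theorem Triple.assign_inp (hU : 1 ≤ U) {a : ℕ} {i : Expr} {ch r : ℕ} {args : Fin r → Expr}
    (hi : i.ok) (hargs : ∀ j, (args j).ok) (hv : |(Expr.inp ch args).eval I m| ≤ (U : ℤ))
    (hQ : Q (m.set a (i.eval I m) ((Expr.inp ch args).eval I m))) :
    Triple I U (.assign a i (.inp ch args)) m (1 + i.weight + (Expr.inp ch args).weight) 1 Q := by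
  intro hm
  refine ⟨_, _, .assign m a i _, ?_, hm.set _ _ _ hv, hQ⟩
  have h1 := Expr.cost_le (I := I) hU hm i hi
  have h2 := Expr.cost_inp_le hU hm ch args hargs hv
  nlinarith

theorem Triple.seq {c₁ c₂ : Cmd} {b₁ b₂ j : ℕ} {Q' : Mem → Prop} (hU : 1 ≤ U)
    (h₁ : Triple I U c₁ m b₁ j Q') (h₂ : ∀ m', Q' m' → Triple I U c₂ m' b₂ j Q) :
    Triple I U (.seq c₁ c₂) m (1 + b₁ + b₂) j Q := by
  intro hm
  obtain ⟨m₁, t₁, hr₁, ht₁, hm₁, hq₁⟩ := h₁ hm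
  obtain ⟨m₂, t₂, hr₂, ht₂, hm₂, hq₂⟩ := h₂ m₁ hq₁ hm₁
  refine ⟨m₂, _, .seq hr₁ hr₂, ?_, hm₂, hq₂⟩
  have : 1 ≤ U ^ j := Nat.one_le_pow _ _ hU
  nlinarith

theorem Triple.ite (hU : 1 ≤ U) {e : Expr} {c₁ c₂ : Cmd} {b₁ b₂ j : ℕ} (hj : 1 ≤ j)
    (he : e.ok) (h₁ : e.eval I m ≠ 0 → Triple I U c₁ m b₁ j Q)
    (h₂ : e.eval I m = 0 → Triple I U c₂ m b₂ j Q) :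
    Triple I U (.ite e c₁ c₂) m (1 + e.weight + b₁ + b₂) j Q := by
  intro hm
  have hc := Expr.cost_le (I := I) hU hm e he
  have hU1 : 1 ≤ U ^ j := Nat.one_le_pow _ _ hU
  have hUj : U ≤ U ^ j := Nat.le_self_pow (by omega) U
  have hc' : e.cost I m ≤ e.weight * U ^ j := hc.trans (Nat.mul_le_mul_left _ hUj)
  by_cases h : e.eval I m = 0
  · obtain ⟨m₁, t₁, hr₁, ht₁, hm₁, hq₁⟩ := h₂ h hm
    exact ⟨m₁, _, .iteFalse h hr₁, by nlinarith, hm₁, hq₁⟩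
  · obtain ⟨m₁, t₁, hr₁, ht₁, hm₁, hq₁⟩ := h₁ h hm
    exact ⟨m₁, _, .iteTrue h hr₁, by nlinarith, hm₁, hq₁⟩

/-- Indexing the invariant by the number of completed iterations yields termination and the time
bound at once. There are at most `n + 1 ≤ 2 * U` tests, so the exponent of `U` counts the nesting
depth of loops. -/
theorem Triple.loop (hU : 1 ≤ U) {e : Expr} {c : Cmd} {b j : ℕ} (hj : 1 ≤ j) (he : e.ok)
    (Inv : ℕ → Mem → Prop) (n : ℕ) (hn : n ≤ U) (h₀ : Inv 0 m)
    (hstep : ∀ i < n, ∀ m, Inv i m → e.eval I m ≠ 0 ∧ Triple I U c m b j (Inv (i + 1)))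
    (hend : ∀ m, Inv n m → e.eval I m = 0) :
    Triple I U (.loop e c) m (2 * (1 + e.weight + b)) (j + 1) (Inv n) := by
  intro hm
  have hU1 : 1 ≤ U ^ j := Nat.one_le_pow _ _ hU
  have hUj : U ≤ U ^ j := Nat.le_self_pow (by omega) U
  have key : ∀ r i, i + r = n → ∀ m, Bounded U m → Inv i m → ∃ m' t, Run I (.loop e c) m m' t ∧
      t ≤ (r + 1) * ((1 + e.weight + b) * U ^ j) ∧ Bounded U m' ∧ Inv n m' := by
    intro r
    induction r with
    | zero =>
      intro i hi m hm hinv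
      obtain rfl : i = n := by omega
      have hc := Expr.cost_le (I := I) hU hm e he
      have hc' : e.cost I m ≤ e.weight * U ^ j := hc.trans (Nat.mul_le_mul_left _ hUj)
      exact ⟨m, _, .loopStop (hend m hinv), by nlinarith, hm, hinv⟩
    | succ r ih =>
      intro i hi m hm hinv
      have hc := Expr.cost_le (I := I) hU hm e he
      have hc' : e.cost I m ≤ e.weight * U ^ j := hc.trans (Nat.mul_le_mul_left _ hUj)
      obtain ⟨hne, hT⟩ := hstep i (by omega) m hinv
      obtain ⟨m₁, t₁, hr₁, ht₁, hm₁, hq₁⟩ := hT hm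
      obtain ⟨m₂, t₂, hr₂, ht₂, hm₂, hq₂⟩ := ih (i + 1) (by omega) m₁ hm₁ hq₁
      exact ⟨m₂, _, .loopStep hne hr₁ hr₂, by nlinarith, hm₂, hq₂⟩
  obtain ⟨m', t, hr, ht, hm', hq⟩ := key n 0 (by omega) m hm h₀
  refine ⟨m', t, hr, ht.trans ?_, hm', hq⟩
  have : n + 1 ≤ 2 * U := by omega
  calc (n + 1) * ((1 + e.weight + b) * U ^ j) ≤ (2 * U) * ((1 + e.weight + b) * U ^ j) :=
        Nat.mul_le_mul_right _ this
    _ = _ := by ring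

/-! ### Calling a program as a subroutine -/

theorem Expr.bits_le_cost (I : Input) (m : Mem) (e : Expr) : bits (e.eval I m) ≤ e.cost I m := by
  cases e <;> simp only [Expr.cost, Expr.eval] <;> omega

/-- Writing a value has already paid for its bits. This bounds the cost of reading the answer of a
subroutine about whose memory nothing else is known. -/
theorem Run.bits_le {I : Input} {c : Cmd} {m m' : Mem} {t : ℕ} (h : Run I c m m' t) (a : ℕ)
    (i : ℤ) : bits (m' a i) ≤ bits (m a i) + t := by
  induction h with
  | skip => omega
  | assign m b i' e =>
    have := Expr.bits_le_cost I m e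
    unfold Mem.set
    split_ifs <;> omega
  | clear m b =>
    unfold Mem.reset
    split_ifs
    · simp [bits]
    · omega
  | seq _ _ h1 h2 => omega
  | iteTrue _ _ h => omega
  | iteFalse _ _ h => omega
  | loopStop => omega
  | loopStep _ _ _ h1 h2 => omega

/-- All arrays that occur in the expression are among the first `w` ones. -/
def Expr.within (w : ℕ) : Expr → Prop
  | .const _ => True
  | .mem a i => a < w ∧ i.within w
  | .inp _ args => ∀ j, (args j).within w
  | .op _ e₁ e₂ => e₁.within w ∧ e₂.within w

theorem Expr.within_mono {w w' : ℕ} (h : w ≤ w') : ∀ e : Expr, e.within w → e.within w'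
  | .const _, _ => trivial
  | .mem _ i, h' => ⟨h'.1.trans_le h, Expr.within_mono h i h'.2⟩
  | .inp _ args, h' => fun j => Expr.within_mono h (args j) (h' j)
  | .op _ e₁ e₂, h' => ⟨Expr.within_mono h e₁ h'.1, Expr.within_mono h e₂ h'.2⟩

theorem Expr.exists_within : ∀ e : Expr, ∃ w, e.within w
  | .const _ => ⟨0, trivial⟩
  | .mem a i => by
    obtain ⟨w, hw⟩ := Expr.exists_within i
    exact ⟨max w (a + 1), by omega, Expr.within_mono (le_max_left _ _) i hw⟩
  | .inp _ args => by
    choose w hw using fun j => Expr.exists_within (args j)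
    exact ⟨Finset.univ.sup w, fun j =>
      Expr.within_mono (Finset.le_sup (f := w) (Finset.mem_univ j)) _ (hw j)⟩
  | .op _ e₁ e₂ => by
    obtain ⟨w₁, h₁⟩ := Expr.exists_within e₁
    obtain ⟨w₂, h₂⟩ := Expr.exists_within e₂
    exact ⟨max w₁ w₂, Expr.within_mono (le_max_left _ _) _ h₁,
      Expr.within_mono (le_max_right _ _) _ h₂⟩

/-- All arrays that occur in the program are among the first `w` ones. -/
def Cmd.within (w : ℕ) : Cmd → Prop
  | .skip => True
  | .assign a i e => a < w ∧ i.within w ∧ e.within w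
  | .clear a => a < w
  | .seq c₁ c₂ => c₁.within w ∧ c₂.within w
  | .ite e c₁ c₂ => e.within w ∧ c₁.within w ∧ c₂.within w
  | .loop e c => e.within w ∧ c.within w

theorem Cmd.within_mono {w w' : ℕ} (h : w ≤ w') (c : Cmd) (hc : c.within w) : c.within w' := by
  induction c with
  | skip => trivial
  | assign a i e =>
    exact ⟨hc.1.trans_le h, Expr.within_mono h _ hc.2.1, Expr.within_mono h _ hc.2.2⟩
  | clear a => exact lt_of_lt_of_le hc h
  | seq c₁ c₂ h₁ h₂ => exact ⟨h₁ hc.1, h₂ hc.2⟩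
  | ite e c₁ c₂ h₁ h₂ => exact ⟨Expr.within_mono h _ hc.1, h₁ hc.2.1, h₂ hc.2.2⟩
  | loop e c ih => exact ⟨Expr.within_mono h _ hc.1, ih hc.2⟩

/-- Finitely many arrays suffice for a program, so they can all be cleared before every call at a
constant cost. -/
theorem Cmd.exists_within (c : Cmd) : ∃ w, c.within w := by
  induction c with
  | skip => exact ⟨0, trivial⟩
  | assign a i e =>
    obtain ⟨w₁, h₁⟩ := i.exists_within
    obtain ⟨w₂, h₂⟩ := e.exists_within
    exact ⟨max (a + 1) (max w₁ w₂), by simp, Expr.within_mono (by simp) _ h₁,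
      Expr.within_mono (by simp) _ h₂⟩
  | clear a => exact ⟨a + 1, Nat.lt_succ_self a⟩
  | seq c₁ c₂ h₁ h₂ =>
    obtain ⟨w₁, h₁⟩ := h₁
    obtain ⟨w₂, h₂⟩ := h₂
    exact ⟨max w₁ w₂, Cmd.within_mono (by simp) _ h₁, Cmd.within_mono (by simp) _ h₂⟩
  | ite e c₁ c₂ h₁ h₂ =>
    obtain ⟨w₀, h₀⟩ := e.exists_within
    obtain ⟨w₁, h₁⟩ := h₁
    obtain ⟨w₂, h₂⟩ := h₂
    exact ⟨max w₀ (max w₁ w₂), Expr.within_mono (by simp) _ h₀, Cmd.within_mono (by simp) _ h₁,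
      Cmd.within_mono (by simp) _ h₂⟩
  | loop e c ih =>
    obtain ⟨w₀, h₀⟩ := e.exists_within
    obtain ⟨w₁, h₁⟩ := ih
    exact ⟨max w₀ w₁, Expr.within_mono (by simp) _ h₀, Cmd.within_mono (by simp) _ h₁⟩

/-- The replacement for an input access of a subroutine: the first two channels are passed on, the
target is cell `14` of array `4`, and the weights are in array `1`. -/
def redirect : ℕ → (r : ℕ) → (Fin r → Expr) → Expr
  | 0, 0, _ => .inp 0 ![]
  | 1, 0, _ => .inp 1 ![]
  | 1, 1, args => .inp 1 ![args 0]
  | 2, 0, _ => .mem 4 (.const 14)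
  | 3, 1, args => .mem 1 (args 0)
  | _, _, _ => .const 0

/-- The expression as part of a subroutine, with its arrays shifted by `5`. -/
def Expr.sub : Expr → Expr
  | .const z => .const z
  | .mem a i => .mem (a + 5) i.sub
  | .inp a (r := r) args => redirect a r fun j => (args j).sub
  | .op o e₁ e₂ => .op o e₁.sub e₂.sub

/-- The program as a subroutine, with its arrays shifted by `5`. -/
def Cmd.sub : Cmd → Cmd
  | .skip => .skip
  | .assign a i e => .assign (a + 5) i.sub e.sub
  | .clear a => .clear (a + 5)
  | .seq c₁ c₂ => .seq c₁.sub c₂.sub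
  | .ite e c₁ c₂ => .ite e.sub c₁.sub c₂.sub
  | .loop e c => .loop e.sub c.sub

/-- The input `I'` of a subroutine is represented by the input `I` and the memory `m`. -/
structure Represents (I : Input) (m : Mem) (I' : Input) : Prop where
  size : I 0 [] = I' 0 []
  length : I 1 [] = I' 1 []
  code : ∀ i, I 1 [i] = I' 1 [i]
  target : m 4 14 = I' 2 []
  weight : ∀ e, m 1 e = I' 3 [e]
  rest : ∀ a l, (a = 0 ∧ l ≠ []) ∨ (a = 1 ∧ 2 ≤ l.length) ∨ (a = 2 ∧ l ≠ []) ∨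
    (a = 3 ∧ l.length ≠ 1) ∨ 4 ≤ a → I' a l = 0

/-- The factor `6` comes from the target: reading cell `14` of array `4` costs `6` plus the bit
length of the value, since the address alone costs `5`, against `1` plus the bit length for the
original access. -/
theorem redirect_spec {I I' : Input} {m : Mem} (h : Represents I m I') (a r : ℕ)
    (args args' : Fin r → Expr) (m' : Mem) (h₁ : ∀ j, (args j).eval I m = (args' j).eval I' m')
    (h₂ : ∀ j, (args j).cost I m ≤ 6 * (args' j).cost I' m') :
    (redirect a r args).eval I m = (Expr.inp a args').eval I' m' ∧
      (redirect a r args).cost I m ≤ 6 * (Expr.inp a args').cost I' m' := by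
  unfold redirect
  split
  · simp [Expr.eval, Expr.cost, h.size]
  · simp [Expr.eval, Expr.cost, h.length]
  · have := h₂ 0
    simp [Expr.eval, Expr.cost, h.code, h₁]; omega
  · have h14 : bits 14 = 4 := by decide
    simp [Expr.eval, Expr.cost, h.target, h14]; omega
  · have := h₂ 0
    simp [Expr.eval, Expr.cost, h.weight, h₁]; omega
  · rename_i a₁ r₁ args₁ g1 g2 g3 g4 g5
    have h0 : bits 0 = 0 := by decide
    have : I' a (List.ofFn fun j => (args' j).eval I' m') = 0 := by
      apply h.rest
      have hl : (List.ofFn fun j => (args' j).eval I' m').length = r := by simp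
      have hn : (List.ofFn fun j => (args' j).eval I' m') ≠ [] ↔ r ≠ 0 := by
        rw [← List.length_pos_iff, hl]; omega
      rw [hl, hn]
      have g1' : ¬ (a = 0 ∧ r = 0) := by
        rintro ⟨rfl, rfl⟩; exact g1 args rfl rfl HEq.rfl
      have g2' : ¬ (a = 1 ∧ r = 0) := by
        rintro ⟨rfl, rfl⟩; exact g2 args rfl rfl HEq.rfl
      have g3' : ¬ (a = 1 ∧ r = 1) := by
        rintro ⟨rfl, rfl⟩; exact g3 args rfl rfl HEq.rfl
      have g4' : ¬ (a = 2 ∧ r = 0) := by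
        rintro ⟨rfl, rfl⟩; exact g4 args rfl rfl HEq.rfl
      have g5' : ¬ (a = 3 ∧ r = 1) := by
        rintro ⟨rfl, rfl⟩; exact g5 args rfl rfl HEq.rfl
      omega
    simp [Expr.eval, Expr.cost, this, h0]; omega

theorem Expr.sub_spec {I I' : Input} {m m' : Mem} {w : ℕ} (h : Represents I m I')
    (hm : ∀ a < w, m (a + 5) = m' a) : ∀ e : Expr, e.within w →
    e.sub.eval I m = e.eval I' m' ∧ e.sub.cost I m ≤ 6 * e.cost I' m'
  | .const z, _ => by
    refine ⟨rfl, ?_⟩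
    simp only [Expr.sub, Expr.cost]
    omega
  | .mem a i, hb => by
    obtain ⟨h1, h2⟩ := Expr.sub_spec h hm i hb.2
    refine ⟨by simp only [Expr.sub, Expr.eval, h1, hm a hb.1], ?_⟩
    simp only [Expr.sub, Expr.eval, Expr.cost, h1, hm a hb.1]
    omega
  | .inp a args, hb => by
    have := fun j => Expr.sub_spec h hm (args j) (hb j)
    exact redirect_spec h a _ _ args m' (fun j => (this j).1) fun j => (this j).2
  | .op o e₁ e₂, hb => by
    obtain ⟨h1, h2⟩ := Expr.sub_spec h hm e₁ hb.1
    obtain ⟨h3, h4⟩ := Expr.sub_spec h hm e₂ hb.2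
    simp only [Expr.sub, Expr.eval, Expr.cost, h1, h3, true_and]; omega

theorem Represents.congr {I I' : Input} {m m' : Mem} (h : Represents I m I')
    (hm : ∀ a < 5, m' a = m a) : Represents I m' I' :=
  ⟨h.size, h.length, h.code, by rw [hm 4 (by norm_num), h.target],
    fun e => by rw [hm 1 (by norm_num), h.weight], h.rest⟩

/-- Step-by-step simulation. The shifted program never writes to the caller's arrays `0, …, 4`, so
the input represented there stays the same throughout the run. -/
theorem Run.sub {I I' : Input} {w : ℕ} {c : Cmd} {m₀ m₁ : Mem} {t : ℕ} (hr : Run I' c m₀ m₁ t)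
    (hc : c.within w) : ∀ m : Mem, Represents I m I' → (∀ a < w, m (a + 5) = m₀ a) →
    ∃ m' t', Run I c.sub m m' t' ∧ t' ≤ 6 * t ∧ (∀ a < w, m' (a + 5) = m₁ a) ∧
      ∀ a < 5, m' a = m a := by
  induction hr with
  | skip m₀ => exact fun m h hm => ⟨m, 1, .skip m, by norm_num, hm, fun _ _ => rfl⟩
  | assign m₀ a i e =>
    intro m h hm
    obtain ⟨h1, h2⟩ := Expr.sub_spec h hm i hc.2.1
    obtain ⟨h3, h4⟩ := Expr.sub_spec h hm e hc.2.2
    refine ⟨_, _, .assign m (a + 5) i.sub e.sub, by omega, fun b hb => ?_, fun b hb => ?_⟩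
    · funext k
      simp [Mem.set, h1, h3, hm b hb]
    · funext k
      have : b ≠ a + 5 := by omega
      simp [Mem.set, this]
  | clear m₀ a =>
    intro m h hm
    refine ⟨_, _, .clear m (a + 5), by norm_num, fun b hb => ?_, fun b hb => ?_⟩
    · funext k
      simp [Mem.reset, hm b hb]
    · funext k
      have : b ≠ a + 5 := by omega
      simp [Mem.reset, this]
  | seq _ _ ih₁ ih₂ =>
    intro m h hm
    obtain ⟨m₁, t₁, r₁, ht₁, e₁, f₁⟩ := ih₁ hc.1 m h hm
    obtain ⟨m₂, t₂, r₂, ht₂, e₂, f₂⟩ := ih₂ hc.2 m₁ (h.congr f₁) e₁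
    exact ⟨m₂, _, .seq r₁ r₂, by omega, e₂, fun a ha => (f₂ a ha).trans (f₁ a ha)⟩
  | @iteTrue e _ _ _ _ _ he _ ih =>
    intro m h hm
    obtain ⟨h1, h2⟩ := Expr.sub_spec h hm e hc.1
    obtain ⟨m₁, t₁, r₁, ht₁, e₁, f₁⟩ := ih hc.2.1 m h hm
    exact ⟨m₁, _, .iteTrue (by rwa [h1]) r₁, by omega, e₁, f₁⟩
  | @iteFalse e _ _ _ _ _ he _ ih =>
    intro m h hm
    obtain ⟨h1, h2⟩ := Expr.sub_spec h hm e hc.1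
    obtain ⟨m₁, t₁, r₁, ht₁, e₁, f₁⟩ := ih hc.2.2 m h hm
    exact ⟨m₁, _, .iteFalse (by rwa [h1]) r₁, by omega, e₁, f₁⟩
  | @loopStop e _ _ he =>
    intro m h hm
    obtain ⟨h1, h2⟩ := Expr.sub_spec h hm e hc.1
    exact ⟨m, _, .loopStop (by rwa [h1]), by omega, hm, fun _ _ => rfl⟩
  | @loopStep e _ _ _ _ _ _ he _ _ ih₁ ih₂ =>
    intro m h hm
    obtain ⟨h1, h2⟩ := Expr.sub_spec h hm e hc.1
    obtain ⟨m₁, t₁, r₁, ht₁, e₁, f₁⟩ := ih₁ hc.2 m h hm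
    obtain ⟨m₂, t₂, r₂, ht₂, e₂, f₂⟩ := ih₂ hc m₁ (h.congr f₁) e₁
    exact ⟨m₂, _, .loopStep (by rwa [h1]) r₁ r₂, by omega, e₂,
      fun a ha => (f₂ a ha).trans (f₁ a ha)⟩

/-- Clear the arrays `5, …, w + 4`. -/
def clearAll : ℕ → Cmd
  | 0 => .skip
  | w + 1 => .seq (clearAll w) (.clear (w + 5))

theorem run_clearAll (I : Input) (w : ℕ) (m : Mem) : ∃ m', Run I (clearAll w) m m' (2 * w + 1) ∧
    (∀ a < w, m' (a + 5) = 0) ∧ ∀ a < 5, m' a = m a := by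
  induction w with
  | zero => exact ⟨m, .skip m, by simp, fun _ _ => rfl⟩
  | succ w ih =>
    obtain ⟨m', hr, h1, h2⟩ := ih
    refine ⟨m'.reset (w + 5), ?_, fun a ha => ?_, fun a ha => ?_⟩
    · have := Run.seq hr (.clear m' (w + 5))
      rwa [show 1 + (2 * w + 1) + 1 = 2 * (w + 1) + 1 by ring] at this
    · funext k
      rcases Nat.lt_succ_iff_lt_or_eq.1 ha with h | rfl
      · have : a ≠ w := by omega
        simp [Mem.reset, this, h1 a h]
      · simp [Mem.reset]
    · funext k
      have : a ≠ w + 5 := by omega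
      simp [Mem.reset, this, h2 a ha]

end RAM

/-! ### The exact algorithm as an oracle -/

open Classical in
/-- `oracle` decides the exact version of `A` for the weights in array `1` and the target in cell
`14` of array `4`, and writes the answer to cell `19` of array `4`. -/
def CombProblem.IsOracle (A : CombProblem) (oracle : RAM.Cmd) (κ p : ℕ) : Prop :=
  ∀ (I : A.Inst) (N : ℕ) (es : ℕ → ExpSum) (X : Access) (wt : Fin (A.n I) → ℕ) (K U : ℕ)
    (m : RAM.Mem), 1 ≤ U → A.n I ≤ U → K ≤ U → (∀ e, wt e ≤ U) → m 4 14 = K →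
    (∀ e, m 1 e = A.exactInput I wt K 3 [e]) →
    RAM.Triple (A.eumInput I N es X) U oracle m κ p fun m' =>
      ∀ a < 5, m' a = m.set 4 19 (if ∃ S ∈ A.feasible I, ∑ e ∈ S, wt e = K then 1 else 0) a

theorem CombProblem.exists_isOracle (A : CombProblem) (hA : A.HasPseudopolyExact) :
    ∃ oracle κ p, A.IsOracle oracle κ p := by
  classical
  obtain ⟨Q, d, hQ⟩ := hA
  obtain ⟨w₀, hw₀⟩ := Q.exists_within
  -- With `1 ≤ w` the simulated arrays include array `0`, which holds the answer even if `Q` never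
  -- mentions it.
  obtain ⟨w, hw, hw1⟩ : ∃ w, Q.within w ∧ 1 ≤ w :=
    ⟨w₀ + 1, Q.within_mono (by omega) hw₀, by omega⟩
  refine ⟨.seq (RAM.clearAll w) (.seq Q.sub (.assign 4 (.const 19)
    (.op .eq (.mem 5 (.const 0)) (.const 1)))), 2 * w + 20 + 7 * (d * 3 ^ d), d + 1, ?_⟩
  intro I N es X wt K U m hU hn hK hwt hK' hwt' hm
  obtain ⟨m₀, t, hr, hres, ht⟩ := hQ I wt K
  have ht := ht U hK hwt
  obtain ⟨m₁, r₁, z₁, f₁⟩ := RAM.run_clearAll (A.eumInput I N es X) w m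
  have hrep : RAM.Represents (A.eumInput I N es X) m (A.exactInput I wt K) := by
    refine ⟨rfl, rfl, fun _ => rfl, hK', hwt', ?_⟩
    rintro a l (⟨rfl, h⟩ | ⟨rfl, h⟩ | ⟨rfl, h⟩ | ⟨rfl, h⟩ | h)
    · match l with
      | [] => exact absurd rfl h
      | _ :: _ => rfl
    · match l with
      | [] => simp at h
      | [_] => simp at h
      | _ :: _ :: _ => rfl
    · match l with
      | [] => exact absurd rfl h
      | _ :: _ => rfl
    · match l with
      | [] => rfl
      | [_] => simp at h
      | _ :: _ :: _ => rfl
    · obtain ⟨b, rfl⟩ := Nat.exists_eq_add_of_le' h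
      rfl
  obtain ⟨m₂, t₂, r₂, ht₂, e₂, f₂⟩ := hr.sub hw m₁ (hrep.congr f₁) (fun a ha => by
    rw [z₁ a ha]; rfl)
  have h5 : m₂ 5 0 = m₀ 0 0 := by rw [← e₂ 0 (by omega)]
  have hb : RAM.bits (m₂ 5 0) ≤ t := by
    have := hr.bits_le 0 0
    rw [h5]
    simpa [RAM.bits] using this
  have hv : (if m₂ 5 0 = 1 then (1 : ℤ) else 0) =
      if ∃ S ∈ A.feasible I, ∑ e ∈ S, wt e = K then 1 else 0 := by
    rw [h5]
    exact if_congr hres rfl rfl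
  have hf : ∀ a < 5, (m₂.set 4 19 (if m₂ 5 0 = 1 then (1 : ℤ) else 0)) a =
      m.set 4 19 (if ∃ S ∈ A.feasible I, ∑ e ∈ S, wt e = K then 1 else 0) a := by
    intro a ha
    funext i
    simp only [RAM.Mem.set, hv, f₂ a ha, f₁ a ha]
  refine ⟨_, _, .seq r₁ (.seq r₂ (.assign m₂ 4 _ _)), ?_, ?_, hf⟩
  · have hc : 1 + (RAM.Expr.const 19).cost (A.eumInput I N es X) m₂ +
        (RAM.Expr.op .eq (.mem 5 (.const 0)) (.const 1)).cost (A.eumInput I N es X) m₂ ≤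
          15 + t := by
      have h19 : RAM.bits 19 = 5 := by decide
      have h0 : RAM.bits 0 = 0 := by decide
      have h1 : RAM.bits 1 = 1 := by decide
      have h01 : RAM.bits (if m₂ 5 0 = 1 then (1 : ℤ) else 0) ≤ 1 := by split_ifs <;> decide
      change 1 + (1 + RAM.bits 19) + (1 + RAM.bits (if m₂ 5 0 = 1 then (1 : ℤ) else 0) +
        (1 + RAM.bits (m₂ 5 0) + (1 + RAM.bits 0)) + (1 + RAM.bits 1)) ≤ 15 + t
      omega
    have ht' : t ≤ d * 3 ^ d * U ^ (d + 1) := by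
      calc t ≤ d * (A.n I + U + 1) ^ d := ht
        _ ≤ d * (3 * U) ^ d := by gcongr; omega
        _ = d * 3 ^ d * U ^ d := by rw [mul_pow, mul_assoc]
        _ ≤ d * 3 ^ d * U ^ (d + 1) := by
          gcongr
          omega
    have h1U : 1 ≤ U ^ (d + 1) := Nat.one_le_pow _ _ hU
    nlinarith
  · intro a ha i
    have := congrFun (hf a ha) i
    change |m₂.set 4 19 (if m₂ 5 0 = 1 then (1 : ℤ) else 0) a i| ≤ _
    rw [this]
    refine hm.set _ _ _ ?_ a ha i
    split_ifs
    · simpa using hU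
    · simp

/-! ### The powers of a complex number near `1` cover the unit disc -/

/-- The complex number `1 - 1 / M ^ 2 + i / M`. -/
noncomputable def spiral (M : ℕ) : ℂ := ⟨1 - 1 / (M : ℝ) ^ 2, 1 / M⟩

theorem norm_spiral_sq (M : ℕ) :
    ‖spiral M‖ ^ 2 = 1 - (1 / (M : ℝ)) ^ 2 + (1 / (M : ℝ)) ^ 4 := by
  rw [← Complex.normSq_eq_norm_sq, Complex.normSq_apply]
  simp only [spiral]
  ring

theorem one_div_natCast_le_half {M : ℕ} (hM : 2 ≤ M) : 1 / (M : ℝ) ≤ 1 / 2 := by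
  have : (2 : ℝ) ≤ M := by exact_mod_cast hM
  exact one_div_le_one_div_of_le (by norm_num) this

/-- With `x = 1 / M` the squared modulus is `1 - x² + x⁴`, so the modulus loses only order `x²` per
step, while the argument gains order `x`. -/
theorem norm_spiral_bounds {M : ℕ} (hM : 2 ≤ M) :
    1 / 2 ≤ ‖spiral M‖ ∧ ‖spiral M‖ ≤ 1 ∧ 1 - ‖spiral M‖ ≤ (1 / (M : ℝ)) ^ 2 ∧
      (1 / (M : ℝ)) ^ 2 / 4 ≤ 1 - ‖spiral M‖ := by
  have h := norm_spiral_sq M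
  have h0 := norm_nonneg (spiral M)
  have hx := one_div_natCast_le_half hM
  have hx0 : 0 ≤ 1 / (M : ℝ) := by positivity
  set x := 1 / (M : ℝ)
  set r := ‖spiral M‖
  have hx2 : x ^ 2 ≤ 1 / 4 := by nlinarith
  have hx4 : x ^ 4 ≤ x ^ 2 / 4 := by nlinarith [sq_nonneg x]
  have hx4' : 0 ≤ x ^ 4 := by positivity
  have h1 : 1 / 2 ≤ r := by nlinarith
  have h2 : r ≤ 1 := by nlinarith
  refine ⟨h1, h2, ?_, ?_⟩ <;> nlinarith

/-- The sine of the argument is `x / r` with `1 / 2 ≤ r ≤ 1`; the upper bound for the argument is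
Jordan's inequality together with `π ≤ 4`. -/
theorem arg_spiral_bounds {M : ℕ} (hM : 2 ≤ M) :
    1 / (M : ℝ) ≤ (spiral M).arg ∧ (spiral M).arg ≤ 4 * (1 / (M : ℝ)) := by
  obtain ⟨h1, h2, -, -⟩ := norm_spiral_bounds hM
  have hx := one_div_natCast_le_half hM
  have hx0 : 0 ≤ 1 / (M : ℝ) := by positivity
  have hsin := Complex.sin_arg (spiral M)
  have him : (spiral M).im = 1 / (M : ℝ) := rfl
  have hre : (spiral M).re = 1 - (1 / (M : ℝ)) ^ 2 := by simp [spiral]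
  have hθ0 : 0 ≤ (spiral M).arg := by rw [Complex.arg_nonneg_iff, him]; exact hx0
  have hθ1 : (spiral M).arg ≤ Real.pi / 2 := by
    refine (le_abs_self _).trans (Complex.abs_arg_le_pi_div_two_iff.2 ?_)
    rw [hre]; nlinarith
  have hs1 := Real.sin_le hθ0
  have hs2 := Real.mul_le_sin hθ0 hθ1
  rw [hsin, him] at hs1 hs2
  set x := 1 / (M : ℝ)
  set θ := (spiral M).arg
  set r := ‖spiral M‖
  have hr : 0 < r := by linarith
  constructor
  · refine le_trans ?_ hs1
    rw [le_div_iff₀ hr]; nlinarith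
  · have h3 : x / r ≤ 2 * x := by
      rw [div_le_iff₀ hr]; nlinarith
    have h4 : 2 / Real.pi * θ ≤ 2 * x := hs2.trans h3
    have hpi := Real.pi_pos
    have hpi4 := Real.pi_le_four
    rw [div_mul_eq_mul_div, div_le_iff₀ hpi] at h4
    nlinarith

/-- Wait until the modulus has come down to that of `z`, then turn at most once more to match the
argument. A full turn takes at most `7 * M` steps and costs at most `7 / M` in modulus, a single
step turns by at most `4 / M`, and very small `z` cost another `1 / M`; together `12 / M`. -/
theorem exists_spiral_pow_near {M : ℕ} (hM : 2 ≤ M) {z : ℂ} (hz : ‖z‖ ≤ 1) :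
    ∃ a ≤ 8 * M ^ 3, ‖spiral M ^ a - z‖ ≤ 12 / M := by
  obtain ⟨hr1, hr2, hr3, hr4⟩ := norm_spiral_bounds hM
  obtain ⟨hθ1, hθ2⟩ := arg_spiral_bounds hM
  have hx := one_div_natCast_le_half hM
  have hM0 : (0 : ℝ) < M := by positivity
  have hx0 : 0 < 1 / (M : ℝ) := by positivity
  have hpolar := Complex.norm_mul_exp_arg_mul_I (spiral M)
  have hMx : (M : ℝ) * (1 / (M : ℝ)) = 1 := by field_simp
  rw [show (12 : ℝ) / M = 12 * (1 / M) by ring]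
  set x := 1 / (M : ℝ)
  set θ := (spiral M).arg
  set r := ‖spiral M‖
  have hθ0 : 0 < θ := by linarith
  -- The powers never reach `0`, so the target modulus is kept at least `1 / M`.
  set ρ := max ‖z‖ x
  have hρ1 : ρ ≤ 1 := max_le hz (by linarith)
  have hρx : x ≤ ρ := le_max_right _ _
  have hρz : |ρ - ‖z‖| ≤ x := by
    have : ρ ≤ ‖z‖ + x := max_le (by linarith) (by linarith [norm_nonneg z])
    rw [abs_le]; constructor <;> linarith [le_max_left ‖z‖ x]
  -- As `1 - r ≥ x ^ 2 / 4`, this many steps bring the modulus down to `exp (-M) < 1 / M`.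
  have hsmall : r ^ (4 * M ^ 3) < x := by
    have h1 : r ≤ Real.exp (-(1 - r)) := by
      have := Real.one_sub_le_exp_neg (1 - r); linarith
    calc r ^ (4 * M ^ 3) ≤ Real.exp (-(1 - r)) ^ (4 * M ^ 3) := by gcongr
      _ = Real.exp (-((4 * M ^ 3 : ℕ) * (1 - r))) := by rw [← Real.exp_nat_mul]; congr 1; ring
      _ ≤ Real.exp (-M) := by
        refine Real.exp_le_exp.2 (neg_le_neg ?_)
        push_cast
        calc (M : ℝ) = 4 * M ^ 3 * (x ^ 2 / 4) := by
              rw [show (4 : ℝ) * M ^ 3 * (x ^ 2 / 4) = M * (M * x) ^ 2 by ring, hMx]; ring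
          _ ≤ _ := by gcongr
      _ = (Real.exp M)⁻¹ := Real.exp_neg _
      _ < x := by
        have := Real.add_one_lt_exp hM0.ne'
        rw [show x = (M : ℝ)⁻¹ from one_div _]
        exact inv_strictAnti₀ hM0 (by linarith)
  have hex : ∃ j, r ^ (j + 1) < ρ := by
    refine ⟨4 * M ^ 3, lt_of_le_of_lt ?_ (hsmall.trans_le hρx)⟩
    exact pow_le_pow_of_le_one (by linarith) hr2 (by omega)
  classical
  obtain ⟨j, hj, hjle, hjρ⟩ : ∃ j, r ^ (j + 1) < ρ ∧ j ≤ 4 * M ^ 3 ∧ ρ ≤ r ^ j := by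
    refine ⟨Nat.find hex, Nat.find_spec hex, Nat.find_min' hex ?_, ?_⟩
    · refine lt_of_le_of_lt ?_ (hsmall.trans_le hρx)
      exact pow_le_pow_of_le_one (by linarith) hr2 (by omega)
    · rcases Nat.eq_zero_or_pos (Nat.find hex) with h | h
      · rw [h]; simpa using hρ1
      · have := Nat.find_min hex (Nat.sub_lt h one_pos)
        rwa [not_lt, show Nat.find hex - 1 + 1 = Nat.find hex by omega] at this
  -- The argument of `z` is represented in the turn that starts at step `j`, so that the exponent
  -- `⌊ψ / θ⌋₊` is at least `j` and lies within that turn.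
  obtain ⟨ψ, hψ1, hψ2, hψz⟩ : ∃ ψ : ℝ, j * θ ≤ ψ ∧ ψ < j * θ + 2 * Real.pi ∧
      z = ‖z‖ * Complex.exp (ψ * Complex.I) := by
    refine ⟨toIcoMod Real.two_pi_pos (j * θ) z.arg, left_le_toIcoMod _ _ _,
      toIcoMod_lt_right _ _ _, ?_⟩
    have h := toIcoMod_add_toIcoDiv_zsmul Real.two_pi_pos (j * θ) z.arg
    have h2 : toIcoMod Real.two_pi_pos (j * θ) z.arg =
        z.arg - toIcoDiv Real.two_pi_pos (j * θ) z.arg * (2 * Real.pi) := by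
      rw [zsmul_eq_mul] at h; linarith
    rw [h2]
    conv_lhs => rw [← Complex.norm_mul_exp_arg_mul_I z]
    congr 1
    push_cast
    rw [sub_mul, Complex.exp_sub, mul_assoc _ _ Complex.I, Complex.exp_int_mul_two_pi_mul_I,
      div_one]
  obtain ⟨a, ha⟩ : ∃ a, a = ⌊ψ / θ⌋₊ := ⟨_, rfl⟩
  have hψ0 : 0 ≤ ψ / θ := by
    apply div_nonneg _ hθ0.le
    exact le_trans (by positivity) hψ1
  have ha1 : (a : ℝ) * θ ≤ ψ := by
    rw [← le_div_iff₀ hθ0, ha]; exact Nat.floor_le hψ0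
  have ha2 : ψ ≤ a * θ + θ := by
    have := (Nat.lt_floor_add_one (ψ / θ)).le
    rw [← ha, div_le_iff₀ hθ0] at this
    linarith
  have haj : j ≤ a := by
    rw [ha]; exact Nat.le_floor (by rwa [le_div_iff₀ hθ0])
  obtain ⟨b, rfl⟩ := Nat.exists_eq_add_of_le haj
  have hb : (b : ℝ) ≤ 7 * M := by
    have h1 : (b : ℝ) * θ ≤ 2 * Real.pi := by push_cast at ha1; linarith
    have h2 : (b : ℝ) * x ≤ b * θ := by gcongr
    have h3 : (b : ℝ) * x ≤ 7 := by linarith [Real.pi_lt_d2]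
    calc (b : ℝ) = (b * x) * M := by rw [mul_assoc, mul_comm x, hMx, mul_one]
      _ ≤ 7 * M := by gcongr
  refine ⟨j + b, ?_, ?_⟩
  · have h1 : b ≤ 7 * M := by exact_mod_cast hb
    have h2 : 7 * M ≤ 4 * M ^ 3 := by nlinarith [mul_le_mul hM hM (by norm_num) (by omega)]
    omega
  have hpow : spiral M ^ (j + b) = (r ^ (j + b) : ℝ) *
      Complex.exp ((((j + b : ℕ) : ℝ) * θ : ℝ) * Complex.I) := by
    conv_lhs => rw [← hpolar]
    rw [mul_pow, ← Complex.exp_nat_mul]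
    push_cast
    congr 2
    ring
  have hangle : ‖Complex.exp ((((j + b : ℕ) : ℝ) * θ : ℝ) * Complex.I) -
      Complex.exp (ψ * Complex.I)‖ ≤ θ := by
    set y : ℝ := ((j + b : ℕ) : ℝ) * θ
    have h1 : Complex.exp (y * Complex.I) - Complex.exp (ψ * Complex.I) =
        Complex.exp (ψ * Complex.I) * (Complex.exp (Complex.I * (y - ψ : ℝ)) - 1) := by
      rw [mul_sub, ← Complex.exp_add, mul_one]
      congr 2
      push_cast; ring
    rw [h1, norm_mul, Complex.norm_exp_ofReal_mul_I, one_mul]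
    refine Real.norm_exp_I_mul_ofReal_sub_one_le.trans ?_
    rw [Real.norm_eq_abs, abs_le]
    constructor <;> linarith
  have hrj1 : r ^ j ≤ 1 := pow_le_one₀ (by linarith) hr2
  have hrj0 : 0 ≤ r ^ j := by positivity
  have hmod : |r ^ (j + b) - ρ| ≤ 7 * x := by
    have h1 : r ^ (j + b) ≤ r ^ j := pow_le_pow_of_le_one (by linarith) hr2 (by omega)
    -- `ρ` lies between these two consecutive moduli, so stopping at `j` overshoots by at most `x ^
    -- 2`; Bernoulli's inequality then controls the remaining `b` steps.
    have h2 : r ^ j - r ^ (j + 1) ≤ x ^ 2 := by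
      rw [pow_succ]; nlinarith
    have h3 : 1 + (b : ℝ) * (r - 1) ≤ r ^ b := one_add_mul_sub_le_pow (by linarith) b
    have h4 : (b : ℝ) * (1 - r) ≤ 7 * x := by
      calc (b : ℝ) * (1 - r) ≤ 7 * M * x ^ 2 := by
            apply mul_le_mul hb hr3 (by linarith) (by positivity)
        _ = 7 * (M * x) * x := by ring
        _ = 7 * x := by rw [hMx]; ring
    have h5 : r ^ j - r ^ (j + b) ≤ 7 * x := by
      rw [pow_add]; nlinarith
    rw [abs_le]; constructor <;> nlinarith
  have hra : 0 ≤ r ^ (j + b) := by positivity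
  have hra1 : r ^ (j + b) ≤ 1 := pow_le_one₀ (by linarith) hr2
  set u := Complex.exp ((((j + b : ℕ) : ℝ) * θ : ℝ) * Complex.I)
  set v := Complex.exp (ψ * Complex.I)
  have hv : ‖v‖ = 1 := Complex.norm_exp_ofReal_mul_I ψ
  have hsplit : spiral M ^ (j + b) - z = (r ^ (j + b) : ℝ) * (u - v) +
      ((r ^ (j + b) - ρ : ℝ) : ℂ) * v + ((ρ - ‖z‖ : ℝ) : ℂ) * v := by
    rw [hpow, hψz]
    simp only [norm_mul, hv, mul_one, Complex.norm_real, norm_norm]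
    push_cast
    ring
  rw [hsplit]
  refine (norm_add₃_le).trans ?_
  simp only [norm_mul, hv, mul_one, Complex.norm_real, Real.norm_eq_abs, abs_of_nonneg hra]
  have : r ^ (j + b) * ‖u - v‖ ≤ 1 * θ := mul_le_mul hra1 hangle (norm_nonneg _) zero_le_one
  linarith

/-- The factors are exchanged one at a time; the others have modulus at most `1` and do not amplify
the error. -/
theorem norm_prod_sub_prod_le {ι : Type*} (s : Finset ι) (f g : ι → ℂ) (hf : ∀ i ∈ s, ‖f i‖ ≤ 1)
    (hg : ∀ i ∈ s, ‖g i‖ ≤ 1) : ‖∏ i ∈ s, f i - ∏ i ∈ s, g i‖ ≤ ∑ i ∈ s, ‖f i - g i‖ := by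
  classical
  induction s using Finset.induction_on with
  | empty => simp
  | insert a s ha ih =>
    rw [Finset.prod_insert ha, Finset.prod_insert ha, Finset.sum_insert ha]
    have h1 := ih (fun i hi => hf i (Finset.mem_insert_of_mem hi))
      (fun i hi => hg i (Finset.mem_insert_of_mem hi))
    have h2 : ‖∏ i ∈ s, f i‖ ≤ 1 := by
      rw [norm_prod]
      exact Finset.prod_le_one (fun _ _ => norm_nonneg _)
        (fun i hi => hf i (Finset.mem_insert_of_mem hi))
    have h3 := hg a (Finset.mem_insert_self a s)
    have h4 : f a * ∏ i ∈ s, f i - g a * ∏ i ∈ s, g i =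
        (f a - g a) * ∏ i ∈ s, f i + g a * (∏ i ∈ s, f i - ∏ i ∈ s, g i) := by ring
    rw [h4]
    refine (norm_add_le _ _).trans ?_
    rw [norm_mul, norm_mul]
    nlinarith [norm_nonneg (f a - g a), norm_nonneg (∏ i ∈ s, f i - ∏ i ∈ s, g i),
      norm_nonneg (g a)]

/-! ### Expected utilities of exponential sums -/

namespace ExpSum

variable (E : ExpSum)

theorem norm_pow_le_one (k : Fin E.L) (x : ℝ≥0) : ‖E.pow k x‖ ≤ 1 := by
  have h : (2 * Real.pi * Complex.I * E.branch k * ((x : ℝ) : ℂ)) =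
      ((2 * Real.pi * E.branch k * x : ℝ) : ℂ) * Complex.I := by push_cast; ring
  rw [pow, norm_mul, Complex.norm_cpow_real, h, Complex.norm_exp_ofReal_mul_I, mul_one]
  exact Real.rpow_le_one (norm_nonneg _) (E.norm_le k) x.2

theorem pow_zero_right (k : Fin E.L) : E.pow k 0 = 1 := by simp [pow]

theorem pow_add (k : Fin E.L) (x y : ℝ≥0) : E.pow k (x + y) = E.pow k x * E.pow k y := by
  -- Zero exponents are treated first because `0 ^ 0 = 1`: for `φ = 0` the power vanishes at every
  -- other exponent, and `Complex.cpow_add` needs a nonzero base.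
  by_cases hx : x = 0
  · simp [hx, pow_zero_right]
  by_cases hy : y = 0
  · simp [hy, pow_zero_right]
  have hxy : x + y ≠ 0 := by simp [hx]
  by_cases h : E.φ k = 0
  · have h0 : ∀ z : ℝ≥0, z ≠ 0 → E.pow k z = 0 := by
      intro z hz
      rw [pow, h, Complex.zero_cpow (by simpa using hz), zero_mul]
    rw [h0 _ hx, h0 _ hxy, zero_mul]
  · simp only [pow]
    push_cast
    rw [Complex.cpow_add _ _ h, mul_add, Complex.exp_add]
    ring

theorem pow_sum {ι : Type*} (k : Fin E.L) (s : Finset ι) (f : ι → ℝ≥0) :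
    E.pow k (∑ i ∈ s, f i) = ∏ i ∈ s, E.pow k (f i) := by
  classical
  induction s using Finset.induction_on with
  | empty => simp [pow_zero_right]
  | insert a s ha ih => rw [Finset.sum_insert ha, Finset.prod_insert ha, pow_add, ih]

theorem measurable_pow (k : Fin E.L) : Measurable (E.pow k) := by
  unfold pow
  fun_prop

variable {n : ℕ} (W : RandomWeights n)

theorem norm_expect_le_one (k : Fin E.L) (e : Fin n) : ‖E.expect W k e‖ ≤ 1 := by
  have := norm_integral_le_of_norm_le_const (μ := W.ν) (f := fun ω => E.pow k (W.w e ω)) (C := 1)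
    (.of_forall fun _ => E.norm_pow_le_one k _)
  simpa [expect] using this

theorem measurable_total (S : Finset (Fin n)) : Measurable (W.total S) := by
  unfold RandomWeights.total
  exact Finset.measurable_sum _ fun e _ => W.measurable_w e

theorem integrable_pow_total (k : Fin E.L) (S : Finset (Fin n)) :
    Integrable (fun ω => E.pow k (W.total S ω)) W.ν :=
  Integrable.of_bound ((E.measurable_pow k).comp (measurable_total W S)).aestronglyMeasurable 1
    (.of_forall fun _ => E.norm_pow_le_one k _)

theorem integral_pow_total (k : Fin E.L) (S : Finset (Fin n)) :
    ∫ ω, E.pow k (W.total S ω) ∂W.ν = ∏ e ∈ S, E.expect W k e := by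
  -- Factors outside `S` are replaced by `1`, so that the product formula for the whole independent
  -- family applies.
  have hind := W.indep.comp (fun e x => if e ∈ S then E.pow k x else 1) (fun e => by
    by_cases h : e ∈ S
    · simpa [h] using E.measurable_pow k
    · simp [h])
  have := hind.integral_fun_prod_eq_prod_integral (fun e => by
    by_cases h : e ∈ S
    · simpa [h, Function.comp_def] using
        ((E.measurable_pow k).comp (W.measurable_w e)).aestronglyMeasurable
    · simp [h, Function.comp_def, aestronglyMeasurable_const])
  have h1 : ∀ ω, ∏ e, ((fun x => if e ∈ S then E.pow k x else 1) ∘ W.w e) ω =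
      E.pow k (W.total S ω) := by
    intro ω
    rw [RandomWeights.total, pow_sum]
    simp [Finset.prod_ite_mem]
  simp only [h1] at this
  rw [this, ← Finset.prod_filter_mul_prod_filter_not Finset.univ (· ∈ S)]
  rw [Finset.prod_congr rfl (g := fun e => E.expect W k e), Finset.prod_eq_one (s := {e | e ∉ S})]
  · simp
  · intro e he
    simp only [Finset.mem_filter, Finset.mem_univ, true_and] at he
    simp [he]
  · intro e he
    simp only [Finset.mem_filter, Finset.mem_univ, true_and] at he
    simp [he, expect]

/-- The expected value of the exponential sum at the weight of `S`. -/
noncomputable def expectedSum (S : Finset (Fin n)) : ℂ := ∑ k, E.c k * ∏ e ∈ S, E.expect W k e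

theorem abs_expectedUtility_sub_le {μ : ℝ≥0 → ℝ} (hμ : Measurable μ) {ε : ℝ}
    (h : E.Approximates μ ε) (S : Finset (Fin n)) :
    |W.expectedUtility μ S - (E.expectedSum W S).re| ≤ ε := by
  have hint : Integrable (fun ω => E.eval (W.total S ω)) W.ν := by
    unfold eval
    exact integrable_finsetSum _ fun k _ => (E.integrable_pow_total W k S).const_mul _
  -- Integrability of the utility is not assumed. It follows because the utility differs from the
  -- integrable exponential sum by a bounded measurable function.
  have hdiff : Integrable (fun ω => (μ (W.total S ω) : ℂ) - E.eval (W.total S ω)) W.ν := by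
    refine Integrable.of_bound ?_ ε (.of_forall fun ω => ?_)
    · exact ((Complex.measurable_ofReal.comp hμ).comp
        (measurable_total W S)).aestronglyMeasurable.sub hint.aestronglyMeasurable
    · rw [norm_sub_rev]; exact h _
  have hval : ∫ ω, E.eval (W.total S ω) ∂W.ν = E.expectedSum W S := by
    unfold eval expectedSum
    rw [integral_finsetSum _ fun k _ => (E.integrable_pow_total W k S).const_mul _]
    refine Finset.sum_congr rfl fun k _ => ?_
    rw [integral_const_mul, integral_pow_total]
  have hμint : Integrable (fun ω => (μ (W.total S ω) : ℂ)) W.ν := by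
    refine (hdiff.add hint).congr (.of_forall fun ω => ?_)
    simp
  have hu : (W.expectedUtility μ S : ℂ) = ∫ ω, (μ (W.total S ω) : ℂ) ∂W.ν := by
    rw [RandomWeights.expectedUtility, integral_complex_ofReal]
  have hb : ‖(W.expectedUtility μ S : ℂ) - E.expectedSum W S‖ ≤ ε := by
    rw [hu, ← hval, ← integral_sub hμint hint]
    have := norm_integral_le_of_norm_le_const (μ := W.ν)
      (f := fun ω => (μ (W.total S ω) : ℂ) - E.eval (W.total S ω)) (C := ε)
      (.of_forall fun _ => by rw [norm_sub_rev]; exact h _)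
    simpa using this
  have := Complex.abs_re_le_norm ((W.expectedUtility μ S : ℂ) - E.expectedSum W S)
  simp only [Complex.sub_re, Complex.ofReal_re] at this
  exact this.trans hb

end ExpSum

/-! ### Discretization of the expected utility -/

/-- The numerical part of the input: `n` elements, the accuracy `1 / N`, the number `L` of terms,
and integer approximations of coefficients (arguments `k` and the precision) and expectations
(arguments `k`, `e` and the precision). -/
structure UtilityData where
  n : ℕ
  N : ℕ
  L : ℕ
  cRe : ℕ → ℕ → ℤ
  cIm : ℕ → ℕ → ℤ
  eRe : ℕ → ℕ → ℕ → ℤ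
  eIm : ℕ → ℕ → ℕ → ℤ

namespace UtilityData

variable (D : UtilityData)

/-- The sum of the approximate absolute values of the first `j` coefficients, times `L`. -/
def absSum (j : ℕ) : ℕ := ∑ k ∈ Finset.range j, ((D.cRe k D.L).natAbs + (D.cIm k D.L).natAbs)

/-- An upper bound of the sum of the absolute values of the coefficients. -/
def coeffBound : ℕ := D.absSum D.L / D.L + 3

/-- The parameter of the spiral. -/
def M : ℕ := D.n * D.N * D.coeffBound

/-- An upper bound of the exponents that occur for sets of elements. -/
def maxExp : ℕ := 8 * D.n * D.M ^ 3

/-- The base in which vectors of exponents are encoded. -/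
def base : ℕ := D.maxExp + 1

/-- The scale of the approximate powers of `spiral M`. -/
def scale : ℕ := D.n * D.M ^ 4

/-- The scale of the approximate coefficients. -/
def coeffScale : ℕ := D.N * D.L

/-- The approximate real and imaginary parts of `scale * spiral M ^ a`. -/
def table : ℕ → ℤ × ℤ
  | 0 => (D.scale, 0)
  | a + 1 => ((((D.M : ℤ) * D.M - 1) * (table a).1 - D.M * (table a).2) / ((D.M : ℤ) * D.M),
      (D.M * (table a).1 + ((D.M : ℤ) * D.M - 1) * (table a).2) / ((D.M : ℤ) * D.M))

/-- The distance of a table entry from an approximate expectation. -/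
def dist (k e a : ℕ) : ℤ :=
  |(D.table a).1 - D.eRe k e D.scale| + |(D.table a).2 - D.eIm k e D.scale|

/-- The largest acceptable distance. -/
def tolerance : ℕ := 60 * D.n * D.M ^ 3

/-- The exponent of the first power of `spiral M` close to the `k`-th expectation of `e`. -/
noncomputable def exponent (k e : ℕ) : ℕ := sInf {a | D.dist k e a ≤ D.tolerance}

/-- The encoded exponents of `e` for the first `j` terms. -/
noncomputable def partialWeight (j e : ℕ) : ℕ :=
  ∑ k ∈ Finset.range j, D.exponent k e * D.base ^ k

/-- The weight of the element `e` in the exact problem. -/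
noncomputable def weight (e : ℕ) : ℕ := D.partialWeight D.L e

/-- One term of the value of an encoded vector of exponents. -/
def term (K k : ℕ) : ℤ :=
  D.cRe k D.coeffScale * (D.table (K / D.base ^ k % D.base)).1 -
    D.cIm k D.coeffScale * (D.table (K / D.base ^ k % D.base)).2

/-- The first `j` terms of the value of an encoded vector of exponents. -/
def partialValue (K j : ℕ) : ℤ := ∑ k ∈ Finset.range j, D.term K k

/-- The scaled approximate expected utility for an encoded vector of exponents. -/
def value (K : ℕ) : ℤ := D.partialValue K D.L

/-- The data are correct for an exponential sum and random weights. -/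
structure Correct (E : ExpSum) {n : ℕ} (W : RandomWeights n) : Prop where
  n_eq : D.n = n
  n_pos : 0 < D.n
  N_pos : 2 ≤ D.N
  L_eq : D.L = E.L
  cRe : ∀ k : Fin E.L, Presents (D.cRe k) (E.c k).re
  cIm : ∀ k : Fin E.L, Presents (D.cIm k) (E.c k).im
  eRe : ∀ (k : Fin E.L) (e : Fin n), Presents (D.eRe k e) (E.expect W k e).re
  eIm : ∀ (k : Fin E.L) (e : Fin n), Presents (D.eIm k e) (E.expect W k e).im

/-- The entry of the table as a complex number. -/
def entry (a : ℕ) : ℂ := ⟨(D.table a).1, (D.table a).2⟩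

theorem abs_ediv_sub_le (x : ℤ) {y : ℤ} (hy : 0 < y) : |((x / y : ℤ) : ℝ) - x / y| ≤ 1 := by
  have h1 : (y : ℝ) * ((x / y : ℤ) : ℝ) ≤ x := by exact_mod_cast Int.mul_ediv_self_le hy.ne'
  have h2 : (x : ℝ) ≤ y * ((x / y : ℤ) : ℝ) + y := by
    exact_mod_cast (Int.lt_mul_ediv_self_add hy).le
  have hy' : (0 : ℝ) < y := by exact_mod_cast hy
  have h3 : ((x / y : ℤ) : ℝ) ≤ x / y := by rw [le_div_iff₀ hy']; linarith
  have h4 : (x : ℝ) / y ≤ ((x / y : ℤ) : ℝ) + 1 := by rw [div_le_iff₀ hy']; linarith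
  rw [abs_le]; constructor <;> linarith

/-- The integer recurrence multiplies by `spiral M`, whose coordinates have denominator `M * M`, and
rounds down each coordinate. Each step adds an error of at most `2`, and earlier errors do not grow
because the multiplier has modulus at most `1`. -/
theorem norm_entry_sub_le (hM : 2 ≤ D.M) (a : ℕ) :
    ‖D.entry a - D.scale * spiral D.M ^ a‖ ≤ 2 * a := by
  have hM0 : (D.M : ℝ) ≠ 0 := by positivity
  have hMM : (0 : ℤ) < (D.M : ℤ) * D.M := by positivity
  induction a with
  | zero => simp [entry, table, ← Complex.ofReal_natCast, Complex.mk_eq_add_mul_I]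
  | succ a ih =>
    have hstep : ‖D.entry (a + 1) - spiral D.M * D.entry a‖ ≤ 2 := by
      refine (Complex.norm_le_abs_re_add_abs_im _).trans ?_
      have h1 := abs_ediv_sub_le (((D.M : ℤ) * D.M - 1) * (D.table a).1 - D.M * (D.table a).2) hMM
      have h2 := abs_ediv_sub_le (D.M * (D.table a).1 + ((D.M : ℤ) * D.M - 1) * (D.table a).2) hMM
      have e1 : (D.entry (a + 1) - spiral D.M * D.entry a).re =
          (((((D.M : ℤ) * D.M - 1) * (D.table a).1 - D.M * (D.table a).2) /
            ((D.M : ℤ) * D.M) : ℤ) : ℝ) -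
          ((((D.M : ℤ) * D.M - 1) * (D.table a).1 - D.M * (D.table a).2 : ℤ) : ℝ) /
            (((D.M : ℤ) * D.M : ℤ) : ℝ) := by
        simp only [entry, table, spiral, Complex.sub_re, Complex.mul_re]
        push_cast
        field_simp
      have e2 : (D.entry (a + 1) - spiral D.M * D.entry a).im =
          (((D.M * (D.table a).1 + ((D.M : ℤ) * D.M - 1) * (D.table a).2) /
            ((D.M : ℤ) * D.M) : ℤ) : ℝ) -
          ((D.M * (D.table a).1 + ((D.M : ℤ) * D.M - 1) * (D.table a).2 : ℤ) : ℝ) /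
            (((D.M : ℤ) * D.M : ℤ) : ℝ) := by
        simp only [entry, table, spiral, Complex.sub_im, Complex.mul_im]
        push_cast
        field_simp
        ring
      rw [e1, e2]
      linarith
    have h : D.entry (a + 1) - D.scale * spiral D.M ^ (a + 1) =
        (D.entry (a + 1) - spiral D.M * D.entry a) +
          spiral D.M * (D.entry a - D.scale * spiral D.M ^ a) := by ring
    rw [h]
    refine (norm_add_le _ _).trans ?_
    rw [norm_mul]
    have := (norm_spiral_bounds hM).2.1
    have h3 := mul_le_mul this ih (norm_nonneg _) zero_le_one
    push_cast
    linarith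

theorem norm_entry_le (hM : 2 ≤ D.M) (a : ℕ) : ‖D.entry a‖ ≤ D.scale + 2 * a := by
  have h := D.norm_entry_sub_le hM a
  have h1 : ‖(D.scale : ℂ) * spiral D.M ^ a‖ ≤ D.scale := by
    rw [norm_mul, norm_pow, Complex.norm_natCast]
    exact mul_le_of_le_one_right (by positivity)
      (pow_le_one₀ (norm_nonneg _) (norm_spiral_bounds hM).2.1)
  have := norm_sub_norm_le (D.entry a) (D.scale * spiral D.M ^ a)
  linarith

theorem abs_table_le (hM : 2 ≤ D.M) (a : ℕ) :
    |(D.table a).1| ≤ (D.scale + 2 * a : ℕ) ∧ |(D.table a).2| ≤ (D.scale + 2 * a : ℕ) := by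
  have h := D.norm_entry_le hM a
  have h1 := (Complex.abs_re_le_norm (D.entry a)).trans h
  have h2 := (Complex.abs_im_le_norm (D.entry a)).trans h
  simp only [entry] at h1 h2
  exact ⟨by exact_mod_cast h1, by exact_mod_cast h2⟩

variable {D} {E : ExpSum} {n : ℕ} {W : RandomWeights n}

theorem sum_digits_lt {B : ℕ} (s : ℕ → ℕ) (L : ℕ) (h : ∀ k < L, s k < B) :
    ∑ k ∈ Finset.range L, s k * B ^ k < B ^ L := by
  induction L with
  | zero => simp
  | succ L ih =>
    rw [Finset.sum_range_succ, pow_succ]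
    have h1 := ih fun k hk => h k (by omega)
    have h2 : (s L + 1) * B ^ L ≤ B * B ^ L := Nat.mul_le_mul_right _ (h L (by omega))
    nlinarith

theorem digit_sum {B : ℕ} (s : ℕ → ℕ) (L : ℕ) (h : ∀ k < L, s k < B) (j : ℕ) (hj : j < L) :
    (∑ k ∈ Finset.range L, s k * B ^ k) / B ^ j % B = s j := by
  induction L generalizing s j with
  | zero => omega
  | succ L ih =>
    have hB : 0 < B := (Nat.zero_le _).trans_lt (h 0 (by omega))
    have hs : ∑ k ∈ Finset.range (L + 1), s k * B ^ k =
        s 0 + B * ∑ k ∈ Finset.range L, s (k + 1) * B ^ k := by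
      rw [Finset.sum_range_succ', Finset.mul_sum, add_comm]
      simp only [pow_zero, mul_one, pow_succ]
      congr 1
      exact Finset.sum_congr rfl fun _ _ => by ring
    rw [hs]
    cases j with
    | zero => simp [Nat.mod_eq_of_lt (h 0 (by omega))]
    | succ j =>
      rw [pow_succ', ← Nat.div_div_eq_div_mul, Nat.add_mul_div_left _ _ hB,
        Nat.div_eq_of_lt (h 0 (by omega)), zero_add]
      exact ih (fun k => s (k + 1)) (fun k hk => h (k + 1) (by omega)) j (by omega)

/-! ### Error analysis of the rounded objective -/

namespace Correct

theorem L_pos (h : D.Correct E W) : 0 < D.L := h.L_eq ▸ E.L_pos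

theorem three_le_coeffBound (D : UtilityData) : 3 ≤ D.coeffBound := Nat.le_add_left _ _

theorem six_le_M (h : D.Correct E W) : 6 ≤ D.M := by
  have h1 := three_le_coeffBound D
  have h2 := h.n_pos
  have h3 := h.N_pos
  calc 6 = 1 * 2 * 3 := by norm_num
    _ ≤ _ := Nat.mul_le_mul (Nat.mul_le_mul h2 h3) h1

theorem absSum_bounds (h : D.Correct E W) :
    D.L * E.coeffNorm ≤ D.absSum D.L + 2 * D.L ∧
      D.absSum D.L ≤ 2 * D.L * E.coeffNorm + 2 * D.L := by
  have hs : (D.absSum D.L : ℝ) = ∑ k : Fin E.L, (|(D.cRe k D.L : ℝ)| + |(D.cIm k D.L : ℝ)|) := by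
    rw [absSum, Nat.cast_sum, h.L_eq, Finset.sum_range]
    refine Finset.sum_congr rfl fun k _ => ?_
    rw [Nat.cast_add, Nat.cast_natAbs, Nat.cast_natAbs, Int.cast_abs, Int.cast_abs]
  have key : ∀ k : Fin E.L,
      D.L * ‖E.c k‖ ≤ |(D.cRe k D.L : ℝ)| + |(D.cIm k D.L : ℝ)| + 2 ∧
      |(D.cRe k D.L : ℝ)| + |(D.cIm k D.L : ℝ)| ≤ 2 * D.L * ‖E.c k‖ + 2 := by
    intro k
    have h1 := h.cRe k D.L
    have h2 := h.cIm k D.L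
    have h3 := Complex.norm_le_abs_re_add_abs_im (E.c k)
    have h4 := Complex.abs_re_le_norm (E.c k)
    have h5 := Complex.abs_im_le_norm (E.c k)
    have hL0 : (0 : ℝ) ≤ D.L := by positivity
    have h6 : |D.L * (E.c k).re| = D.L * |(E.c k).re| := by rw [abs_mul, abs_of_nonneg hL0]
    have h7 : |D.L * (E.c k).im| = D.L * |(E.c k).im| := by rw [abs_mul, abs_of_nonneg hL0]
    have a1 := abs_sub_abs_le_abs_sub (D.cRe k D.L : ℝ) (D.L * (E.c k).re)
    have a2 := abs_sub_abs_le_abs_sub (D.L * (E.c k).re) (D.cRe k D.L : ℝ)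
    have a3 := abs_sub_abs_le_abs_sub (D.cIm k D.L : ℝ) (D.L * (E.c k).im)
    have a4 := abs_sub_abs_le_abs_sub (D.L * (E.c k).im) (D.cIm k D.L : ℝ)
    rw [abs_sub_comm] at a2 a4
    rw [h6] at a1 a2
    rw [h7] at a3 a4
    constructor <;> nlinarith
  have hM : 2 * (D.L : ℝ) = ∑ _k : Fin E.L, (2 : ℝ) := by simp [h.L_eq, mul_comm]
  rw [hs, ExpSum.coeffNorm, Finset.mul_sum, Finset.mul_sum]
  have h1 := Finset.sum_le_sum fun k (_ : k ∈ Finset.univ) => (key k).1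
  have h2 := Finset.sum_le_sum fun k (_ : k ∈ Finset.univ) => (key k).2
  rw [Finset.sum_add_distrib, ← hM] at h1
  rw [Finset.sum_add_distrib (g := fun _ => (2 : ℝ)), ← hM] at h2
  exact ⟨h1, h2⟩

/-- At precision `L` the approximation error is at most `2` per coefficient, hence `2` after
dividing the sum by `L`. The floor loses at most `1` more, which explains the `3` in `coeffBound`.
In the other direction a factor `2` comes from adding real and imaginary parts. -/
theorem coeffNorm_le (h : D.Correct E W) :
    E.coeffNorm ≤ D.coeffBound ∧ (D.coeffBound : ℝ) ≤ 2 * E.coeffNorm + 5 := by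
  obtain ⟨h1, h2⟩ := h.absSum_bounds
  have hL : (0 : ℝ) < D.L := by exact_mod_cast h.L_pos
  have h3 : (D.L : ℝ) * (D.absSum D.L / D.L : ℕ) ≤ D.absSum D.L := by
    exact_mod_cast Nat.mul_div_le _ _
  have h4 : (D.absSum D.L : ℝ) ≤ D.L * (D.absSum D.L / D.L : ℕ) + D.L := by
    exact_mod_cast (Nat.lt_mul_div_succ (D.absSum D.L) h.L_pos).le.trans_eq (by ring)
  have h5 : (D.coeffBound : ℝ) = (D.absSum D.L / D.L : ℕ) + 3 := by
    simp [coeffBound]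
  rw [h5]
  constructor
  · refine le_of_mul_le_mul_left ?_ hL
    nlinarith
  · refine le_of_mul_le_mul_left (?_ : (D.L : ℝ) * _ ≤ _) hL
    nlinarith

theorem norm_spiral_pow_le (h : D.Correct E W) (a : ℕ) : ‖spiral D.M ^ a‖ ≤ 1 := by
  rw [norm_pow]
  exact pow_le_one₀ (norm_nonneg _) (norm_spiral_bounds (by have := h.six_le_M; omega)).2.1

/-- In units of `n * M ^ 3`, a coordinate is off by at most `12` for the net, `16` for the table and
`1` for the presentation; two coordinates give `58`, below the tolerance `60`. -/
theorem exists_dist_le (h : D.Correct E W) (k : Fin E.L) (e : Fin n) :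
    ∃ a ≤ 8 * D.M ^ 3, D.dist k e a ≤ D.tolerance := by
  have hM6 := h.six_le_M
  have hM : 2 ≤ D.M := by omega
  obtain ⟨a, ha, hz⟩ := exists_spiral_pow_near hM (E.norm_expect_le_one W k e)
  refine ⟨a, ha, ?_⟩
  have h1 := D.norm_entry_sub_le hM a
  have hR : (0 : ℝ) ≤ D.scale := by positivity
  have hM0 : (0 : ℝ) < D.M := by positivity
  have hn : (1 : ℝ) ≤ D.n := by exact_mod_cast h.n_pos
  have haR : (a : ℝ) ≤ 8 * D.M ^ 3 := by exact_mod_cast ha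
  have hscale : (D.scale : ℝ) * (12 / D.M) = 12 * (D.n * D.M ^ 3) := by
    simp only [scale]; push_cast; field_simp
  have h2 : ‖D.entry a - D.scale * E.expect W k e‖ ≤ 28 * (D.n * D.M ^ 3) := by
    have : D.entry a - D.scale * E.expect W k e = (D.entry a - D.scale * spiral D.M ^ a) +
        D.scale * (spiral D.M ^ a - E.expect W k e) := by ring
    rw [this]
    refine (norm_add_le _ _).trans ?_
    rw [norm_mul, Complex.norm_natCast]
    have := mul_le_mul_of_nonneg_left hz hR
    have h3 : (D.M : ℝ) ^ 3 ≤ D.n * D.M ^ 3 := le_mul_of_one_le_left (by positivity) hn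
    linarith
  have h3 := (Complex.abs_re_le_norm _).trans h2
  have h4 := (Complex.abs_im_le_norm _).trans h2
  simp only [entry, Complex.sub_re, Complex.sub_im, Complex.mul_re, Complex.mul_im,
    Complex.natCast_re, Complex.natCast_im, zero_mul, sub_zero, add_zero] at h3 h4
  have h5 := h.eRe k e D.scale
  have h6 := h.eIm k e D.scale
  have h7 : (1 : ℝ) ≤ D.n * D.M ^ 3 := by
    exact_mod_cast Nat.mul_pos h.n_pos (by positivity)
  have h8 : ((D.dist k e a : ℤ) : ℝ) ≤ D.tolerance := by
    simp only [dist, tolerance]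
    push_cast
    have b1 := abs_sub_le ((D.table a).1 : ℝ) (D.scale * (E.expect W k e).re) (D.eRe k e D.scale)
    have b2 := abs_sub_le ((D.table a).2 : ℝ) (D.scale * (E.expect W k e).im) (D.eIm k e D.scale)
    rw [abs_sub_comm (D.scale * _ : ℝ)] at b1 b2
    linarith
  exact_mod_cast h8

theorem dist_exponent_le (h : D.Correct E W) (k : Fin E.L) (e : Fin n) :
    D.dist k e (D.exponent k e) ≤ D.tolerance := by
  obtain ⟨a, -, ha⟩ := h.exists_dist_le k e
  exact Nat.sInf_mem (s := {a | D.dist k e a ≤ D.tolerance}) ⟨a, ha⟩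

theorem exponent_le (h : D.Correct E W) (k : Fin E.L) (e : Fin n) :
    D.exponent k e ≤ 8 * D.M ^ 3 := by
  obtain ⟨a, ha, ha'⟩ := h.exists_dist_le k e
  exact (Nat.sInf_le (s := {a | D.dist k e a ≤ D.tolerance}) ha').trans ha

theorem exponent_le_maxExp (h : D.Correct E W) (k : Fin E.L) (e : Fin n) :
    D.exponent k e ≤ D.maxExp := by
  refine (h.exponent_le k e).trans ?_
  rw [maxExp]
  have := h.n_pos
  exact Nat.mul_le_mul_right _ (by omega)

/-- Conversely, acceptance by the integer test certifies closeness: `60` for the tolerance, `2` for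
the presentations and `16` for the table, in the same units. -/
theorem norm_spiral_exponent_sub_le (h : D.Correct E W) (k : Fin E.L) (e : Fin n) :
    ‖spiral D.M ^ D.exponent k e - E.expect W k e‖ ≤ 80 / D.M := by
  have hM6 := h.six_le_M
  have hM : 2 ≤ D.M := by omega
  have hd := h.dist_exponent_le k e
  have hle := h.exponent_le k e
  set a := D.exponent k e
  have h1 := D.norm_entry_sub_le hM a
  have hM0 : (0 : ℝ) < D.M := by positivity
  have hn : (1 : ℝ) ≤ D.n := by exact_mod_cast h.n_pos
  have haR : (a : ℝ) ≤ 8 * D.M ^ 3 := by exact_mod_cast hle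
  have h3 : (D.M : ℝ) ^ 3 ≤ D.n * D.M ^ 3 := le_mul_of_one_le_left (by positivity) hn
  have h7 : (1 : ℝ) ≤ D.n * D.M ^ 3 := by
    exact_mod_cast Nat.mul_pos h.n_pos (by positivity)
  have h8 : ((D.dist k e a : ℤ) : ℝ) ≤ D.tolerance := by exact_mod_cast hd
  have h2 : ‖D.entry a - D.scale * E.expect W k e‖ ≤ 62 * (D.n * D.M ^ 3) := by
    refine (Complex.norm_le_abs_re_add_abs_im _).trans ?_
    simp only [entry, Complex.sub_re, Complex.sub_im, Complex.mul_re, Complex.mul_im,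
      Complex.natCast_re, Complex.natCast_im, zero_mul, sub_zero, add_zero]
    simp only [dist, tolerance] at h8
    push_cast at h8
    have h5 := h.eRe k e D.scale
    have h6 := h.eIm k e D.scale
    have b1 := abs_sub_le ((D.table a).1 : ℝ) (D.eRe k e D.scale) (D.scale * (E.expect W k e).re)
    have b2 := abs_sub_le ((D.table a).2 : ℝ) (D.eIm k e D.scale) (D.scale * (E.expect W k e).im)
    linarith
  have hR : (0 : ℝ) < D.scale := by
    exact_mod_cast Nat.mul_pos h.n_pos (by positivity)
  have h9 : D.scale * ‖spiral D.M ^ a - E.expect W k e‖ ≤ D.scale * (80 / D.M) := by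
    have e1 : (D.scale : ℝ) * (80 / D.M) = 80 * (D.n * D.M ^ 3) := by
      simp only [scale]; push_cast; field_simp
    have e2 : D.scale * ‖spiral D.M ^ a - E.expect W k e‖ =
        ‖(D.scale : ℂ) * (spiral D.M ^ a - E.expect W k e)‖ := by
      rw [norm_mul, Complex.norm_natCast]
    have e3 : (D.scale : ℂ) * (spiral D.M ^ a - E.expect W k e) =
        (D.entry a - D.scale * E.expect W k e) - (D.entry a - D.scale * spiral D.M ^ a) := by ring
    rw [e1, e2, e3]
    refine (norm_sub_le _ _).trans ?_
    linarith
  exact le_of_mul_le_mul_left h9 hR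

/-- The weight of a set of elements in the exact problem. -/
noncomputable def _root_.UtilityData.setWeight (D : UtilityData) {n : ℕ} (S : Finset (Fin n)) :
    ℕ := ∑ e ∈ S, D.weight e

theorem setWeight_eq (D : UtilityData) {n : ℕ} (S : Finset (Fin n)) :
    D.setWeight S = ∑ k ∈ Finset.range D.L, (∑ e ∈ S, D.exponent k e) * D.base ^ k := by
  simp only [setWeight, weight, partialWeight, Finset.sum_mul]
  exact Finset.sum_comm

/-- The factor `n` in `maxExp` leaves room for adding up the exponents of all elements, so that no
carries occur in `digit_setWeight`. -/
theorem sum_exponent_le (h : D.Correct E W) (S : Finset (Fin n)) (k : ℕ) (hk : k < D.L) :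
    ∑ e ∈ S, D.exponent k e ≤ D.maxExp := by
  rw [h.L_eq] at hk
  calc ∑ e ∈ S, D.exponent k e ≤ ∑ _e ∈ S, 8 * D.M ^ 3 :=
        Finset.sum_le_sum fun e _ => h.exponent_le ⟨k, hk⟩ e
    _ = S.card * (8 * D.M ^ 3) := by simp
    _ ≤ D.n * (8 * D.M ^ 3) :=
        Nat.mul_le_mul_right _ (by simpa [h.n_eq] using Finset.card_le_univ S)
    _ = D.maxExp := by rw [maxExp]; ring

theorem setWeight_lt (h : D.Correct E W) (S : Finset (Fin n)) :
    D.setWeight S < D.base ^ D.L := by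
  rw [setWeight_eq]
  exact sum_digits_lt _ _ fun k hk => Nat.lt_succ_of_le (h.sum_exponent_le S k hk)

theorem digit_setWeight (h : D.Correct E W) (S : Finset (Fin n)) (k : ℕ) (hk : k < D.L) :
    D.setWeight S / D.base ^ k % D.base = ∑ e ∈ S, D.exponent k e := by
  rw [setWeight_eq]
  exact digit_sum (fun k => ∑ e ∈ S, D.exponent k e) _
    (fun k hk => Nat.lt_succ_of_le (h.sum_exponent_le S k hk)) k hk

theorem partialWeight_lt (h : D.Correct E W) (j : ℕ) (hj : j ≤ D.L) (e : Fin n) :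
    D.partialWeight j e < D.base ^ j := by
  refine sum_digits_lt _ _ fun k hk => Nat.lt_succ_of_le ?_
  exact h.exponent_le_maxExp ⟨k, by have := h.L_eq; omega⟩ e

/-- Each term has three errors: rounding the coefficient, at most `34 * R`; the table entry, `16 *
(n / M)`; and the net, `80 * (n / M)`, the last two relative to `R * P * ‖c_k‖`. Summed over the
terms, the first is `R * P * (34 / N)` since `P = N * L`, and the others are at most `R * P * (96 /
N)` by the choice of `M`. -/
theorem abs_value_sub_le (h : D.Correct E W) (S : Finset (Fin n)) :
    |(D.value (D.setWeight S) : ℝ) - D.scale * D.coeffScale * (E.expectedSum W S).re| ≤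
      D.scale * D.coeffScale * (130 / D.N) := by
  have hM6 := h.six_le_M
  have hM : 2 ≤ D.M := by omega
  have hM0 : (0 : ℝ) < D.M := by positivity
  have hn : (1 : ℝ) ≤ D.n := by exact_mod_cast h.n_pos
  have hN : (2 : ℝ) ≤ D.N := by exact_mod_cast h.N_pos
  have hL : (1 : ℝ) ≤ D.L := by exact_mod_cast h.L_pos
  have hC := h.coeffNorm_le.1
  have hMeq : (D.M : ℝ) = D.n * D.N * D.coeffBound := by simp [M]
  have hC0 : 0 ≤ E.coeffNorm := Finset.sum_nonneg fun _ _ => norm_nonneg _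
  -- This inequality is the reason for `M = n * N * coeffBound`.
  have hCM : E.coeffNorm * (D.n / D.M) ≤ 1 / D.N := by
    have h3 : (0 : ℝ) < D.coeffBound := by
      exact_mod_cast (by norm_num : 0 < 3).trans_le (three_le_coeffBound D)
    rw [hMeq, show (D.n : ℝ) / (D.n * D.N * D.coeffBound) = 1 / (D.N * D.coeffBound) by
      field_simp, mul_one_div, div_le_div_iff₀ (by positivity) (by positivity)]
    nlinarith
  set s : ℕ → ℕ := fun k => ∑ e ∈ S, D.exponent k e
  set R : ℝ := (D.scale : ℝ)
  set P : ℝ := (D.coeffScale : ℝ)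
  have hR : 0 ≤ R := by positivity
  have hP : 0 ≤ P := by positivity
  set c : Fin E.L → ℂ := fun k => ⟨D.cRe k D.coeffScale, D.cIm k D.coeffScale⟩
  have hval : (D.value (D.setWeight S) : ℝ) = (∑ k : Fin E.L, c k * D.entry (s k)).re := by
    rw [value, partialValue, Int.cast_sum, h.L_eq, Finset.sum_range, Complex.re_sum]
    refine Finset.sum_congr rfl fun k _ => ?_
    rw [term, h.digit_setWeight S k (by rw [h.L_eq]; exact k.2)]
    simp [c, s, entry]
  have hc : ∀ k, ‖c k - P * E.c k‖ ≤ 2 := by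
    intro k
    refine (Complex.norm_le_abs_re_add_abs_im _).trans ?_
    have h1 := h.cRe k D.coeffScale
    have h2 := h.cIm k D.coeffScale
    simp [c, P]
    linarith
  have hsR : ∀ k : Fin E.L, 2 * (s k : ℝ) ≤ 16 * (D.n * D.M ^ 3) := by
    intro k
    have : (s k : ℝ) ≤ D.maxExp := by
      exact_mod_cast h.sum_exponent_le S k (by rw [h.L_eq]; exact k.2)
    simp only [maxExp] at this
    push_cast at this
    linarith
  have hRM : (D.n : ℝ) * D.M ^ 3 = R * (1 / D.M) := by
    simp only [R, scale]; push_cast; field_simp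
  have hRM' : (D.n : ℝ) * D.M ^ 3 ≤ R := by
    rw [hRM]
    refine mul_le_of_le_one_right hR ?_
    rw [div_le_one hM0]
    exact_mod_cast (by omega : 1 ≤ D.M)
  have hterm : ∀ k : Fin E.L, ‖c k * D.entry (s k) - R * P * (E.c k * ∏ e ∈ S, E.expect W k e)‖ ≤
      34 * R + R * P * (‖E.c k‖ * (96 * (D.n / D.M))) := by
    intro k
    have h1 := D.norm_entry_sub_le hM (s k)
    have h2 := D.norm_entry_le hM (s k)
    have h3 : ‖spiral D.M ^ s k - ∏ e ∈ S, E.expect W k e‖ ≤ 80 * (D.n / D.M) := by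
      rw [← Finset.prod_pow_eq_pow_sum]
      refine (norm_prod_sub_prod_le S _ _ (fun e _ => h.norm_spiral_pow_le _)
        (fun e _ => E.norm_expect_le_one W k e)).trans ?_
      calc ∑ e ∈ S, ‖spiral D.M ^ D.exponent k e - E.expect W k e‖ ≤ ∑ _e ∈ S, 80 / (D.M : ℝ) :=
            Finset.sum_le_sum fun e _ => h.norm_spiral_exponent_sub_le k e
        _ = S.card * (80 / D.M) := by simp
        _ ≤ D.n * (80 / D.M) := by
          gcongr
          simpa [h.n_eq] using Finset.card_le_univ S
        _ = _ := by ring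
    have hsplit : c k * D.entry (s k) - R * P * (E.c k * ∏ e ∈ S, E.expect W k e) =
        (c k - P * E.c k) * D.entry (s k) + P * E.c k * (D.entry (s k) - D.scale * spiral D.M ^ s k)
          + R * P * E.c k * (spiral D.M ^ s k - ∏ e ∈ S, E.expect W k e) := by
      simp only [R]
      push_cast
      ring
    rw [hsplit]
    refine norm_add₃_le.trans ?_
    simp only [norm_mul, Complex.norm_real, Real.norm_eq_abs, abs_of_nonneg hR, abs_of_nonneg hP]
    have hn1 : (1 : ℝ) / D.M ≤ D.n / D.M := by gcongr
    have i1 : ‖c k - P * E.c k‖ * ‖D.entry (s k)‖ ≤ 2 * (17 * R) := by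
      apply mul_le_mul (hc k) _ (norm_nonneg _) (by norm_num)
      linarith [hsR k]
    have i2 : P * ‖E.c k‖ * ‖D.entry (s k) - D.scale * spiral D.M ^ s k‖ ≤
        P * ‖E.c k‖ * (16 * (R * (D.n / D.M))) := by
      gcongr
      have : R * (1 / D.M) ≤ R * (D.n / D.M) := by gcongr
      linarith [hsR k]
    have i3 : R * P * ‖E.c k‖ * ‖spiral D.M ^ s k - ∏ e ∈ S, E.expect W k e‖ ≤
        R * P * ‖E.c k‖ * (80 * (D.n / D.M)) := by gcongr
    linarith
  have hsum : ‖∑ k : Fin E.L, c k * D.entry (s k) - R * P * E.expectedSum W S‖ ≤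
      R * P * (130 / D.N) := by
    rw [ExpSum.expectedSum, Finset.mul_sum, ← Finset.sum_sub_distrib]
    refine (norm_sum_le _ _).trans ((Finset.sum_le_sum fun k _ => hterm k).trans ?_)
    have e1 : ∑ _k : Fin E.L, 34 * R = R * P * (34 / D.N) := by
      simp only [Finset.sum_const, Finset.card_univ, Fintype.card_fin, nsmul_eq_mul, P, coeffScale,
        ← h.L_eq]
      push_cast
      field_simp
    rw [Finset.sum_add_distrib, e1, ← Finset.mul_sum, ← Finset.sum_mul]
    have e2 : (∑ k, ‖E.c k‖) * (96 * (D.n / D.M)) ≤ 96 / D.N := by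
      have : (∑ k, ‖E.c k‖) = E.coeffNorm := rfl
      rw [this]
      calc E.coeffNorm * (96 * (D.n / D.M)) = 96 * (E.coeffNorm * (D.n / D.M)) := by ring
        _ ≤ 96 * (1 / D.N) := by gcongr
        _ = _ := by ring
    calc R * P * (34 / D.N) + R * P * ((∑ k, ‖E.c k‖) * (96 * (D.n / D.M))) ≤
          R * P * (34 / D.N) + R * P * (96 / D.N) := by gcongr
      _ = _ := by ring
  have hre := (Complex.abs_re_le_norm _).trans hsum
  rw [Complex.sub_re, ← hval] at hre
  have : ((R : ℂ) * P * E.expectedSum W S).re = R * P * (E.expectedSum W S).re := by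
    rw [← Complex.ofReal_mul, Complex.re_ofReal_mul]
  rwa [this] at hre

/-- A set with the best value is nearly optimal. -/
theorem expectedUtility_le_of_value_le (h : D.Correct E W) {μ : ℝ≥0 → ℝ} (hμ : Measurable μ)
    (hE : E.Approximates μ (1 / D.N)) {S S' : Finset (Fin n)}
    (hS : D.value (D.setWeight S') ≤ D.value (D.setWeight S)) :
    W.expectedUtility μ S' - 262 / D.N ≤ W.expectedUtility μ S := by
  have h1 := h.abs_value_sub_le S
  have h2 := h.abs_value_sub_le S'
  have h3 := E.abs_expectedUtility_sub_le W hμ hE S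
  have h4 := E.abs_expectedUtility_sub_le W hμ hE S'
  have hS' : (D.value (D.setWeight S') : ℝ) ≤ D.value (D.setWeight S) := by exact_mod_cast hS
  have hRP : (0 : ℝ) < D.scale * D.coeffScale := by
    have := h.six_le_M
    have hR : 0 < D.scale := Nat.mul_pos h.n_pos (by positivity)
    have hP : 0 < D.coeffScale := Nat.mul_pos (by have := h.N_pos; omega) h.L_pos
    positivity
  have h5 : D.scale * D.coeffScale * (E.expectedSum W S').re ≤
      D.scale * D.coeffScale * ((E.expectedSum W S).re + 260 / D.N) := by
    have e : D.scale * D.coeffScale * ((E.expectedSum W S).re + 260 / D.N) =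
        D.scale * D.coeffScale * (E.expectedSum W S).re +
          2 * (D.scale * D.coeffScale * (130 / D.N)) := by ring
    rw [e]
    rw [abs_le] at h1 h2
    linarith
  have h6 := le_of_mul_le_mul_left h5 hRP
  rw [abs_le] at h3 h4
  -- Both sets contribute `130 / N` for the rounded objective and `1 / N` for the exponential sum.
  have e1 : (262 : ℝ) / D.N = 260 / D.N + 2 * (1 / D.N) := by ring
  rw [e1]
  linarith

end Correct

end UtilityData

namespace RAM

/-! ### Symbolic execution of subroutine-free programs -/

instance : Add Expr := ⟨.op .add⟩
instance : Sub Expr := ⟨.op .sub⟩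
instance : Mul Expr := ⟨.op .mul⟩
instance : Div Expr := ⟨.op .div⟩

/-- The variable number `i`, which is kept in cell `i` of array `4`. -/
def var (i : ℤ) : Expr := .mem 4 (.const i)

/-- The absolute value. -/
def absExpr (e : Expr) : Expr := e * (.const 1 - .const 2 * .op .le e (.const 0))

/-- The test `e₁ < e₂`. -/
def ltExpr (e₁ e₂ : Expr) : Expr := .op .le (e₁ + .const 1) e₂

/-- The assignment to the variable number `i`. -/
def put (i : ℤ) (e : Expr) : Cmd := .assign 4 (.const i) e

infixr:60 " ;; " => Cmd.seq

section Eval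

variable {I : Input} {m : Mem}

@[simp] theorem eval_const (z : ℤ) : (Expr.const z).eval I m = z := rfl
@[simp] theorem eval_mem (a : ℕ) (e : Expr) : (Expr.mem a e).eval I m = m a (e.eval I m) := rfl
@[simp] theorem eval_var (i : ℤ) : (var i).eval I m = m 4 i := rfl
@[simp] theorem eval_add (e₁ e₂ : Expr) : (e₁ + e₂).eval I m = e₁.eval I m + e₂.eval I m := rfl
@[simp] theorem eval_sub (e₁ e₂ : Expr) : (e₁ - e₂).eval I m = e₁.eval I m - e₂.eval I m := rfl
@[simp] theorem eval_mul (e₁ e₂ : Expr) : (e₁ * e₂).eval I m = e₁.eval I m * e₂.eval I m := rfl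
@[simp] theorem eval_div (e₁ e₂ : Expr) : (e₁ / e₂).eval I m = e₁.eval I m / e₂.eval I m := rfl

@[simp] theorem eval_le (e₁ e₂ : Expr) :
    (Expr.op .le e₁ e₂).eval I m = if e₁.eval I m ≤ e₂.eval I m then 1 else 0 := rfl

@[simp] theorem eval_eq (e₁ e₂ : Expr) :
    (Expr.op .eq e₁ e₂).eval I m = if e₁.eval I m = e₂.eval I m then 1 else 0 := rfl

@[simp] theorem eval_ltExpr (e₁ e₂ : Expr) :
    (ltExpr e₁ e₂).eval I m = if e₁.eval I m < e₂.eval I m then 1 else 0 := rfl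

@[simp] theorem eval_absExpr (e : Expr) : (absExpr e).eval I m = |e.eval I m| := by
  by_cases h : e.eval I m ≤ 0
  · simp [absExpr, h, abs_of_nonpos h]
  · simp [absExpr, h, abs_of_pos (not_le.1 h)]

@[simp] theorem ok_const (z : ℤ) : (Expr.const z).ok := trivial
@[simp] theorem ok_var (i : ℤ) : (var i).ok := ⟨by norm_num, trivial⟩
@[simp] theorem ok_mem (a : ℕ) (e : Expr) : (Expr.mem a e).ok ↔ a < 5 ∧ e.ok := Iff.rfl
@[simp] theorem ok_op (o : Op) (e₁ e₂ : Expr) : (Expr.op o e₁ e₂).ok ↔ e₁.ok ∧ e₂.ok := Iff.rfl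
@[simp] theorem ok_add (e₁ e₂ : Expr) : (e₁ + e₂).ok ↔ e₁.ok ∧ e₂.ok := Iff.rfl
@[simp] theorem ok_sub (e₁ e₂ : Expr) : (e₁ - e₂).ok ↔ e₁.ok ∧ e₂.ok := Iff.rfl
@[simp] theorem ok_mul (e₁ e₂ : Expr) : (e₁ * e₂).ok ↔ e₁.ok ∧ e₂.ok := Iff.rfl
@[simp] theorem ok_div (e₁ e₂ : Expr) : (e₁ / e₂).ok ↔ e₁.ok ∧ e₂.ok := Iff.rfl
@[simp] theorem ok_ltExpr (e₁ e₂ : Expr) : (ltExpr e₁ e₂).ok ↔ e₁.ok ∧ e₂.ok := by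
  simp [ltExpr]
@[simp] theorem ok_absExpr (e : Expr) : (absExpr e).ok ↔ e.ok := by
  simp [absExpr]

end Eval

/-- Running time of a program per iteration of its loops, in units of a common bound for all
cells. -/
def Cmd.weight : Cmd → ℕ
  | .skip => 1
  | .assign _ i e => 1 + i.weight + e.weight
  | .clear _ => 1
  | .seq c₁ c₂ => 1 + c₁.weight + c₂.weight
  | .ite e c₁ c₂ => 1 + e.weight + c₁.weight + c₂.weight
  | .loop e c => 2 * (1 + e.weight + c.weight)

/-- A triple with the time bound `c.weight * U ^ j`. -/
def Halts (I : Input) (U : ℕ) (c : Cmd) (m : Mem) (j : ℕ) (Q : Mem → Prop) : Prop :=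
  Triple I U c m c.weight j Q

variable {I : Input} {U : ℕ} {m : Mem} {j : ℕ} {Q : Mem → Prop}

theorem Halts.skip (hU : 1 ≤ U) (hQ : Q m) : Halts I U .skip m j Q :=
  (Triple.skip hQ).mono hU le_rfl (Nat.zero_le _) fun _ h => h

theorem Halts.seq {c₁ c₂ : Cmd} {Q' : Mem → Prop} (hU : 1 ≤ U) (h₁ : Halts I U c₁ m j Q')
    (h₂ : ∀ m', Q' m' → Halts I U c₂ m' j Q) : Halts I U (c₁ ;; c₂) m j Q :=
  Triple.seq hU h₁ h₂

theorem Halts.assign {c : Cmd} {a : ℕ} {i e : Expr} (hU : 1 ≤ U) (hj : 1 ≤ j) (iv v : ℤ)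
    (hi : i.ok) (he : e.ok) (hiv : i.eval I m = iv) (hev : e.eval I m = v) (hv : |v| ≤ (U : ℤ))
    (h : Halts I U c (m.set a iv v) j Q) : Halts I U (.assign a i e ;; c) m j Q := by
  subst hiv hev
  refine Triple.seq hU ((Triple.assign (Q := fun m' => m' = _) hU hi he hv rfl).mono hU le_rfl hj
    fun _ h => h) ?_
  rintro _ rfl
  exact h

theorem Halts.put {c : Cmd} {i : ℤ} {e : Expr} (hU : 1 ≤ U) (hj : 1 ≤ j) (v : ℤ)
    (he : e.ok) (hev : e.eval I m = v) (hv : |v| ≤ (U : ℤ))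
    (h : Halts I U c (m.set 4 i v) j Q) : Halts I U (put i e ;; c) m j Q :=
  Halts.assign hU hj i v trivial he rfl hev hv h

theorem Halts.put_inp {c : Cmd} {i : ℤ} {ch r : ℕ} {args : Fin r → Expr} (hU : 1 ≤ U) (hj : 1 ≤ j)
    (v : ℤ) (hargs : ∀ k, (args k).ok)
    (hev : I ch (List.ofFn fun k => (args k).eval I m) = v) (hv : |v| ≤ (U : ℤ))
    (h : Halts I U c (m.set 4 i v) j Q) : Halts I U (RAM.put i (.inp ch args) ;; c) m j Q := by
  subst hev
  refine Triple.seq hU ((Triple.assign_inp (Q := fun m' => m' = _) hU (i := .const i) trivial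
    hargs hv rfl).mono hU le_rfl hj fun _ h => h) ?_
  rintro _ rfl
  exact h

theorem Halts.ite {e : Expr} {c₁ c₂ : Cmd} (hU : 1 ≤ U) (hj : 1 ≤ j) (he : e.ok)
    (h₁ : e.eval I m ≠ 0 → Halts I U c₁ m j Q) (h₂ : e.eval I m = 0 → Halts I U c₂ m j Q) :
    Halts I U (.ite e c₁ c₂) m j Q :=
  Triple.ite hU hj he h₁ h₂

theorem Halts.loop {e : Expr} {c : Cmd} {i : ℕ} (hU : 1 ≤ U) (hi : 1 ≤ i) (hij : i + 1 ≤ j)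
    (he : e.ok) (Inv : ℕ → Mem → Prop) (n : ℕ) (hn : n ≤ U) (h₀ : Inv 0 m)
    (hstep : ∀ k < n, ∀ m, Inv k m → e.eval I m ≠ 0 ∧ Halts I U c m i (Inv (k + 1)))
    (hend : ∀ m, Inv n m → e.eval I m = 0) : Halts I U (.loop e c) m j (Inv n) :=
  (Triple.loop hU hi he Inv n hn h₀ hstep hend).mono hU le_rfl hij fun _ h => h

/-- Apart from the variables in `s`, the memory is unchanged. -/
def Agree (s : Finset ℤ) (m m' : Mem) : Prop := ∀ a < 5, ∀ i, (a = 4 → i ∉ s) → m' a i = m a i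

theorem Agree.refl (s : Finset ℤ) (m : Mem) : Agree s m m := fun _ _ _ _ => rfl

theorem Agree.set {s : Finset ℤ} {m m' : Mem} (h : Agree s m m') {i : ℤ} (hi : i ∈ s) (v : ℤ) :
    Agree s m (m'.set 4 i v) := by
  intro a ha k hk
  have : ¬ (a = 4 ∧ k = i) := by rintro ⟨rfl, rfl⟩; exact hk rfl hi
  rw [Mem.set, if_neg this]
  exact h a ha k hk

end RAM

/-! ### Size bounds and input conventions of the algorithm -/

namespace UtilityData

open RAM

/-- The intermediate results of the algorithm are bounded by `U`, and the search for exponents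
succeeds. -/
structure Admissible (D : UtilityData) (U : ℕ) : Prop where
  one_le : 1 ≤ U
  n_pos : 0 < D.n
  n_le : D.n ≤ U
  N_le : D.N ≤ U
  L_le : D.L ≤ U
  absSum_le : D.absSum D.L ≤ U
  coeffBound_le : D.coeffBound ≤ U
  M_le : D.M ≤ U
  base_le : D.base ≤ U
  scale_le : D.scale ≤ U
  coeffScale_le : D.coeffScale ≤ U
  pow_le : D.base ^ D.L ≤ U
  cRe_le : ∀ k < D.L, |D.cRe k D.L| ≤ U ∧ |D.cRe k D.coeffScale| ≤ U
  cIm_le : ∀ k < D.L, |D.cIm k D.L| ≤ U ∧ |D.cIm k D.coeffScale| ≤ U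
  eRe_le : ∀ k < D.L, ∀ e < D.n, |D.eRe k e D.scale| ≤ U
  eIm_le : ∀ k < D.L, ∀ e < D.n, |D.eIm k e D.scale| ≤ U
  table_le : ∀ a ≤ D.maxExp, |(D.table a).1| ≤ U ∧ |(D.table a).2| ≤ U
  partialValue_le : ∀ K, ∀ j ≤ D.L, |D.partialValue K j| ≤ U
  dist_le : ∀ k < D.L, ∀ e < D.n, D.dist k e (D.exponent k e) ≤ D.tolerance
  exponent_le : ∀ k < D.L, ∀ e < D.n, D.exponent k e ≤ D.maxExp
  partialWeight_lt : ∀ j ≤ D.L, ∀ e < D.n, D.partialWeight j e < D.base ^ j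
  setWeight_lt : ∀ S : Finset (Fin D.n), D.setWeight S < D.base ^ D.L

/-- Access to the data through the input channels. -/
structure IsInput (D : UtilityData) (N₀ J : ℕ) (I : RAM.Input) : Prop where
  n : I 0 [] = D.n
  acc : I 2 [] = N₀
  N : N₀ * J = D.N
  L : I 3 [(D.N : ℤ)] = D.L
  cRe : ∀ k m : ℕ, I 4 [(D.N : ℤ), k, m] = D.cRe k m
  cIm : ∀ k m : ℕ, I 5 [(D.N : ℤ), k, m] = D.cIm k m
  eRe : ∀ k e m : ℕ, I 6 [(D.N : ℤ), k, e, m] = D.eRe k e m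
  eIm : ∀ k e m : ℕ, I 7 [(D.N : ℤ), k, e, m] = D.eIm k e m

variable {D : UtilityData} {U N₀ J : ℕ} {I : RAM.Input}

/-! ### Reading the parameters -/

/-- Read the sizes and sum up the absolute values of the coefficients. -/
def readParams (J : ℕ) : Cmd :=
  put 0 (.inp 0 ![]) ;; put 1 (.inp 2 ![]) ;; put 1 (var 1 * .const J) ;;
  put 2 (.inp 3 ![var 1]) ;;
  .loop (ltExpr (var 8) (var 2))
    (put 11 (.inp 4 ![var 1, var 8, var 2]) ;; put 12 (.inp 5 ![var 1, var 8, var 2]) ;;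
      put 3 (var 3 + (absExpr (var 11) + absExpr (var 12))) ;; put 8 (var 8 + .const 1) ;; .skip)

/-- The state of the memory after the first `j` coefficients have been read. -/
structure Started (D : UtilityData) (j : ℕ) (m : Mem) : Prop where
  n : m 4 0 = D.n
  N : m 4 1 = D.N
  L : m 4 2 = D.L
  sum : m 4 3 = D.absSum j
  k : m 4 8 = j
  zero : ∀ a < 4, ∀ i, m a i = 0

theorem halts_readParams (hD : D.Admissible U) (hI : D.IsInput N₀ J I) (hJ : 1 ≤ J) :
    Halts I U (readParams J) 0 2 (D.Started D.L) := by
  have hU := hD.one_le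
  have hN₀ : N₀ ≤ U := by
    have := hD.N_le
    rw [← hI.N] at this
    exact (Nat.le_mul_of_pos_right _ hJ).trans this
  refine Halts.put_inp hU (by norm_num) D.n (by simp) (by simp [hI.n]) (by simpa using hD.n_le) ?_
  refine Halts.put_inp hU (by norm_num) N₀ (by simp) (by simp [hI.acc]) (by simpa using hN₀) ?_
  refine Halts.put hU (by norm_num) D.N (by simp) (by simp [Mem.set, ← hI.N])
    (by simpa using hD.N_le) ?_
  refine Halts.put_inp hU (by norm_num) D.L (by simp) (by simp [Mem.set, hI.L])
    (by simpa using hD.L_le) ?_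
  refine Halts.loop hU le_rfl le_rfl (by simp) D.Started D.L hD.L_le ?_ ?_ ?_
  -- The accumulator in cell `3` and the counter in cell `8` are never initialized: the run starts
  -- in the zero memory.
  · refine ⟨?_, ?_, ?_, ?_, ?_, ?_⟩
    · simp [Mem.set]
    · simp [Mem.set]
    · simp [Mem.set]
    · simp [Mem.set, absSum]
    · simp [Mem.set]
    · intro a ha i
      simp [Mem.set, ha.ne]
  · intro k hk m hm
    refine ⟨by simp [hm.k, hm.L, hk], ?_⟩
    refine Halts.put_inp hU le_rfl (D.cRe k D.L) ?_ ?_ (hD.cRe_le k hk).1 ?_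
    · simp [Fin.forall_fin_succ]
    · simp [hm.N, hm.L, hm.k, hI.cRe]
    refine Halts.put_inp hU le_rfl (D.cIm k D.L) ?_ ?_ (hD.cIm_le k hk).1 ?_
    · simp [Fin.forall_fin_succ]
    · simp [Mem.set, hm.N, hm.L, hm.k, hI.cIm]
    refine Halts.put hU le_rfl (D.absSum (k + 1)) (by simp) ?_ ?_ ?_
    · simp [Mem.set, hm.sum, absSum, Finset.sum_range_succ]
    · rw [Nat.abs_cast, Nat.cast_le]
      refine le_trans ?_ hD.absSum_le
      exact Finset.sum_le_sum_of_subset (by simpa using hk)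
    refine Halts.put hU le_rfl (k + 1 : ℕ) (by simp) ?_ ?_ (Halts.skip hU ?_)
    · simp [Mem.set, hm.k]
    · rw [Nat.abs_cast, Nat.cast_le]
      exact le_trans hk hD.L_le
    · refine ⟨?_, ?_, ?_, ?_, ?_, ?_⟩
      · simp [Mem.set, hm.n]
      · simp [Mem.set, hm.N]
      · simp [Mem.set, hm.L]
      · simp [Mem.set]
      · simp [Mem.set]
      · intro a ha i
        simp [Mem.set, ha.ne, hm.zero a ha]
  · intro m hm
    simp [hm.k, hm.L]

/-! ### The table of powers -/

/-- Compute the parameters and the table. -/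
def fillTable : Cmd :=
  put 3 (var 3 / var 2 + .const 3) ;; put 4 (var 0 * var 1 * var 3) ;;
  put 5 (.const 8 * var 0 * (var 4 * var 4 * var 4) + .const 1) ;;
  put 6 (var 0 * (var 4 * var 4 * (var 4 * var 4))) ;; put 7 (var 1 * var 2) ;;
  .assign 2 (.const 0) (var 6) ;; put 10 (.const 0) ;;
  .loop (ltExpr (var 10 + .const 1) (var 5))
    (.assign 2 (var 10 + .const 1) (((var 4 * var 4 - .const 1) * .mem 2 (var 10) -
        var 4 * .mem 3 (var 10)) / (var 4 * var 4)) ;;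
      .assign 3 (var 10 + .const 1) ((var 4 * .mem 2 (var 10) +
        (var 4 * var 4 - .const 1) * .mem 3 (var 10)) / (var 4 * var 4)) ;;
      put 10 (var 10 + .const 1) ;; .skip)

/-- The state of the memory after the first `j + 1` entries of the table have been computed. -/
structure Tabulated (D : UtilityData) (j : ℕ) (m : Mem) : Prop where
  n : m 4 0 = D.n
  N : m 4 1 = D.N
  L : m 4 2 = D.L
  M : m 4 4 = D.M
  base : m 4 5 = D.base
  scale : m 4 6 = D.scale
  coeffScale : m 4 7 = D.coeffScale
  table : ∀ a ≤ j, m 2 a = (D.table a).1 ∧ m 3 a = (D.table a).2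

theorem Tabulated.congr {j : ℕ} {m m' : Mem} (h : D.Tabulated j m) (h₂ : m' 2 = m 2)
    (h₃ : m' 3 = m 3) (h₄ : ∀ i < 8, m' 4 i = m 4 i) : D.Tabulated j m' where
  n := (h₄ 0 (by norm_num)).trans h.n
  N := (h₄ 1 (by norm_num)).trans h.N
  L := (h₄ 2 (by norm_num)).trans h.L
  M := (h₄ 4 (by norm_num)).trans h.M
  base := (h₄ 5 (by norm_num)).trans h.base
  scale := (h₄ 6 (by norm_num)).trans h.scale
  coeffScale := (h₄ 7 (by norm_num)).trans h.coeffScale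
  table a ha := by rw [h₂, h₃]; exact h.table a ha

theorem Tabulated.set_var {j : ℕ} {m : Mem} (h : D.Tabulated j m) {i : ℤ} (hi : 8 ≤ i) (v : ℤ) :
    D.Tabulated j (m.set 4 i v) :=
  h.congr (by funext k; simp [Mem.set]) (by funext k; simp [Mem.set]) fun k hk => by
    simp [Mem.set, (hk.trans_le hi).ne]

theorem Tabulated.set_weight {j : ℕ} {m : Mem} (h : D.Tabulated j m) (i v : ℤ) :
    D.Tabulated j (m.set 1 i v) :=
  h.congr (by funext k; simp [Mem.set]) (by funext k; simp [Mem.set]) fun k _ => by simp [Mem.set]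

theorem halts_fillTable (hD : D.Admissible U) {m : Mem} (hm : D.Started D.L m) :
    Halts I U fillTable m 2 fun m' =>
      D.Tabulated D.maxExp m' ∧ (∀ i, m' 0 i = 0) ∧ ∀ i, m' 1 i = 0 := by
  have hU := hD.one_le
  refine Halts.put hU (by norm_num) D.coeffBound (by simp) (by simp [hm.sum, hm.L, coeffBound])
    (by simpa using hD.coeffBound_le) ?_
  refine Halts.put hU (by norm_num) D.M (by simp) (by simp [Mem.set, hm.n, hm.N, M])
    (by simpa using hD.M_le) ?_
  refine Halts.put hU (by norm_num) D.base (by simp) ?_ (by simpa using hD.base_le) ?_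
  · simp [Mem.set, hm.n, base, maxExp]
    left
    ring
  refine Halts.put hU (by norm_num) D.scale (by simp) ?_ (by simpa using hD.scale_le) ?_
  · simp [Mem.set, hm.n, scale]
    left
    ring
  refine Halts.put hU (by norm_num) D.coeffScale (by simp)
    (by simp [Mem.set, hm.N, hm.L, coeffScale]) (by simpa using hD.coeffScale_le) ?_
  -- Only the real part of entry `0` has to be written; array `3` is still zero.
  refine Halts.assign hU (by norm_num) 0 D.scale (by simp) (by simp) (by simp)
    (by simp [Mem.set]) (by simpa using hD.scale_le) ?_
  refine Halts.put hU (by norm_num) 0 (by simp) (by simp) (by simp) ?_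
  have hmax : D.maxExp ≤ U := (Nat.le_succ _).trans hD.base_le
  refine (Halts.loop hU le_rfl le_rfl (by simp) (fun j m' => D.Tabulated j m' ∧ m' 4 10 = j ∧
    (∀ i, m' 0 i = 0) ∧ ∀ i, m' 1 i = 0) D.maxExp hmax ?_ ?_ ?_).mono hU le_rfl le_rfl
    fun m' h => ⟨h.1, h.2.2⟩
  · refine ⟨⟨?_, ?_, ?_, ?_, ?_, ?_, ?_, ?_⟩, ?_, ?_, ?_⟩
    · simp [Mem.set, hm.n]
    · simp [Mem.set, hm.N]
    · simp [Mem.set, hm.L]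
    · simp [Mem.set]
    · simp [Mem.set]
    · simp [Mem.set]
    · simp [Mem.set]
    · intro a ha
      obtain rfl : a = 0 := by omega
      simp [Mem.set, UtilityData.table, hm.zero]
    · simp [Mem.set]
    · simp [Mem.set, hm.zero]
    · simp [Mem.set, hm.zero]
  · rintro a ha m' ⟨h, h10, h0, h1⟩
    obtain ⟨t1, t2⟩ := h.table a le_rfl
    refine ⟨?_, ?_⟩
    · have : (a : ℤ) < D.maxExp := by exact_mod_cast ha
      simp [h10, h.base, base, this]
    refine Halts.assign hU le_rfl (a + 1 : ℕ) (D.table (a + 1)).1 (by simp) (by simp)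
      (by simp [h10]) ?_ (hD.table_le _ ha).1 ?_
    · simp [h10, h.M, t1, t2, UtilityData.table]
    refine Halts.assign hU le_rfl (a + 1 : ℕ) (D.table (a + 1)).2 (by simp) (by simp)
      (by simp [Mem.set, h10]) ?_ (hD.table_le _ ha).2 ?_
    · simp [Mem.set, h10, h.M, t1, t2, UtilityData.table]
    refine Halts.put hU le_rfl (a + 1 : ℕ) (by simp) (by simp [Mem.set, h10]) ?_
      (Halts.skip hU ?_)
    · rw [Nat.abs_cast, Nat.cast_le]; exact le_trans ha hmax
    refine ⟨⟨?_, ?_, ?_, ?_, ?_, ?_, ?_, ?_⟩, ?_, ?_, ?_⟩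
    · simp [Mem.set, h.n]
    · simp [Mem.set, h.N]
    · simp [Mem.set, h.L]
    · simp [Mem.set, h.M]
    · simp [Mem.set, h.base]
    · simp [Mem.set, h.scale]
    · simp [Mem.set, h.coeffScale]
    · intro b hb
      rcases Nat.lt_or_ge a b with hab | hab
      · obtain rfl : b = a + 1 := by omega
        simp [Mem.set]
      · have : (b : ℤ) ≠ a + 1 := by omega
        simpa [Mem.set, this] using h.table b hab
    · simp [Mem.set]
    · simp [Mem.set, h0]
    · simp [Mem.set, h1]
  · rintro m' ⟨h, h10, -, -⟩
    simp [h10, h.base, base]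

/-! ### The weights -/

/-- Find the exponent of the current element and the current term. -/
def findExponent : Cmd :=
  .loop (ltExpr (.const 60 * var 0 * (var 4 * var 4 * var 4))
      (absExpr (.mem 2 (var 10) - var 11) + absExpr (.mem 3 (var 10) - var 12)))
    (put 10 (var 10 + .const 1) ;; .skip)

/-- Compute the weights of the exact problem. -/
def computeWeights : Cmd :=
  .loop (ltExpr (var 9) (var 0))
    (put 13 (.const 1) ;; put 8 (.const 0) ;;
      .loop (ltExpr (var 8) (var 2))
        (put 11 (.inp 6 ![var 1, var 8, var 9, var 6]) ;;
          put 12 (.inp 7 ![var 1, var 8, var 9, var 6]) ;;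
          put 10 (.const 0) ;; findExponent ;;
          .assign 1 (var 9) (.mem 1 (var 9) + var 10 * var 13) ;;
          put 13 (var 13 * var 5) ;; put 8 (var 8 + .const 1) ;; .skip) ;;
      put 9 (var 9 + .const 1) ;; .skip)

/-- The linear search stops exactly at the infimum defining `exponent`. By `exponent_le` it never
leaves the computed table. -/
theorem halts_findExponent (hD : D.Admissible U) {m : Mem} (h : D.Tabulated D.maxExp m) {k e : ℕ}
    (hk : k < D.L) (he : e < D.n) (h10 : m 4 10 = 0) (h11 : m 4 11 = D.eRe k e D.scale)
    (h12 : m 4 12 = D.eIm k e D.scale) :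
    Halts I U findExponent m 2 fun m' => m' = m.set 4 10 (D.exponent k e) := by
  have hU := hD.one_le
  have hle := hD.exponent_le k hk e he
  have hmax : D.maxExp ≤ U := (Nat.le_succ _).trans hD.base_le
  have htol : (D.tolerance : ℤ) = 60 * D.n * (D.M * D.M * D.M) := by
    simp only [tolerance]; push_cast; ring
  have hguard : ∀ a ≤ D.exponent k e,
      (ltExpr (.const 60 * var 0 * (var 4 * var 4 * var 4))
        (absExpr (.mem 2 (var 10) - var 11) + absExpr (.mem 3 (var 10) - var 12))).eval I
        (m.set 4 10 a) = if (D.tolerance : ℤ) < D.dist k e a then 1 else 0 := by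
    intro a ha
    obtain ⟨t1, t2⟩ := h.table a (ha.trans hle)
    simp [Mem.set, h11, h12, h.n, h.M, t1, t2, htol, dist]
  refine Halts.loop hU le_rfl le_rfl (by simp) (fun (a : ℕ) m' => m' = m.set 4 10 a)
    (D.exponent k e) (hle.trans hmax) ?_ ?_ ?_
  · funext a i
    by_cases hai : a = 4 ∧ i = 10
    · simp [hai, h10, Mem.set]
    · rw [Mem.set, if_neg hai]
  · rintro a ha _ rfl
    have hlt : (D.tolerance : ℤ) < D.dist k e a := by
      by_contra hcon
      exact Nat.notMem_of_lt_sInf ha (not_lt.1 hcon)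
    refine ⟨by rw [hguard a ha.le]; simp [hlt], ?_⟩
    refine Halts.put hU le_rfl (a + 1 : ℕ) (by simp) (by simp [Mem.set]) ?_ (Halts.skip hU ?_)
    · rw [Nat.abs_cast, Nat.cast_le]; omega
    · funext b i
      simp only [Mem.set]
      split_ifs <;> rfl
  · rintro _ rfl
    rw [hguard _ le_rfl, if_neg (not_lt.2 (hD.dist_le k hk e he))]

/-- The state of the memory after the first `e` weights have been computed. -/
structure Weighted (D : UtilityData) (e : ℕ) (m : Mem) : Prop where
  tab : D.Tabulated D.maxExp m
  out : ∀ i, m 0 i = 0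
  elt : m 4 9 = e
  pow : 0 < e → m 4 13 = (D.base ^ D.L : ℕ)
  weight : ∀ z, m 1 z = if 0 ≤ z ∧ z.toNat < e then (D.weight z.toNat : ℤ) else 0

/-- The state of the memory after the first `j` digits of the weight of `e` have been computed. -/
structure Weighting (D : UtilityData) (e j : ℕ) (m : Mem) : Prop where
  tab : D.Tabulated D.maxExp m
  out : ∀ i, m 0 i = 0
  elt : m 4 9 = e
  k : m 4 8 = j
  pow : m 4 13 = (D.base ^ j : ℕ)
  weight : ∀ z : ℤ, z ≠ e → m 1 z = if 0 ≤ z ∧ z.toNat < e then (D.weight z.toNat : ℤ) else 0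
  weight_elt : m 1 e = D.partialWeight j e

/-- Three nested loops, over elements, terms and candidate exponents, account for the power `4`. -/
theorem halts_computeWeights (hD : D.Admissible U) (hI : D.IsInput N₀ J I) {m : Mem}
    (hm : D.Tabulated D.maxExp m) (h0 : ∀ i, m 0 i = 0) (h1 : ∀ i, m 1 i = 0) (h9 : m 4 9 = 0) :
    Halts I U computeWeights m 4 (D.Weighted D.n) := by
  have hU := hD.one_le
  have hpow : ∀ j ≤ D.L, D.base ^ j ≤ U := fun j hj =>
    (Nat.pow_le_pow_right (Nat.succ_pos _) hj).trans hD.pow_le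
  refine Halts.loop hU (by norm_num : 1 ≤ 3) le_rfl (by simp) D.Weighted D.n hD.n_le ?_ ?_ ?_
  · exact ⟨hm, h0, by simp [h9], by simp, by simp [h1]⟩
  · intro e he m hm
    refine ⟨by simp [hm.elt, hm.tab.n, he], ?_⟩
    refine Halts.put hU (by norm_num) 1 (by simp) (by simp) (by simpa using hU) ?_
    refine Halts.put hU (by norm_num) 0 (by simp) (by simp) (by simp) ?_
    refine Halts.seq hU (Halts.loop hU (by norm_num : 1 ≤ 2) le_rfl (by simp) (D.Weighting e) D.L
      hD.L_le ?_ ?_ ?_) ?_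
    · refine ⟨(hm.tab.set_var (by norm_num) _).set_var (by norm_num) _, ?_, ?_, ?_, ?_, ?_, ?_⟩
      · simp [Mem.set, hm.out]
      · simp [Mem.set, hm.elt]
      · simp [Mem.set]
      · simp [Mem.set]
      · intro z _
        simp [Mem.set, hm.weight]
      · simp [Mem.set, hm.weight, partialWeight]
    · intro k hk m hm
      refine ⟨by simp [hm.k, hm.tab.L, hk], ?_⟩
      refine Halts.put_inp hU (by norm_num) (D.eRe k e D.scale) ?_ ?_ (hD.eRe_le k hk e he) ?_
      · simp [Fin.forall_fin_succ]
      · simp [hm.tab.N, hm.k, hm.elt, hm.tab.scale, hI.eRe]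
      refine Halts.put_inp hU (by norm_num) (D.eIm k e D.scale) ?_ ?_ (hD.eIm_le k hk e he) ?_
      · simp [Fin.forall_fin_succ]
      · simp [Mem.set, hm.tab.N, hm.k, hm.elt, hm.tab.scale, hI.eIm]
      refine Halts.put hU (by norm_num) 0 (by simp) (by simp) (by simp) ?_
      have htab := ((hm.tab.set_var (by norm_num : (8 : ℤ) ≤ 11) (D.eRe k e D.scale)).set_var
        (by norm_num : (8 : ℤ) ≤ 12) (D.eIm k e D.scale)).set_var (by norm_num : (8 : ℤ) ≤ 10) 0
      refine Halts.seq hU (halts_findExponent hD htab hk he (by simp [Mem.set])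
        (by simp [Mem.set]) (by simp [Mem.set])) ?_
      rintro _ rfl
      have hpw := hD.partialWeight_lt (k + 1) hk e he
      refine Halts.assign hU (by norm_num) e (D.partialWeight (k + 1) e) (by simp) (by simp)
        (by simp [Mem.set, hm.elt]) ?_ ?_ ?_
      · simp [Mem.set, hm.elt, hm.weight_elt, hm.pow, partialWeight, Finset.sum_range_succ]
      · rw [Nat.abs_cast, Nat.cast_le]
        exact hpw.le.trans (hpow _ hk)
      refine Halts.put hU (by norm_num) (D.base ^ (k + 1) : ℕ) (by simp) ?_ ?_ ?_
      · simp [Mem.set, hm.pow, hm.tab.base, pow_succ]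
      · rw [Nat.abs_cast, Nat.cast_le]
        exact hpow _ hk
      refine Halts.put hU (by norm_num) (k + 1 : ℕ) (by simp) ?_ ?_ (Halts.skip hU ?_)
      · simp [Mem.set, hm.k]
      · rw [Nat.abs_cast, Nat.cast_le]
        exact le_trans hk hD.L_le
      refine ⟨?_, ?_, ?_, ?_, ?_, ?_, ?_⟩
      · exact (((htab.set_var (by norm_num) _).set_weight _ _).set_var (by norm_num) _).set_var
          (by norm_num) _
      · simp [Mem.set, hm.out]
      · simp [Mem.set, hm.elt]
      · simp [Mem.set]
      · simp [Mem.set]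
      · intro z hz
        simp [Mem.set, hz, hm.weight z hz]
      · simp [Mem.set]
    · intro m hm
      simp [hm.k, hm.tab.L]
    · intro m hm
      refine Halts.put hU (by norm_num) (e + 1 : ℕ) (by simp) ?_ ?_ (Halts.skip hU ?_)
      · simp [hm.elt]
      · rw [Nat.abs_cast, Nat.cast_le]
        exact le_trans he hD.n_le
      refine ⟨hm.tab.set_var (by norm_num) _, ?_, ?_, ?_, ?_⟩
      · simp [Mem.set, hm.out]
      · simp [Mem.set]
      · intro _
        simp [Mem.set, hm.pow]
      · intro z
        by_cases hz : z = e
        · subst hz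
          simp [Mem.set, hm.weight_elt, UtilityData.weight]
        · have : (0 ≤ z ∧ z.toNat < e + 1) ↔ (0 ≤ z ∧ z.toNat < e) := by omega
          have hz' : m.set 4 9 (e + 1 : ℕ) 1 z = m 1 z := by simp [Mem.set]
          rw [hz', hm.weight z hz]
          exact if_congr this.symm rfl rfl
  · intro m hm
    simp [hm.elt, hm.tab.n]

end UtilityData

namespace UtilityData

open RAM

variable {D : UtilityData} {U : ℕ} {I : RAM.Input}

/-- The table indexed by `ℤ` that represents a function on `Fin n`. -/
def extend {n : ℕ} (f : Fin n → ℕ) (z : ℤ) : ℤ :=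
  if h : 0 ≤ z ∧ z.toNat < n then (f ⟨z.toNat, h.2⟩ : ℤ) else 0

theorem extend_coe {n : ℕ} (f : Fin n → ℕ) (e : Fin n) : extend f ((e : ℕ) : ℤ) = f e := by
  simp [extend]

theorem set_extend {n : ℕ} {f g : Fin n → ℕ} {m : Mem} (hm : ∀ z, m 1 z = extend f z) (e : Fin n)
    {v : ℤ} (hv : v = g e) (hfg : ∀ x, x ≠ e → g x = f x) (z : ℤ) :
    m.set 1 ((e : ℕ) : ℤ) v 1 z = extend g z := by
  by_cases hz : z = ((e : ℕ) : ℤ)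
  · subst hz
    simp [Mem.set, extend_coe, hv]
  · have : m.set 1 ((e : ℕ) : ℤ) v 1 z = m 1 z := by simp [Mem.set, hz]
    rw [this, hm]
    unfold extend
    split_ifs with h
    · rw [hfg]
      rintro rfl
      apply hz
      simp [Int.toNat_of_nonneg h.1]
    · rfl

open Classical in
/-- The program `oracle` decides whether some set in `F` has exactly the weight that is the content
of cell `14` of array `4`, for the weights in array `1`. -/
def Decides (I : RAM.Input) (U n : ℕ) (F : Set (Finset (Fin n))) (oracle : Cmd) (κ p : ℕ) : Prop :=
  ∀ (wt : Fin n → ℕ) (K : ℕ) (m : Mem), K ≤ U → (∀ e, wt e ≤ U) → m 4 14 = K →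
    (∀ z, m 1 z = extend wt z) → Triple I U oracle m κ p fun m' =>
      ∀ a < 5, m' a = m.set 4 19 (if ∃ S ∈ F, ∑ e ∈ S, wt e = K then 1 else 0) a

/-! ### The search for the best vector of exponents -/

/-- Compute the value of the current vector of exponents. -/
def evalValue : Cmd :=
  put 20 (var 14) ;; put 15 (.const 0) ;; put 8 (.const 0) ;;
  .loop (ltExpr (var 8) (var 2))
    (put 11 (.inp 4 ![var 1, var 8, var 7]) ;; put 12 (.inp 5 ![var 1, var 8, var 7]) ;;
      put 10 (var 20 - var 5 * (var 20 / var 5)) ;;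
      put 15 (var 15 + (var 11 * .mem 2 (var 10) - var 12 * .mem 3 (var 10))) ;;
      put 20 (var 20 / var 5) ;; put 8 (var 8 + .const 1) ;; .skip)

/-- Auxiliary variables of the search. -/
def scratch : Finset ℤ := {8, 10, 11, 12, 15, 19, 20}

theorem Tabulated.of_agree {j : ℕ} {m m' : Mem} (h : D.Tabulated j m) (ha : Agree scratch m m') :
    D.Tabulated j m' := by
  refine h.congr (funext fun i => ha 2 (by norm_num) i (by norm_num))
    (funext fun i => ha 3 (by norm_num) i (by norm_num)) fun i hi => ha 4 (by norm_num) i ?_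
  intro _ hs
  simp only [scratch, Finset.mem_insert, Finset.mem_singleton] at hs
  omega

theorem Agree.var {m m' : Mem} (ha : Agree scratch m m') (i : ℤ) (hi : i ∉ scratch) :
    m' 4 i = m 4 i := ha 4 (by norm_num) i fun _ => hi

theorem halts_evalValue (hD : D.Admissible U) {N₀ J : ℕ} (hI : D.IsInput N₀ J I) {j : ℕ}
    (hj : 2 ≤ j) {m : Mem} {K : ℕ} (hm : D.Tabulated D.maxExp m) (hK : m 4 14 = K) (hKU : K ≤ U) :
    Halts I U evalValue m j fun m' => Agree scratch m m' ∧ m' 4 15 = D.value K := by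
  have hU := hD.one_le
  refine Halts.put hU (by omega) K (by simp) (by simp [hK]) (by simpa using hKU) ?_
  refine Halts.put hU (by omega) 0 (by simp) (by simp) (by simp) ?_
  refine Halts.put hU (by omega) 0 (by simp) (by simp) (by simp) ?_
  refine (Halts.loop hU le_rfl hj (by simp) (fun k m' => Agree scratch m m' ∧ m' 4 8 = k ∧
    m' 4 15 = D.partialValue K k ∧ m' 4 20 = (K / D.base ^ k : ℕ)) D.L hD.L_le ?_ ?_ ?_).mono hU
    le_rfl le_rfl fun m' h => ⟨h.1, h.2.2.1⟩
  · refine ⟨?_, ?_, ?_, ?_⟩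
    · exact (((Agree.refl _ m).set (by simp [scratch]) _).set (by simp [scratch]) _).set
        (by simp [scratch]) _
    · simp [Mem.set]
    · simp [Mem.set, partialValue]
    · simp [Mem.set]
  · rintro k hk m' ⟨ha, h8, h15, h20⟩
    have ht := hm.of_agree ha
    refine ⟨by simp [h8, ht.L, hk], ?_⟩
    refine Halts.put_inp hU le_rfl (D.cRe k D.coeffScale) ?_ ?_ (hD.cRe_le k hk).2 ?_
    · simp [Fin.forall_fin_succ]
    · simp [ht.N, ht.coeffScale, h8, hI.cRe]
    refine Halts.put_inp hU le_rfl (D.cIm k D.coeffScale) ?_ ?_ (hD.cIm_le k hk).2 ?_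
    · simp [Fin.forall_fin_succ]
    · simp [Mem.set, ht.N, ht.coeffScale, h8, hI.cIm]
    -- The lookup stays inside the table for every `K`, whether or not it is the weight of a set.
    have hlt : K / D.base ^ k % D.base < D.base := Nat.mod_lt _ (Nat.succ_pos _)
    refine Halts.put hU le_rfl (K / D.base ^ k % D.base : ℕ) (by simp) ?_ ?_ ?_
    · have h1 : ((K / D.base ^ k : ℕ) : ℤ) % D.base =
          (K / D.base ^ k : ℕ) - D.base * (((K / D.base ^ k : ℕ) : ℤ) / D.base) :=
        Int.emod_def _ _
      rw [Int.natCast_mod, h1]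
      simp [Mem.set, h20, ht.base]
    · rw [Nat.abs_cast, Nat.cast_le]
      exact hlt.le.trans hD.base_le
    obtain ⟨t1, t2⟩ := ht.table _ (Nat.lt_succ_iff.1 hlt)
    refine Halts.put hU le_rfl (D.partialValue K (k + 1)) (by simp) ?_
      (hD.partialValue_le K _ hk) ?_
    · have e : ∀ z : ℤ, Mem.set (Mem.set (Mem.set m' 4 11 (D.cRe k D.coeffScale)) 4 12
          (D.cIm k D.coeffScale)) 4 10 z 2 = m' 2 := fun z => by funext i; simp [Mem.set]
      have e' : ∀ z : ℤ, Mem.set (Mem.set (Mem.set m' 4 11 (D.cRe k D.coeffScale)) 4 12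
          (D.cIm k D.coeffScale)) 4 10 z 3 = m' 3 := fun z => by funext i; simp [Mem.set]
      simp only [eval_add, eval_sub, eval_mul, eval_var, eval_mem, e, e']
      have e10 : ∀ z : ℤ, Mem.set (Mem.set (Mem.set m' 4 11 (D.cRe k D.coeffScale)) 4 12
          (D.cIm k D.coeffScale)) 4 10 z 4 10 = z := fun z => by simp [Mem.set]
      rw [e10, t1, t2, partialValue, Finset.sum_range_succ, term]
      simp [Mem.set, h15, partialValue]
    refine Halts.put hU le_rfl (K / D.base ^ (k + 1) : ℕ) (by simp) ?_ ?_ ?_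
    · simp [Mem.set, h20, ht.base, pow_succ, ← Int.ediv_ediv_of_nonneg]
    · rw [Nat.abs_cast, Nat.cast_le]
      exact (Nat.div_le_self _ _).trans hKU
    refine Halts.put hU le_rfl (k + 1 : ℕ) (by simp) (by simp [Mem.set, h8]) ?_ (Halts.skip hU ?_)
    · rw [Nat.abs_cast, Nat.cast_le]
      exact le_trans hk hD.L_le
    refine ⟨?_, ?_, ?_, ?_⟩
    · exact (((((ha.set (by simp [scratch]) _).set (by simp [scratch]) _).set
        (by simp [scratch]) _).set (by simp [scratch]) _).set (by simp [scratch]) _).set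
        (by simp [scratch]) _
    · simp [Mem.set]
    · simp [Mem.set]
    · simp [Mem.set]
  · rintro m' ⟨ha, h8, -, -⟩
    simp [h8, (hm.of_agree ha).L]

/-- Update the best value if the current target is the weight of a feasible set. -/
def updateBest : Cmd :=
  .ite (var 19)
    (evalValue ;;
      .ite (.op .eq (var 18) (.const 0) + ltExpr (var 16) (var 15))
        (put 16 (var 15) ;; put 17 (var 14) ;; put 18 (.const 1) ;; .skip) .skip) .skip ;;
  put 14 (var 14 + .const 1) ;; .skip

/-- Find the weight of a feasible set with the best value. -/
def selectBest (oracle : Cmd) : Cmd :=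
  (put 14 (.const 0) ;; put 18 (.const 0) ;; .skip) ;;
    .loop (ltExpr (var 14) (var 13)) (oracle ;; updateBest)

/-- The state of the memory at the target `K`, when the feasible sets of weight less than `b` have
been taken into account. -/
structure Searching (D : UtilityData) (F : Set (Finset (Fin D.n))) (K b : ℕ) (m : Mem) : Prop where
  tab : D.Tabulated D.maxExp m
  out : ∀ i, m 0 i = 0
  pow : m 4 13 = (D.base ^ D.L : ℕ)
  target : m 4 14 = K
  weight : ∀ z, m 1 z = extend (fun e : Fin D.n => D.weight e) z
  best : (m 4 18 = 0 ∧ ∀ S ∈ F, b ≤ D.setWeight S) ∨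
    m 4 18 = 1 ∧ ∃ S ∈ F, m 4 17 = D.setWeight S ∧ m 4 16 = D.value (D.setWeight S) ∧
      ∀ S' ∈ F, D.setWeight S' < b → D.value (D.setWeight S') ≤ D.value (D.setWeight S)

variable {F : Set (Finset (Fin D.n))}

theorem Searching.of_agree {K b : ℕ} {m m' : Mem} (h : D.Searching F K b m)
    (ha : Agree scratch m m') : D.Searching F K b m' where
  tab := h.tab.of_agree ha
  out i := (ha 0 (by norm_num) i (by norm_num)).trans (h.out i)
  pow := (Agree.var ha 13 (by simp [scratch])).trans h.pow
  target := (Agree.var ha 14 (by simp [scratch])).trans h.target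
  weight z := (ha 1 (by norm_num) z (by norm_num)).trans (h.weight z)
  best := by
    rw [Agree.var ha 18 (by simp [scratch]), Agree.var ha 17 (by simp [scratch]),
      Agree.var ha 16 (by simp [scratch])]
    exact h.best

theorem weight_le (hD : D.Admissible U) (e : Fin D.n) : D.weight e ≤ U :=
  (hD.partialWeight_lt D.L le_rfl e e.2).le.trans hD.pow_le

theorem halts_updateBest (hD : D.Admissible U) {N₀ J : ℕ} (hI : D.IsInput N₀ J I) {j : ℕ}
    (hj : 2 ≤ j) {m : Mem} {K : ℕ} (hm : D.Searching F K K m) (hK : K < D.base ^ D.L)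
    (h₁ : m 4 19 ≠ 0 → ∃ S ∈ F, D.setWeight S = K)
    (h₀ : m 4 19 = 0 → ¬ ∃ S ∈ F, D.setWeight S = K) :
    Halts I U updateBest m j (D.Searching F (K + 1) (K + 1)) := by
  have hU := hD.one_le
  have hKU : K < U := hK.trans_le hD.pow_le
  -- In between, the sets of weight `K` are accounted for while the target cell still contains `K`.
  refine Halts.seq (Q' := D.Searching F K (K + 1)) hU ?_ ?_
  · refine Halts.ite hU (by omega) (by simp) ?_ ?_
    · intro h19
      obtain ⟨S, hS, hSK⟩ := h₁ h19
      refine Halts.seq hU (halts_evalValue hD hI hj hm.tab hm.target hKU.le) ?_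
      rintro m' ⟨ha, h15⟩
      have hm' := hm.of_agree ha
      refine Halts.ite hU (by omega) (by simp) ?_ ?_
      · intro hc
        refine Halts.put hU (by omega) (D.value K) (by simp) (by simp [h15])
          (hD.partialValue_le K _ le_rfl) ?_
        refine Halts.put hU (by omega) K (by simp) (by simp [Mem.set, hm'.target])
          (by simpa using hKU.le) ?_
        refine Halts.put hU (by omega) 1 (by simp) (by simp) (by simpa using hU) (Halts.skip hU ?_)
        refine ⟨((hm'.tab.set_var (by norm_num) _).set_var (by norm_num) _).set_var
          (by norm_num) _, ?_, ?_, ?_, ?_, Or.inr ⟨by simp [Mem.set], S, hS, ?_, ?_, ?_⟩⟩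
        · simp [Mem.set, hm'.out]
        · simp [Mem.set, hm'.pow]
        · simp [Mem.set, hm'.target]
        · simp [Mem.set, hm'.weight]
        · simp [Mem.set, hSK]
        · simp [Mem.set, hSK]
        · intro S' hS' hlt
          rw [hSK]
          rcases Nat.lt_succ_iff_lt_or_eq.1 hlt with hlt | heq
          · rcases hm'.best with ⟨-, hb⟩ | ⟨h18, S₂, -, -, h16, hb⟩
            · exact absurd (hb S' hS') (by omega)
            · have h3 : m' 4 16 < m' 4 15 := by
                by_contra hcon
                apply hc
                simp [h18, hcon]
              rw [h15, h16] at h3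
              exact (hb S' hS' hlt).trans h3.le
          · rw [heq]
      · intro hc
        refine Halts.skip hU ⟨hm'.tab, hm'.out, hm'.pow, hm'.target, hm'.weight, Or.inr ?_⟩
        rcases hm'.best with ⟨h18, -⟩ | ⟨h18, S₂, hS₂, h17, h16, hb⟩
        · exfalso
          by_cases h : m' 4 16 < m' 4 15 <;> simp [h18, h] at hc
        · refine ⟨h18, S₂, hS₂, h17, h16, fun S' hS' hlt => ?_⟩
          rcases Nat.lt_succ_iff_lt_or_eq.1 hlt with hlt | heq
          · exact hb S' hS' hlt
          · have h3 : ¬ m' 4 16 < m' 4 15 := by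
              intro hcon
              simp [h18, hcon] at hc
            rw [h15, h16] at h3
            rw [heq]
            exact not_lt.1 h3
    · intro h19
      have hno := h₀ h19
      refine Halts.skip hU ⟨hm.tab, hm.out, hm.pow, hm.target, hm.weight, ?_⟩
      rcases hm.best with ⟨h18, hb⟩ | ⟨h18, S₂, hS₂, h17, h16, hb⟩
      · exact Or.inl ⟨h18, fun S hS =>
          lt_of_le_of_ne (hb S hS) fun h => hno ⟨S, hS, h.symm⟩⟩
      · refine Or.inr ⟨h18, S₂, hS₂, h17, h16, fun S' hS' hlt => hb S' hS' ?_⟩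
        exact lt_of_le_of_ne (Nat.lt_succ_iff.1 hlt) fun h => hno ⟨S', hS', h⟩
  · intro m' hm'
    refine Halts.put hU (by omega) (K + 1 : ℕ) (by simp) (by simp [hm'.target]) ?_
      (Halts.skip hU ?_)
    · rw [Nat.abs_cast, Nat.cast_le]; exact hKU
    refine ⟨hm'.tab.set_var (by norm_num) _, ?_, ?_, ?_, ?_, ?_⟩
    · simp [Mem.set, hm'.out]
    · simp [Mem.set, hm'.pow]
    · simp [Mem.set]
    · simp [Mem.set, hm'.weight]
    · simpa [Mem.set] using hm'.best

theorem agree_of_eq {m m' : Mem} {v : ℤ} (h : ∀ a < 5, m' a = m.set 4 19 v a) :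
    Agree scratch m m' := by
  intro a ha i hi
  rw [h a ha]
  exact (Agree.refl scratch m).set (by simp [scratch]) v a ha i hi

/-- The weight of `selectBest` for an oracle of weight `κ`. -/
def selectCost (κ : ℕ) : ℕ := 1 + (put 14 (.const 0) ;; put 18 (.const 0) ;; .skip).weight +
  2 * (1 + (ltExpr (var 14) (var 13)).weight + (1 + κ + updateBest.weight))

/-- All feasible sets have weight below `base ^ L`, so an exhaustive search over targets sees each
attained vector of exponents. Sets of equal weight have equal value, so a yes/no oracle is enough.
-/
theorem triple_selectBest (hD : D.Admissible U) {N₀ J : ℕ} (hI : D.IsInput N₀ J I) {oracle : Cmd}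
    {κ p q : ℕ} (hor : Decides I U D.n F oracle κ p) (hpq : p ≤ q) (hq : 2 ≤ q) {m : Mem}
    (hm : D.Weighted D.n m) :
    Triple I U (selectBest oracle) m
      (selectCost κ) (q + 1)
      (D.Searching F (D.base ^ D.L) (D.base ^ D.L)) := by
  classical
  have hU := hD.one_le
  refine Triple.seq (Q' := D.Searching F 0 0) hU ?_ ?_
  · refine Halts.put hU (by omega) 0 (by simp) (by simp) (by simp) ?_
    refine Halts.put hU (by omega) 0 (by simp) (by simp) (by simp) (Halts.skip hU ?_)
    refine ⟨(hm.tab.set_var (by norm_num) _).set_var (by norm_num) _, ?_, ?_, ?_, ?_,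
      Or.inl ⟨by simp [Mem.set], by simp⟩⟩
    · simp [Mem.set, hm.out]
    -- The limit `base ^ L` of the search is left in cell `13` by the last element processed, which
    -- exists since the ground set is nonempty.
    · simp [Mem.set, hm.pow hD.n_pos]
    · simp [Mem.set]
    · intro z
      simp only [Mem.set, hm.weight z, extend]
      simp
  · intro m' hm'
    refine Triple.loop hU (by omega) (by simp) (fun K => D.Searching F K K) (D.base ^ D.L)
      hD.pow_le hm' ?_ ?_
    · intro K hK m hm
      refine ⟨?_, ?_⟩
      · have : (K : ℤ) < (D.base ^ D.L : ℕ) := by exact_mod_cast hK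
        simp only [eval_ltExpr, eval_var, hm.target, hm.pow, this, if_true]
        exact one_ne_zero
      refine Triple.seq hU ((hor (fun e => D.weight e) K m (hK.le.trans hD.pow_le)
        (weight_le hD) hm.target hm.weight).mono hU le_rfl hpq fun _ h => h) ?_
      intro m' hm'
      have h19 : m' 4 19 = if ∃ S ∈ F, ∑ e ∈ S, D.weight e = K then 1 else 0 := by
        rw [hm' 4 (by norm_num)]; simp [Mem.set]
      refine halts_updateBest hD hI hq (hm.of_agree (agree_of_eq hm')) hK ?_ ?_
      · intro h
        by_contra hcon
        exact h (h19.trans (if_neg hcon))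
      · intro h hcon
        exact one_ne_zero ((h19.trans (if_pos hcon)).symm.trans h)
    · intro m hm
      simp [hm.target, hm.pow]

/-! ### The reconstruction of a set from its weight -/

/-- Exclude the current element. -/
def excludeElt : Cmd := put 21 (.mem 1 (var 9)) ;; .assign 1 (var 9) (var 14 + .const 1) ;; .skip

/-- Keep the current element if it cannot be excluded, and go to the next one. -/
def decideElt : Cmd :=
  .ite (var 19) .skip (.assign 1 (var 9) (var 21) ;; .assign 0 (var 9) (.const 1) ;; .skip) ;;
  put 9 (var 9 + .const 1) ;; .skip

/-- Find a feasible set whose weight is the best one. -/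
def reconstruct (oracle : Cmd) : Cmd :=
  (put 14 (var 17) ;; put 9 (.const 0) ;; .skip) ;;
    .loop (ltExpr (var 9) (var 0)) (excludeElt ;; oracle ;; decideElt)

/-- The weights when the elements below `e` outside of `G` are excluded from sets of weight `K`. -/
noncomputable def exclWeight (D : UtilityData) (K e : ℕ) (G : Finset (Fin D.n)) (x : Fin D.n) : ℕ :=
  if (x : ℕ) < e ∧ x ∉ G then K + 1 else D.weight x

/-- An element of weight `K + 1` cannot occur in a set of weight `K`. Thus elements are forbidden
through the weights alone, leaving the instance unchanged. -/
theorem sum_exclWeight_eq_iff (K e : ℕ) (G S : Finset (Fin D.n)) :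
    ∑ x ∈ S, D.exclWeight K e G x = K ↔
      D.setWeight S = K ∧ ∀ x ∈ S, (x : ℕ) < e → x ∈ G := by
  constructor
  · intro h
    have hx : ∀ x ∈ S, (x : ℕ) < e → x ∈ G := by
      intro x hx hxe
      by_contra hG
      have := Finset.single_le_sum (f := fun x => D.exclWeight K e G x)
        (fun _ _ => Nat.zero_le _) hx
      simp only [exclWeight, hxe, hG, not_false_eq_true, and_self, if_true] at this h
      omega
    refine ⟨?_, hx⟩
    rw [← h]
    refine Finset.sum_congr rfl fun x hxS => ?_
    rw [exclWeight, if_neg]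
    rintro ⟨h1, h2⟩
    exact h2 (hx x hxS h1)
  · rintro ⟨h, hx⟩
    rw [← h]
    refine Finset.sum_congr rfl fun x hxS => ?_
    rw [exclWeight, if_neg]
    rintro ⟨h1, h2⟩
    exact h2 (hx x hxS h1)

/-- The state of the memory when `G` is the set of those elements below `e` that are kept. -/
structure Excluding (D : UtilityData) (F : Set (Finset (Fin D.n))) (K e : ℕ) (m : Mem)
    (G : Finset (Fin D.n)) : Prop where
  n : m 4 0 = D.n
  target : m 4 14 = K
  elt : m 4 9 = e
  lt : ∀ x ∈ G, (x : ℕ) < e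
  out : ∀ x : Fin D.n, m 0 ((x : ℕ) : ℤ) = if x ∈ G then 1 else 0
  weight : ∀ z, m 1 z = extend (D.exclWeight K e G) z
  exists_mem : ∃ S ∈ F, D.setWeight S = K ∧ ∀ x ∈ S, (x : ℕ) < e → x ∈ G
  subset : ∀ S ∈ F, D.setWeight S = K → (∀ x ∈ S, (x : ℕ) < e → x ∈ G) → G ⊆ S

/-- If no suitable set remains after excluding `e`, then every set compatible with the earlier
decisions contains `e`. So kept elements are forced, which preserves the `subset` field of the
invariant; otherwise the exclusion is made permanent. -/
theorem triple_decideElt (hD : D.Admissible U) {oracle : Cmd} {κ p q : ℕ}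
    (hor : Decides I U D.n F oracle κ p) (hpq : p ≤ q) (hq : 1 ≤ q) {m : Mem} {K : ℕ}
    (hK : K < D.base ^ D.L) {e : ℕ} (he : e < D.n) {G : Finset (Fin D.n)}
    (hm : D.Excluding F K e m G) :
    Triple I U (excludeElt ;; oracle ;; decideElt) m
      (1 + excludeElt.weight + (1 + κ + decideElt.weight)) q
      fun m' => ∃ G', D.Excluding F K (e + 1) m' G' := by
  classical
  have hU := hD.one_le
  have hKU : K < U := hK.trans_le hD.pow_le
  obtain ⟨x₀, hx₀⟩ : ∃ x₀ : Fin D.n, (x₀ : ℕ) = e := ⟨⟨e, he⟩, rfl⟩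
  have hx₀G : x₀ ∉ G := fun h => by have := hm.lt x₀ h; omega
  have hw : m 1 e = D.weight e := by
    rw [← hx₀, hm.weight, extend_coe, exclWeight, if_neg]
    omega
  have hwU : |(D.weight e : ℤ)| ≤ U := by
    rw [Nat.abs_cast, Nat.cast_le, ← hx₀]; exact weight_le hD x₀
  refine Triple.seq (Q' := fun m' => m' = (m.set 4 21 (D.weight e)).set 1 e (K + 1 : ℕ)) hU ?_ ?_
  · refine Halts.put hU hq (D.weight e) (by simp) (by simp [hm.elt, hw]) hwU ?_
    refine Halts.assign hU hq e (K + 1 : ℕ) (by simp) (by simp) (by simp [Mem.set, hm.elt])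
      (by simp [Mem.set, hm.target]) ?_ (Halts.skip hU rfl)
    rw [Nat.abs_cast, Nat.cast_le]; exact hKU
  rintro _ rfl
  set m₁ := (m.set 4 21 (D.weight e)).set 1 e (K + 1 : ℕ) with hm₁
  have hw₁ : ∀ z, m₁ 1 z = extend (D.exclWeight K (e + 1) G) z := by
    intro z
    rw [hm₁, ← hx₀]
    refine set_extend (f := D.exclWeight K e G) (fun z => ?_) x₀ ?_ ?_ z
    · simp [Mem.set, hm.weight]
    · simp [exclWeight, hx₀G]
    · intro x hx
      have : (x : ℕ) ≠ e := fun h => hx (Fin.ext (h.trans hx₀.symm))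
      have h2 : (x : ℕ) < x₀ + 1 ↔ (x : ℕ) < e := by omega
      simp only [exclWeight, h2]
  refine Triple.seq hU ((hor (D.exclWeight K (e + 1) G) K m₁ hKU.le ?_ (by
    simp [hm₁, Mem.set, hm.target]) hw₁).mono hU le_rfl hpq fun _ h => h) ?_
  · intro x
    unfold exclWeight
    split_ifs
    · exact hKU
    · exact weight_le hD x
  intro m₂ hm₂
  have hlt : ∀ x : Fin D.n, (x : ℕ) < e + 1 ↔ (x : ℕ) < e ∨ x = x₀ := by
    intro x
    rw [Fin.ext_iff, hx₀]; omega
  have h4 : ∀ i, i ≠ 19 → m₂ 4 i = (m.set 4 21 (D.weight e)) 4 i := by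
    intro i hi
    rw [hm₂ 4 (by norm_num)]
    simp [hm₁, Mem.set, hi]
  have h0 : m₂ 0 = m 0 := by
    rw [hm₂ 0 (by norm_num)]
    funext i
    simp [hm₁, Mem.set]
  have h1 : ∀ z, m₂ 1 z = extend (D.exclWeight K (e + 1) G) z := by
    intro z
    rw [hm₂ 1 (by norm_num), ← hw₁]
    simp [Mem.set]
  have h19 : m₂ 4 19 = if ∃ S ∈ F, ∑ x ∈ S, D.exclWeight K (e + 1) G x = K then 1 else 0 := by
    rw [hm₂ 4 (by norm_num)]; simp [Mem.set]
  simp only [sum_exclWeight_eq_iff] at h19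
  have hn : m₂ 4 0 = D.n := by rw [h4 0 (by norm_num)]; simp [Mem.set, hm.n]
  have ht : m₂ 4 14 = K := by rw [h4 14 (by norm_num)]; simp [Mem.set, hm.target]
  have h9 : m₂ 4 9 = e := by rw [h4 9 (by norm_num)]; simp [Mem.set, hm.elt]
  have h21 : m₂ 4 21 = D.weight e := by rw [h4 21 (by norm_num)]; simp [Mem.set]
  refine Halts.seq (Q' := fun m' => m' 4 0 = D.n ∧ m' 4 14 = K ∧ m' 4 9 = e ∧
    ∃ G' : Finset (Fin D.n),
    (∀ x ∈ G', (x : ℕ) < e + 1) ∧ (∀ x : Fin D.n, m' 0 ((x : ℕ) : ℤ) = if x ∈ G' then 1 else 0) ∧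
    (∀ z, m' 1 z = extend (D.exclWeight K (e + 1) G') z) ∧
    (∃ S ∈ F, D.setWeight S = K ∧ ∀ x ∈ S, (x : ℕ) < e + 1 → x ∈ G') ∧
    ∀ S ∈ F, D.setWeight S = K → (∀ x ∈ S, (x : ℕ) < e + 1 → x ∈ G') → G' ⊆ S) hU ?_ ?_
  · refine Halts.ite hU hq (by simp) ?_ ?_
    · intro hne
      have hex : ∃ S ∈ F, D.setWeight S = K ∧ ∀ x ∈ S, (x : ℕ) < e + 1 → x ∈ G := by
        by_contra hcon
        exact hne (h19.trans (if_neg hcon))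
      refine Halts.skip hU ⟨hn, ht, h9, G, fun x hx => (hm.lt x hx).trans (Nat.lt_succ_self e),
        fun x => by rw [h0, hm.out x], h1, hex, fun S hS hSK hSG => ?_⟩
      exact hm.subset S hS hSK fun x hx hxe => hSG x hx (by omega)
    · intro heq
      have hno : ¬ ∃ S ∈ F, D.setWeight S = K ∧ ∀ x ∈ S, (x : ℕ) < e + 1 → x ∈ G := by
        intro hcon
        rw [eval_var, h19, if_pos hcon] at heq
        exact one_ne_zero heq
      refine Halts.assign hU hq e (D.weight e) (by simp) (by simp) (by simp [h9])
        (by simp [h21]) hwU ?_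
      refine Halts.assign hU hq e 1 (by simp) (by simp) (by simp [Mem.set, h9])
        (by simp) (by simpa using hU) (Halts.skip hU ?_)
      refine ⟨by simp [Mem.set, hn], by simp [Mem.set, ht], by simp [Mem.set, h9], insert x₀ G,
        ?_, ?_, ?_, ?_, ?_⟩
      · intro x hx
        rcases Finset.mem_insert.1 hx with rfl | hx
        · omega
        · exact (hm.lt x hx).trans (Nat.lt_succ_self e)
      · intro x
        by_cases hx : x = x₀
        · subst hx
          simp [Mem.set, hx₀]
        · have : (x : ℕ) ≠ e := fun h => hx (Fin.ext (h.trans hx₀.symm))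
          simp [Mem.set, hx, this, h0, hm.out x]
      · intro z
        have : ∀ m : Mem, ∀ v : ℤ, m.set 0 e v 1 z = m 1 z := fun m v => by simp [Mem.set]
        rw [this, ← hx₀]
        refine set_extend (f := D.exclWeight K (e + 1) G) h1 x₀ ?_ ?_ z
        · simp [exclWeight]
        · intro x hx
          simp [exclWeight, hx, hx₀]
      · obtain ⟨S, hS, hSK, hSG⟩ := hm.exists_mem
        refine ⟨S, hS, hSK, fun x hx hxe => ?_⟩
        rcases (hlt x).1 hxe with h | rfl
        · exact Finset.mem_insert_of_mem (hSG x hx h)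
        · exact Finset.mem_insert_self _ _
      · intro S hS hSK hSG
        have hSG' : ∀ x ∈ S, (x : ℕ) < e → x ∈ G := by
          intro x hx hxe
          rcases Finset.mem_insert.1 (hSG x hx (by omega)) with rfl | h
          · omega
          · exact h
        refine Finset.insert_subset ?_ (hm.subset S hS hSK hSG')
        by_contra hx₀S
        refine hno ⟨S, hS, hSK, fun x hx hxe => ?_⟩
        rcases (hlt x).1 hxe with h | rfl
        · exact hSG' x hx h
        · exact absurd hx hx₀S
  · rintro m' ⟨hn, ht, h9, G', hG1, hG2, hG3, hG4, hG5⟩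
    refine Halts.put hU hq (e + 1 : ℕ) (by simp) (by simp [h9]) ?_ (Halts.skip hU ?_)
    · rw [Nat.abs_cast, Nat.cast_le]
      exact le_trans he hD.n_le
    refine ⟨G', ?_, ?_, ?_, hG1, ?_, ?_, hG4, hG5⟩
    · simp [Mem.set, hn]
    · simp [Mem.set, ht]
    · simp [Mem.set]
    · intro x
      simp [Mem.set, hG2]
    · intro z
      simp [Mem.set, hG3]

/-- The weight of `reconstruct` for an oracle of weight `κ`. -/
def reconstructCost (κ : ℕ) : ℕ := 1 + (put 14 (var 17) ;; put 9 (.const 0) ;; .skip).weight +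
  2 * (1 + (ltExpr (var 9) (var 0)).weight + (1 + excludeElt.weight + (1 + κ + decideElt.weight)))

theorem triple_reconstruct (hD : D.Admissible U) {oracle : Cmd} {κ p q : ℕ}
    (hor : Decides I U D.n F oracle κ p) (hpq : p ≤ q) (hq : 1 ≤ q) {m : Mem}
    (hF : F.Nonempty) (hm : D.Searching F (D.base ^ D.L) (D.base ^ D.L) m) :
    Triple I U (reconstruct oracle) m
      (reconstructCost κ) (q + 1)
      fun m' => outputSet D.n m' ∈ F ∧
        ∀ S ∈ F, D.value (D.setWeight S) ≤ D.value (D.setWeight (outputSet D.n m')) := by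
  classical
  have hU := hD.one_le
  obtain ⟨S₀, hS₀, h17, hbest⟩ : ∃ S ∈ F, m 4 17 = D.setWeight S ∧
      ∀ S' ∈ F, D.value (D.setWeight S') ≤ D.value (D.setWeight S) := by
    -- The search cannot have ended empty-handed: it passed the weight of every feasible set, and
    -- there is one.
    rcases hm.best with ⟨-, hb⟩ | ⟨-, S, hS, h17, -, hb⟩
    · obtain ⟨S, hS⟩ := hF
      exact absurd (hb S hS) (not_le.2 (hD.setWeight_lt S))
    · exact ⟨S, hS, h17, fun S' hS' => hb S' hS' (hD.setWeight_lt S')⟩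
  have hK := hD.setWeight_lt S₀
  set K := D.setWeight S₀ with hKdef
  refine Triple.seq (Q' := fun m' => ∃ G, D.Excluding F K 0 m' G) hU ?_ ?_
  · refine Halts.put hU (by omega) K (by simp) (by simp [h17]) ?_ ?_
    · rw [Nat.abs_cast, Nat.cast_le]
      exact hK.le.trans hD.pow_le
    refine Halts.put hU (by omega) 0 (by simp) (by simp) (by simp) (Halts.skip hU ⟨∅, ?_⟩)
    refine ⟨?_, ?_, ?_, ?_, ?_, ?_, ⟨S₀, hS₀, rfl, ?_⟩, ?_⟩
    · simp [Mem.set, hm.tab.n]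
    · simp [Mem.set]
    · simp [Mem.set]
    · simp
    · simp [Mem.set, hm.out]
    · intro z
      simp [Mem.set, hm.weight, extend, exclWeight]
    · simp
    · simp
  intro m' hm'
  refine (Triple.loop hU hq (by simp) (fun e m' => ∃ G, D.Excluding F K e m' G) D.n hD.n_le
    hm' ?_ ?_).mono hU le_rfl le_rfl ?_
  · rintro e he m ⟨G, hG⟩
    exact ⟨by simp [hG.elt, hG.n, he], triple_decideElt hD hor hpq hq hK he hG⟩
  · rintro m ⟨G, hG⟩
    simp [hG.elt, hG.n]
  · rintro m' ⟨G, hG⟩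
    have hout : outputSet D.n m' = G := by
      ext x
      simp [outputSet, hG.out x]
    obtain ⟨S, hS, hSK, hSG⟩ := hG.exists_mem
    -- After the last element the restriction `x < e` is void, so a witness lies inside `G`, and `G`
    -- inside every witness.
    have hGS : G = S :=
      (hG.subset S hS hSK hSG).antisymm fun x hx => hSG x hx x.2
    rw [hout, hGS, hSK]
    exact ⟨hS, hbest⟩

/-! ### The algorithm -/

/-- The algorithm for accuracy `1 / (N * J)`, where `1 / N` is the accuracy in the input. -/
def algorithm (oracle : Cmd) (J : ℕ) : Cmd :=
  readParams J ;; fillTable ;; (put 9 (.const 0) ;; computeWeights) ;; selectBest oracle ;;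
    reconstruct oracle

/-- The constants are chosen before data and input, so they depend only on the oracle and `J`. The
exponent `max p 3 + 1` covers one loop around the oracle as well as the power `4` of
`computeWeights`. -/
theorem triple_algorithm (oracle : Cmd) (κ p J : ℕ) (hJ : 1 ≤ J) : ∃ b q, ∀ (D : UtilityData)
    (U N₀ : ℕ) (I : RAM.Input) (F : Set (Finset (Fin D.n))), D.Admissible U → D.IsInput N₀ J I →
    Decides I U D.n F oracle κ p → F.Nonempty →
    Triple I U (algorithm oracle J) 0 b q fun m' => outputSet D.n m' ∈ F ∧
        ∀ S ∈ F, D.value (D.setWeight S) ≤ D.value (D.setWeight (outputSet D.n m')) := by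
  refine ⟨1 + (readParams J).weight + (1 + fillTable.weight +
    (1 + (put 9 (.const 0) ;; computeWeights).weight + (1 + selectCost κ + reconstructCost κ))),
    max p 3 + 1, fun D U N₀ I F hD hI hor hF => ?_⟩
  have hU := hD.one_le
  refine Triple.seq hU ((halts_readParams hD hI hJ).mono hU le_rfl (by omega) fun _ h => h) ?_
  intro m hm
  refine Triple.seq hU ((halts_fillTable hD hm).mono hU le_rfl (by omega) fun _ h => h) ?_
  rintro m ⟨hm, h0, h1⟩
  refine Triple.seq (Q' := D.Weighted D.n) (b₁ := (put 9 (.const 0) ;; computeWeights).weight) hU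
    ?_ ?_
  · refine Halts.put hU (by omega) 0 (by simp) (by simp) (by simp) ?_
    refine (halts_computeWeights hD hI (hm.set_var (by norm_num) _) ?_ ?_ ?_).mono hU le_rfl
      (by omega) fun _ h => h
    · simp [Mem.set, h0]
    · simp [Mem.set, h1]
    · simp [Mem.set]
  intro m hm
  refine Triple.seq hU (triple_selectBest hD hI hor (le_max_left p 3) (by omega) hm) ?_
  intro m hm
  exact triple_reconstruct hD hor (le_max_left p 3) (by omega) hF hm

end UtilityData

/-! ### Bounds for the intermediate results -/

theorem Presents.abs_le {f : ℕ → ℤ} {x : ℝ} (h : Presents f x) {B : ℕ} (hB : |x| ≤ B) (m : ℕ) :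
    |f m| ≤ (m * B + 1 : ℕ) := by
  have h1 := h m
  have h2 := abs_sub_abs_le_abs_sub (f m : ℝ) (m * x)
  have h3 : |(m : ℝ) * x| ≤ m * B := by
    rw [abs_mul, Nat.abs_cast]
    gcongr
  have h4 : |(f m : ℝ)| ≤ m * B + 1 := by linarith
  exact_mod_cast h4

namespace UtilityData.Correct

open RAM

variable {D : UtilityData} {E : ExpSum}

/-- Everything is measured in powers of `u = M ^ L`, which dominates `M`, `L`, `n`, `N` and
`coeffBound`. Coefficients are at most `u ^ 4`, table entries `u ^ 7` and targets `u ^ 6`; the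
largest numbers, sums of at most `L` terms of two such products each, reach `u ^ 13`. -/
theorem admissible {W : RandomWeights D.n} (h : D.Correct E W) :
    D.Admissible (D.M ^ (13 * D.L)) := by
  have hM6 := h.six_le_M
  have hM2 : 2 ≤ D.M := by omega
  have hn := h.n_pos
  have hN := h.N_pos
  have hL := h.L_pos
  have hc3 := three_le_coeffBound D
  obtain ⟨u, hu⟩ : ∃ u, u = D.M ^ D.L := ⟨_, rfl⟩
  have hU : D.M ^ (13 * D.L) = u ^ 13 := by rw [hu, ← pow_mul, mul_comm]
  have hMu : D.M ≤ u := hu ▸ Nat.le_self_pow hL.ne' _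
  have hu6 : 6 ≤ u := hM6.trans hMu
  have hLu : D.L ≤ u := by
    rw [hu]; exact (Nat.lt_pow_self (by omega)).le
  have hmono : ∀ {a b : ℕ}, a ≤ b → u ^ a ≤ u ^ b := fun h => Nat.pow_le_pow_right (by omega) h
  have hsucc : ∀ a, u ^ a + 1 ≤ u ^ (a + 1) := by
    intro a
    have : 1 ≤ u ^ a := Nat.one_le_pow _ _ (by omega)
    rw [pow_succ]; nlinarith
  have hnM : D.n ≤ D.M := by
    rw [M, mul_assoc]; exact Nat.le_mul_of_pos_right _ (by positivity)
  have hNM : D.N ≤ D.M := by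
    rw [M, mul_comm D.n, mul_assoc]; exact Nat.le_mul_of_pos_right _ (by positivity)
  have hcM : D.coeffBound ≤ D.M := by
    rw [M]; exact Nat.le_mul_of_pos_left _ (by positivity)
  have hpow : ∀ {a b : ℕ}, a ≤ u ^ b → b ≤ 13 → a ≤ u ^ 13 := fun h h' => h.trans (hmono h')
  have hu1 : u = u ^ 1 := (pow_one u).symm
  have hbaseM : D.base ≤ D.M ^ 6 := by
    have h1 : D.maxExp ≤ 8 * D.M ^ 4 := by
      rw [maxExp]
      calc 8 * D.n * D.M ^ 3 ≤ 8 * D.M * D.M ^ 3 := by gcongr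
        _ = 8 * D.M ^ 4 := by ring
    have h2 : 1 ≤ D.M ^ 4 := Nat.one_le_pow _ _ (by omega)
    have h3 : D.M ^ 6 = D.M * D.M * D.M ^ 4 := by ring
    have h4 : 9 ≤ D.M * D.M := by nlinarith
    have h5 := Nat.mul_le_mul_right (D.M ^ 4) h4
    rw [base, h3]
    omega
  have hbase : D.base ≤ u ^ 6 := hbaseM.trans (Nat.pow_le_pow_left hMu 6)
  have hscale : D.scale ≤ u ^ 5 := by
    rw [scale]
    calc D.n * D.M ^ 4 ≤ u * u ^ 4 := by gcongr; exact hnM.trans hMu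
      _ = u ^ 5 := by ring
  have hcs : D.coeffScale ≤ u ^ 2 := by
    rw [coeffScale, pow_two]
    exact Nat.mul_le_mul (hNM.trans hMu) hLu
  have hcu : D.coeffBound ≤ u := hcM.trans hMu
  have hnorm : ∀ k : Fin E.L, ‖E.c k‖ ≤ D.coeffBound := fun k =>
    (Finset.single_le_sum (f := fun k => ‖E.c k‖) (fun _ _ => norm_nonneg _)
      (Finset.mem_univ k)).trans h.coeffNorm_le.1
  have hc : ∀ k < D.L, ∀ m ≤ u ^ 2, |D.cRe k m| ≤ (u ^ 4 : ℕ) ∧ |D.cIm k m| ≤ (u ^ 4 : ℕ) := by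
    intro k hk m hm
    have hk' : k < E.L := h.L_eq ▸ hk
    have hb : m * D.coeffBound + 1 ≤ u ^ 4 := by
      refine le_trans ?_ (hsucc 3)
      gcongr
      rw [pow_succ]
      exact Nat.mul_le_mul hm hcu
    have hb' : ((m * D.coeffBound + 1 : ℕ) : ℤ) ≤ (u ^ 4 : ℕ) := by exact_mod_cast hb
    exact ⟨((h.cRe ⟨k, hk'⟩).abs_le ((Complex.abs_re_le_norm _).trans (hnorm _)) m).trans hb',
      ((h.cIm ⟨k, hk'⟩).abs_le ((Complex.abs_im_le_norm _).trans (hnorm _)) m).trans hb'⟩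
  have he : ∀ k < D.L, ∀ e < D.n,
      |D.eRe k e D.scale| ≤ (u ^ 6 : ℕ) ∧ |D.eIm k e D.scale| ≤ (u ^ 6 : ℕ) := by
    intro k hk e he
    have hk' : k < E.L := h.L_eq ▸ hk
    have h1 : ‖E.expect W ⟨k, hk'⟩ ⟨e, he⟩‖ ≤ (1 : ℕ) := by
      simpa using E.norm_expect_le_one W ⟨k, hk'⟩ ⟨e, he⟩
    have hb : D.scale * 1 + 1 ≤ u ^ 6 := by
      refine le_trans ?_ (hsucc 5)
      omega
    have hb' : ((D.scale * 1 + 1 : ℕ) : ℤ) ≤ (u ^ 6 : ℕ) := by exact_mod_cast hb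
    exact ⟨((h.eRe ⟨k, hk'⟩ ⟨e, he⟩).abs_le ((Complex.abs_re_le_norm _).trans h1) _).trans hb',
      ((h.eIm ⟨k, hk'⟩ ⟨e, he⟩).abs_le ((Complex.abs_im_le_norm _).trans h1) _).trans hb'⟩
  have ht : ∀ a ≤ D.maxExp, |(D.table a).1| ≤ (u ^ 7 : ℕ) ∧ |(D.table a).2| ≤ (u ^ 7 : ℕ) := by
    intro a ha
    have hb : D.scale + 2 * a ≤ u ^ 7 := by
      have h1 : a ≤ u ^ 6 := ha.trans ((Nat.le_succ _).trans hbase)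
      have h2 : u ^ 5 ≤ u ^ 6 := hmono (by norm_num)
      have h3 : u ^ 7 = u * u ^ 6 := by ring
      nlinarith
    have hb' : ((D.scale + 2 * a : ℕ) : ℤ) ≤ (u ^ 7 : ℕ) := by exact_mod_cast hb
    have := D.abs_table_le hM2 a
    exact ⟨this.1.trans hb', this.2.trans hb'⟩
  have hcast : ∀ {a b : ℕ}, a ≤ b → (a : ℤ) ≤ b := fun h => by exact_mod_cast h
  rw [hU]
  refine
    { one_le := Nat.one_le_pow _ _ (by omega)
      n_pos := hn
      n_le := hpow ((hnM.trans hMu).trans_eq hu1) (by norm_num)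
      N_le := hpow ((hNM.trans hMu).trans_eq hu1) (by norm_num)
      L_le := hpow (hLu.trans_eq hu1) (by norm_num)
      absSum_le := ?_
      coeffBound_le := hpow (hcu.trans_eq hu1) (by norm_num)
      M_le := hpow (hMu.trans_eq hu1) (by norm_num)
      base_le := hpow hbase (by norm_num)
      scale_le := hpow hscale (by norm_num)
      coeffScale_le := hpow hcs (by norm_num)
      pow_le := ?_
      cRe_le := fun k hk => ?_
      cIm_le := fun k hk => ?_
      eRe_le := fun k hk e he' => (he k hk e he').1.trans (hcast (hmono (by norm_num)))
      eIm_le := fun k hk e he' => (he k hk e he').2.trans (hcast (hmono (by norm_num)))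
      table_le := fun a ha => ⟨(ht a ha).1.trans (hcast (hmono (by norm_num))),
        (ht a ha).2.trans (hcast (hmono (by norm_num)))⟩
      partialValue_le := ?_
      dist_le := fun k hk e he' => h.dist_exponent_le ⟨k, h.L_eq ▸ hk⟩ ⟨e, he'⟩
      exponent_le := fun k hk e he' => h.exponent_le_maxExp ⟨k, h.L_eq ▸ hk⟩ ⟨e, he'⟩
      partialWeight_lt := fun j hj e he' => h.partialWeight_lt j hj ⟨e, he'⟩
      setWeight_lt := h.setWeight_lt }
  · have h1 : D.absSum D.L < D.L * (D.absSum D.L / D.L + 1) := Nat.lt_mul_div_succ _ hL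
    have h2 : D.L * (D.absSum D.L / D.L + 1) ≤ D.L * D.coeffBound :=
      Nat.mul_le_mul_left _ (by rw [coeffBound]; omega)
    have h3 : D.L * D.coeffBound ≤ u ^ 2 := by
      rw [pow_two]; exact Nat.mul_le_mul hLu hcu
    exact hpow (h1.le.trans (h2.trans h3)) (by norm_num)
  · calc D.base ^ D.L ≤ (D.M ^ 6) ^ D.L := Nat.pow_le_pow_left hbaseM _
      _ = u ^ 6 := by rw [hu, ← pow_mul, ← pow_mul, mul_comm]
      _ ≤ u ^ 13 := hmono (by norm_num)
  · have hL2 : D.L ≤ u ^ 2 := hLu.trans (Nat.le_self_pow (by norm_num) u)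
    exact ⟨(hc k hk _ hL2).1.trans (hcast (hmono (by norm_num))),
      (hc k hk _ hcs).1.trans (hcast (hmono (by norm_num)))⟩
  · have hL2 : D.L ≤ u ^ 2 := hLu.trans (Nat.le_self_pow (by norm_num) u)
    exact ⟨(hc k hk _ hL2).2.trans (hcast (hmono (by norm_num))),
      (hc k hk _ hcs).2.trans (hcast (hmono (by norm_num)))⟩
  · intro K j hj
    have hterm : ∀ k ∈ Finset.range j, |D.term K k| ≤ (u ^ 12 : ℕ) := by
      intro k hk
      have hk' : k < D.L := (Finset.mem_range.1 hk).trans_le hj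
      have hlt : K / D.base ^ k % D.base < D.base := Nat.mod_lt _ (Nat.succ_pos _)
      have t := ht _ (Nat.lt_succ_iff.1 hlt)
      have c := hc k hk' _ hcs
      have h1 := mul_le_mul c.1 t.1 (abs_nonneg _) (by positivity)
      have h2 := mul_le_mul c.2 t.2 (abs_nonneg _) (by positivity)
      rw [← abs_mul] at h1 h2
      refine (abs_sub _ _).trans ((add_le_add h1 h2).trans ?_)
      have : u ^ 4 * u ^ 7 + u ^ 4 * u ^ 7 ≤ u ^ 12 := by
        have h3 : u ^ 4 * u ^ 7 + u ^ 4 * u ^ 7 = 2 * u ^ 11 := by ring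
        have h4 : u ^ 12 = u * u ^ 11 := by ring
        rw [h3, h4]
        exact Nat.mul_le_mul_right _ (by omega)
      exact_mod_cast this
    refine (Finset.abs_sum_le_sum_abs _ _).trans ((Finset.sum_le_sum hterm).trans ?_)
    rw [Finset.sum_const, Finset.card_range, nsmul_eq_mul]
    have : j * u ^ 12 ≤ u ^ 13 := by
      rw [pow_succ u 12, mul_comm (u ^ 12)]
      exact Nat.mul_le_mul_right _ (hj.trans hLu)
    exact_mod_cast this

/-- Since `n * N ≥ 2`, constant factors can be absorbed into the exponent: `7 * β ≤ β ^ 4` for `β ≥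
2`. -/
theorem M_le {n : ℕ} {W : RandomWeights n} (h : D.Correct E W) :
    (D.M : ℝ) ≤ ((D.n : ℝ) * D.N * max 1 E.coeffNorm) ^ 4 ∧
      2 ≤ (D.n : ℝ) * D.N * max 1 E.coeffNorm := by
  have hn : (1 : ℝ) ≤ D.n := by exact_mod_cast h.n_pos
  have hN : (2 : ℝ) ≤ D.N := by exact_mod_cast h.N_pos
  have hc := h.coeffNorm_le.2
  have h1 : (D.coeffBound : ℝ) ≤ 7 * max 1 E.coeffNorm := by
    linarith [le_max_left 1 E.coeffNorm, le_max_right 1 E.coeffNorm]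
  have hmax : 1 ≤ max 1 E.coeffNorm := le_max_left _ _
  have hM : (D.M : ℝ) = D.n * D.N * D.coeffBound := by simp [M]
  have hnN : 2 ≤ (D.n : ℝ) * D.N := by nlinarith
  have h2 : 2 ≤ (D.n : ℝ) * D.N * max 1 E.coeffNorm := by nlinarith
  refine ⟨?_, h2⟩
  have h3 : (D.M : ℝ) ≤ 7 * (D.n * D.N * max 1 E.coeffNorm) := by
    rw [hM]
    calc (D.n : ℝ) * D.N * D.coeffBound ≤ D.n * D.N * (7 * max 1 E.coeffNorm) := by gcongr
      _ = _ := by ring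
  set β := (D.n : ℝ) * D.N * max 1 E.coeffNorm
  have h4 : (2 : ℝ) ^ 3 ≤ β ^ 3 := by gcongr
  calc (D.M : ℝ) ≤ 7 * β := h3
    _ ≤ β ^ 3 * β := by gcongr; linarith
    _ = β ^ 4 := by ring

end UtilityData.Correct

/-! ### From the program to the approximation theorem -/

/-- The numerical data of an instance of the expected utility maximization problem. -/
def CombProblem.utilityData (A : CombProblem) (I : A.Inst) (N : ℕ) (es : ℕ → ExpSum) (X : Access) :
    UtilityData :=
  ⟨A.n I, N, (es N).L, X.cRe N, X.cIm N, X.eRe N, X.eIm N⟩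

/-- Near-optimal solutions of the expected utility maximization problem, with accuracy
`1 / (N * J)` instead of `1 / N`. -/
theorem CombProblem.exists_algorithm (A : CombProblem) (hA : A.HasPseudopolyExact) (J : ℕ)
    (hJ : 1 ≤ J) : ∃ (P : RAM.Cmd) (C : ℕ), ∀ (μ : ℝ≥0 → ℝ) (es : ℕ → ExpSum), Measurable μ →
      (∀ N : ℕ, 1 ≤ N → (es N).Approximates μ (1 / N)) → ∀ N : ℕ, 2 ≤ N * J →
      ∀ (I : A.Inst), 1 ≤ A.n I → (A.feasible I).Nonempty →
      ∀ (W : RandomWeights (A.n I)) (X : Access), X.Valid es W →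
      ∃ (m : RAM.Mem) (t : ℕ), RAM.Run (A.eumInput I N es X) P 0 m t ∧
        RAM.outputSet (A.n I) m ∈ A.feasible I ∧
        (∀ S ∈ A.feasible I, W.expectedUtility μ S - 262 / ((N * J : ℕ) : ℝ) ≤
          W.expectedUtility μ (RAM.outputSet (A.n I) m)) ∧
        (t : ℝ) ≤ ((A.n I : ℝ) * (N * J : ℕ) * max 1 (es (N * J)).coeffNorm) ^
          (C * (es (N * J)).L) := by
  classical
  obtain ⟨oracle, κ, p, hor⟩ := A.exists_isOracle hA
  obtain ⟨b, q, hbq⟩ := UtilityData.triple_algorithm oracle κ p J hJ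
  -- The time is at most `b * U ^ q` with `U = M ^ (13 * L)` and `M ≤ β ^ 4`, whence `52 = 4 * 13`;
  -- the factor `b ≤ 2 ^ b` is absorbed as `β ^ (b * L)`.
  refine ⟨UtilityData.algorithm oracle J, b + 52 * q, ?_⟩
  intro μ es hμ hes N hN I hn hF W X hX
  have hcor : (A.utilityData I (N * J) es X).Correct (es (N * J)) W :=
    { n_eq := rfl
      n_pos := hn
      N_pos := hN
      L_eq := rfl
      cRe := fun k => (hX (N * J) k).1
      cIm := fun k => (hX (N * J) k).2.1
      eRe := fun k e => ((hX (N * J) k).2.2 e).1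
      eIm := fun k e => ((hX (N * J) k).2.2 e).2 }
  have hadm := UtilityData.Correct.admissible (D := A.utilityData I (N * J) es X) hcor
  have hinp : (A.utilityData I (N * J) es X).IsInput N J (A.eumInput I N es X) :=
    { n := rfl
      acc := rfl
      N := rfl
      L := rfl
      cRe := fun _ _ => rfl
      cIm := fun _ _ => rfl
      eRe := fun _ _ _ => rfl
      eIm := fun _ _ _ => rfl }
  have hdec : UtilityData.Decides (A.eumInput I N es X)
      ((A.utilityData I (N * J) es X).M ^ (13 * (A.utilityData I (N * J) es X).L))
      (A.utilityData I (N * J) es X).n (A.feasible I) oracle κ p := fun wt K m hK hwt h14 hm =>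
    hor I N es X wt K _ m hadm.one_le hadm.n_le hK hwt h14 hm
  obtain ⟨m, t, hrun, ht, -, hout, hbest⟩ :=
    hbq _ _ N _ (A.feasible I) hadm hinp hdec hF (fun _ _ _ => by simp)
  refine ⟨m, t, hrun, hout, fun S hS => ?_, ?_⟩
  · exact hcor.expectedUtility_le_of_value_le hμ (hes _ (by omega)) (hbest S hS)
  · obtain ⟨hM, h2⟩ := hcor.M_le
    have hn' : (A.utilityData I (N * J) es X).n = A.n I := rfl
    have hN' : (A.utilityData I (N * J) es X).N = N * J := rfl
    have hL' : (A.utilityData I (N * J) es X).L = (es (N * J)).L := rfl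
    rw [hn', hN'] at hM h2
    rw [hL'] at ht
    set β := (A.n I : ℝ) * (N * J : ℕ) * max 1 (es (N * J)).coeffNorm
    set L := (es (N * J)).L
    have hLpos : 1 ≤ L := (es (N * J)).L_pos
    have hb : (b : ℝ) ≤ β ^ (b * L) := by
      calc (b : ℝ) ≤ (2 : ℝ) ^ b := by exact_mod_cast Nat.lt_two_pow_self.le
        _ ≤ β ^ b := by gcongr
        _ ≤ β ^ (b * L) := pow_le_pow_right₀ (by linarith) (Nat.le_mul_of_pos_right _ hLpos)
    calc (t : ℝ) ≤ b * ((A.utilityData I (N * J) es X).M ^ (13 * L)) ^ q := by exact_mod_cast ht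
      _ ≤ β ^ (b * L) * ((β ^ 4) ^ (13 * L)) ^ q := by gcongr
      _ = β ^ ((b + 52 * q) * L) := by
        rw [← pow_mul, ← pow_mul, ← pow_add]
        congr 1
        ring

theorem theorem1 (A : CombProblem) (hA : A.HasPseudopolyExact) :
    -- additive error `O(1/N)` in time `(nN)^{O(L)}`, for `ε = 1/N`
    (∃ (P : RAM.Cmd) (C : ℕ),
      ∀ (μ : ℝ≥0 → ℝ) (es : ℕ → ExpSum), Measurable μ →
      (∀ N : ℕ, 1 ≤ N → (es N).Approximates μ (1 / N)) →
      ∀ N : ℕ, 2 ≤ N →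
      ∀ (I : A.Inst), 1 ≤ A.n I → (A.feasible I).Nonempty →
      ∀ (W : RandomWeights (A.n I)) (X : Access), X.Valid es W →
      ∃ (m : RAM.Mem) (t : ℕ), RAM.Run (A.eumInput I N es X) P 0 m t ∧
        RAM.outputSet (A.n I) m ∈ A.feasible I ∧
        (∀ S ∈ A.feasible I, W.expectedUtility μ S - C * (1 / (N : ℝ)) ≤
          W.expectedUtility μ (RAM.outputSet (A.n I) m)) ∧
        (t : ℝ) ≤ ((A.n I : ℝ) * N * max 1 (es N).coeffNorm) ^ (C * (es N).L) ∧
        ∀ D : ℕ, (es N).coeffNorm ≤ (N : ℝ) ^ D →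
          (t : ℝ) ≤ ((A.n I : ℝ) * N) ^ (C * (D + 1) * (es N).L)) ∧
    -- a PTAS if the optimum is bounded below by a positive constant `κ`
    (∀ κ : ℝ, 0 < κ → ∃ P : RAM.Cmd,
      ∀ (μ : ℝ≥0 → ℝ) (es : ℕ → ExpSum), Measurable μ →
      (∀ N : ℕ, 1 ≤ N → (es N).Approximates μ (1 / N)) →
      ∀ N : ℕ, 1 ≤ N → ∃ d : ℕ,
      ∀ (I : A.Inst), 1 ≤ A.n I →
      ∀ (W : RandomWeights (A.n I)) (X : Access), X.Valid es W →
      (∃ S ∈ A.feasible I, κ ≤ W.expectedUtility μ S) →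
      ∃ (m : RAM.Mem) (t : ℕ), RAM.Run (A.eumInput I N es X) P 0 m t ∧
        RAM.outputSet (A.n I) m ∈ A.feasible I ∧
        (∀ S ∈ A.feasible I, (1 - 1 / (N : ℝ)) * W.expectedUtility μ S ≤
          W.expectedUtility μ (RAM.outputSet (A.n I) m)) ∧
        t ≤ d * A.n I ^ d) := by
  constructor
  · obtain ⟨P, C, h⟩ := A.exists_algorithm hA 1 le_rfl
    -- One constant serves both as factor of the additive error and in the exponent of the time
    -- bound.
    refine ⟨P, C + 262, ?_⟩
    intro μ es hμ hes N hN I hn hF W X hX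
    obtain ⟨m, t, hrun, hout, hbest, ht⟩ := h μ es hμ hes N (by omega) I hn hF W X hX
    simp only [mul_one] at hbest ht
    have hn' : (1 : ℝ) ≤ A.n I := by exact_mod_cast hn
    have hN' : (2 : ℝ) ≤ N := by exact_mod_cast hN
    have hnN : 1 ≤ (A.n I : ℝ) * N := by nlinarith
    have hmax : 1 ≤ max 1 (es N).coeffNorm := le_max_left _ _
    have hβ : 1 ≤ (A.n I : ℝ) * N * max 1 (es N).coeffNorm := by nlinarith
    have ht' : (t : ℝ) ≤ ((A.n I : ℝ) * N * max 1 (es N).coeffNorm) ^ ((C + 262) * (es N).L) :=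
      ht.trans (pow_le_pow_right₀ hβ (Nat.mul_le_mul_right _ (by omega)))
    refine ⟨m, t, hrun, hout, fun S hS => ?_, ht', fun D hD => ?_⟩
    · refine le_trans ?_ (hbest S hS)
      rw [mul_one_div]
      gcongr
      push_cast
      linarith [(Nat.cast_nonneg C : (0 : ℝ) ≤ C)]
    · refine ht'.trans ?_
      have h1 : max 1 (es N).coeffNorm ≤ ((A.n I : ℝ) * N) ^ D := by
        refine max_le (one_le_pow₀ hnN) (hD.trans ?_)
        gcongr
        nlinarith
      calc ((A.n I : ℝ) * N * max 1 (es N).coeffNorm) ^ ((C + 262) * (es N).L) ≤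
            ((A.n I : ℝ) * N * ((A.n I : ℝ) * N) ^ D) ^ ((C + 262) * (es N).L) := by gcongr
        _ = ((A.n I : ℝ) * N) ^ ((C + 262) * (D + 1) * (es N).L) := by
          rw [← pow_succ', ← pow_mul]
          congr 1
          ring
  · intro κ hκ
    -- The loss `262 / (N * J)` becomes at most `κ / N`, and `2 ≤ J` keeps `N * J ≥ 2` even for `N =
    -- 1`.
    obtain ⟨J, hJ2, hJκ⟩ : ∃ J : ℕ, 2 ≤ J ∧ 262 ≤ κ * J := by
      obtain ⟨J, hJ⟩ := exists_nat_ge (262 / κ)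
      refine ⟨J + 2, by omega, ?_⟩
      rw [div_le_iff₀ hκ] at hJ
      push_cast
      nlinarith
    obtain ⟨P, C, h⟩ := A.exists_algorithm hA J (by omega)
    refine ⟨P, ?_⟩
    intro μ es hμ hes N hN
    have hNJ : 2 ≤ N * J := by nlinarith
    obtain ⟨e, he⟩ : ∃ e, e = C * (es (N * J)).L := ⟨_, rfl⟩
    -- For fixed accuracy and exponential sums only `n` varies, so the other factors of the time
    -- bound form a constant.
    obtain ⟨c, hc⟩ := exists_nat_ge ((((N * J : ℕ) : ℝ) * max 1 (es (N * J)).coeffNorm) ^ e)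
    refine ⟨max e c, ?_⟩
    rintro I hn W X hX ⟨S₀, hS₀, hκS₀⟩
    obtain ⟨m, t, hrun, hout, hbest, ht⟩ := h μ es hμ hes N hNJ I hn ⟨S₀, hS₀⟩ W X hX
    refine ⟨m, t, hrun, hout, fun S hS => ?_, ?_⟩
    · have hN0 : (1 : ℝ) ≤ N := by exact_mod_cast hN
      have hJ0 : (2 : ℝ) ≤ J := by exact_mod_cast hJ2
      have hloss : 262 / ((N * J : ℕ) : ℝ) ≤ κ * (1 / N) := by
        push_cast
        rw [mul_one_div, div_le_div_iff₀ (by positivity) (by positivity)]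
        nlinarith
      have hδ0 : 0 < 1 / (N : ℝ) := by positivity
      have hδ1 : 1 / (N : ℝ) ≤ 1 := by rw [div_le_one (by positivity)]; exact hN0
      have key : ∀ S ∈ A.feasible I, κ ≤ W.expectedUtility μ S →
          (1 - 1 / (N : ℝ)) * W.expectedUtility μ S ≤
            W.expectedUtility μ (RAM.outputSet (A.n I) m) := by
        intro S hS hκS
        have := hbest S hS
        nlinarith
      -- Sets of utility below `κ`, possibly negative, are compared with `S₀`, for which the
      -- additive loss is known to be relatively small.
      rcases le_total κ (W.expectedUtility μ S) with hS' | hS'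
      · exact key S hS hS'
      · refine le_trans ?_ (key S₀ hS₀ hκS₀)
        exact mul_le_mul_of_nonneg_left (hS'.trans hκS₀) (by linarith)
    · have hn' : 1 ≤ A.n I := hn
      have h1 : (t : ℝ) ≤ c * (A.n I : ℝ) ^ e := by
        rw [← he, mul_assoc, mul_pow] at ht
        refine ht.trans ?_
        rw [mul_comm]
        gcongr
      have h2 : t ≤ c * A.n I ^ e := by exact_mod_cast h1
      exact h2.trans (Nat.mul_le_mul (le_max_right _ _)
        (Nat.pow_le_pow_right hn' (le_max_left _ _)))
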